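/- **Setting.** Let $S,A$ be finite sets and $g\notin S$ a goal state. A linear contextual stochastic shortest path problem has context space the simplex $\mathcal C=\{c\in\mathbb R^d: c_j\ge 0,\ \sum_j c_j=1\}$ and unknown $L^\star(s,a)\in\mathbb R^d$, $P^\star(s,a)\in\mathbb R^{|S|\times d}$, where every column of $P^\star(s,a)$ is a sub-probability vector on $S$ (the missing mass is the probability of moving to $g$). Under context $c$, action $a$ in state $s$ leads to $s'\in S$ with probability $P^c(s'\mid s,a)=\langle c,P^\star(s'\mid s,a)\rangle$ and incurs a random loss in $[\ell_{\min},1]$, $\ell_{\min}>0$, with mean $\ell^c(s,a)=\langle c,L^\star(s,a)\rangle$; $L^\star(s,a)\in[\ell_{\min},1]^d$. For losses $\ell\ge 0$ and dynamics $P$, $\mathcal V^\pi_{\ell,P}(s)\in[0,\infty]$ is the expected total loss of the stationary deterministic policy $\pi:S\to A$ until $g$ is reached from $s$; $\pi$ is proper if $g$ is reached with probability $1$ from every state. For every $c\in\mathcal C$ a proper policy exists, and $B_\star\ge1$ satisfies $\min_{\pi\text{ proper}}\mathcal V^\pi_{\ell^c,P^c}(s)\le B_\star$ for all $s\in S$,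 $c\in\mathcal C$. In each episode $k=1,2,\dots$ an adversary, who may use the past, chooses a context $c_k$, and the learner starts in an initial state (which may depend on $c_k$) and acts until reaching $g$. **Algorithm (LR-CSSP)** with parameters $\lambda\ge1$, $\delta\in(0,1)$, $\ell_{\min}$, $B_\star$. Time is divided into intervals $m=1,2,\dots$, each inside one episode; $c_m$ is the context in interval $m$. At the start of interval $m$ let $\tau_{s,a}$ be the number of past visits to $(s,a)$, $\bar V_m(s,a)=\lambda I+\sum cc^\top$ over these visits, $\hat L_m(s,a)$ the ridge regression (parameter $\lambda$) of the observed losses on the contexts, $\hat P'_m(s,a)$ the ridge regression of the indicator vectors $e_{s'}\in\mathbb R^S$ of the observed next states ($e_g=0$), and $\hat P_m(s,a)$ its projection, in the norm $\|P\|_V=\sqrt{\mathrm{tr}(PVP^\top)}$ with $V=\bar V_m(s,a)$, on the matrices with sub-probability columns. Put $$\rho=\sqrt{d\log\tfrac{8|S|^2|A|(1+\tau_{s,a}/\lambda)}{\delta}}+\sqrt\lambda,\qquad \rho_\ell=\sqrt{d\log\tfrac{8|S||A|(1+\tau_{s,a}/\lambda)}{\delta}}+\sqrt\lambda ,$$ $$\Theta^\ell_m(s,a)=\{L:\|L-\hat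 L_m(s,a)\|_{\bar V_m(s,a)}\le\rho_\ell\},\qquad \Theta^P_m(s,a)=\{P:\|P-\hat P_m(s,a)\|_{\bar V_m(s,a)}\le\sqrt{|S|}\,\rho\}.$$ A triple $(\pi_m,\tilde\ell_m,\widetilde P_m)$ is chosen that minimizes $\mathcal V^\pi_{\ell,P}(s)$, simultaneously for all $s\in S$, over all policies $\pi$, all $\ell:S\times A\to[0,1]$ with $\ell(s,a)\in\{\langle L,c_m\rangle: L\in\Theta_m^\ell(s,a)\}$, and all $P$ with $P(\cdot\mid s,a)$ a sub-probability vector in $\{P'c_m:P'\in\Theta_m^P(s,a)\}$ (the triple is arbitrary if there is no such $\ell$ or no such $P$; the policy $\pi_1$ of the first interval is arbitrary). The choices depend on the past only. The policy $\pi_m$ is played throughout interval $m$. The pair $(s,a)$ is *known* in interval $m$ if $$\|c_m\|_{\bar V_m(s,a)^{-1}}<\frac{\ell_{\min}}{10B_\star\max\{|S|\rho,\sqrt{\log(4m/\delta)}\}},$$ and interval $m$ ends after the first step that reaches $g$ or plays a pair unknown in interval $m$. **High-probability event.** For $K\ge0$ let $\Omega_K$ be the event that in the first $K$ episodes: (1)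 $L^\star(s,a)\in\Theta^\ell_m(s,a)$ for all $s,a$ and all intervals $m$; (2) $P^\star(s,a)\in\Theta^P_m(s,a)$ for all $s,a$ and all $m$; (3) for all $m$ the loss incurred in interval $m$, up to any step of it, is at most $48B_\star\log(4m/\delta)$; (4) for all $n$, with $\widetilde V_m=\mathcal V^{\pi_m}_{\tilde\ell_m,\widetilde P_m}$ and $\widetilde V_m(g)=0$, the sum of $\widetilde V_m(s_{t+1})-\sum_{s'\in S}P^{c_t}(s'\mid s_t,a_t)\widetilde V_m(s')$ over those of the first $n$ steps $t$ that do not belong to the first interval, where $m$ is the interval containing step $t$ and $s_{t+1}$ the observed next state (possibly $g$), is at most $B_\star\sqrt{n\log(4n/\delta)}$. **Statement.** If $\lambda=1$, then $\Pr(\Omega_K)\ge1-\delta$ for every $K$. Moreover, for every $\lambda\ge1$, on the event $\Omega_K$ each of the first $K$ episodes terminates and the total number $T$ of steps in these episodes satisfies $$T=\widetilde O\!\left(\frac{K B_\star}{\ell_{\min}}+\frac{|S|^3|A|d^2B_\star^3}{\ell_{\min}^3}\Big(\max\{1,\log\tfrac1\delta\}\Big)^2\right),$$ where $\widetilde O(X)$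 means: at most $C\,X\,\big(\log(2+K|S||A|dB_\star/\ell_{\min})\big)^r$ with an absolute exponent $r$ and a constant $C$ that depends only on $\lambda$. -/

import Mathlib

open MeasureTheory ProbabilityTheory Filter Topology Matrix
open scoped ENNReal BigOperators

noncomputable section

namespace LRCSSP

/-! ### Stochastic shortest paths with a finite state set

The goal state `g` is not an element of `S`.  A transition function is a family of
sub-probability vectors `P s a : S → ℝ`; the missing mass `1 - ∑ s', P s a s'` is the probability
of moving to the goal.  An observed next state is an element of `Option S`, with `none` for `g`. -/

/-- The context space: the probability simplex in `ℝ^d`. -/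
def contexts (d : ℕ) : Set (Fin d → ℝ) := stdSimplex ℝ (Fin d)

/-- Sub-probability vectors on `S` (probability vectors on `S ∪ {g}`). -/
def subDist (S : Type*) [Fintype S] : Set (S → ℝ) :=
  {q | (∀ s, 0 ≤ q s) ∧ ∑ s, q s ≤ 1}

section SSP

variable {S A : Type*} [Fintype S] [DecidableEq S]

/-- The one-step transition matrix (restricted to the non-goal states) of the stationary
deterministic policy `π`. -/
def policyMatrix (P : S → A → S → ℝ) (π : S → A) : Matrix S S ℝ :=
  Matrix.of fun s s' => P s (π s) s'

/-- A policy is proper if it reaches the goal with probability one from every state: the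
probability of still being in `S` after `t` steps tends to `0`. -/
def IsProper (P : S → A → S → ℝ) (π : S → A) : Prop :=
  ∀ s, Tendsto (fun t : ℕ => ∑ s', (policyMatrix P π ^ t) s s') atTop (𝓝 0)

/-- The value `𝓥^π(s) = 𝔼[∑ₜ ℓ(sₜ, π(sₜ)) | s₀ = s] ∈ [0, ∞]` of the policy `π` in the SSP with
(non-negative) losses `l` and dynamics `P`: the `t`-th summand is the expected loss of step `t`,
steps after reaching the goal being free of loss. -/
def value (l : S → A → ℝ) (P : S → A → S → ℝ) (π : S → A) (s : S) : ℝ≥0∞ :=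
  ∑' t : ℕ, ENNReal.ofReal (((policyMatrix P π ^ t) *ᵥ fun s' => l s' (π s')) s)

end SSP

/-- A linear contextual SSP with embeddings `L⋆(s,a) ∈ ℝ^d` and `P⋆(s,a) ∈ ℝ^{|S| × d}`: every
column of `P⋆(s,a)` is a transition distribution, and all losses lie in `[lmin, 1]`. -/
structure LinearCSSP (S A : Type*) [Fintype S] (d : ℕ) (lmin : ℝ) where
  Lstar : S → A → Fin d → ℝ
  Pstar : S → A → Matrix S (Fin d) ℝ
  sInit : (Fin d → ℝ) → S
  Lstar_mem : ∀ s a j, Lstar s a j ∈ Set.Icc lmin 1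
  Pstar_mem : ∀ s a j, (fun s' => Pstar s a s' j) ∈ subDist S

namespace LinearCSSP

variable {S A : Type*} [Fintype S] [DecidableEq S] {d : ℕ} {lmin : ℝ}

/-- The expected loss `⟨c, L⋆(s,a)⟩` under context `c`. -/
def meanLoss (M : LinearCSSP S A d lmin) (c : Fin d → ℝ) (s : S) (a : A) : ℝ :=
  c ⬝ᵥ M.Lstar s a

/-- The transition probabilities `⟨c, P⋆(s' | s,a)⟩` under context `c`. -/
def dyn (M : LinearCSSP S A d lmin) (c : Fin d → ℝ) (s : S) (a : A) : S → ℝ :=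
  M.Pstar s a *ᵥ c

/-- The value at `s` of the best proper (stationary deterministic) policy under context `c`. -/
def optValue (M : LinearCSSP S A d lmin) (c : Fin d → ℝ) (s : S) : ℝ≥0∞ :=
  ⨅ π : {π : S → A // IsProper (M.dyn c) π}, value (M.meanLoss c) (M.dyn c) π.1 s

end LinearCSSP

/-! ### The algorithm -/

/-- The numerical inputs of the algorithm: regularization `lam`, confidence `delta`, lower bound
`lmin` on the losses, and upper bound `Bstar` on the optimal values. -/
structure Params where
  lam : ℝ
  delta : ℝ
  lmin : ℝ
  Bstar : ℝ

/-- A realized interaction, all steps of all episodes being one time-ordered sequence `t = 0,1,…`.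
`ctx t`, `state t` are the context and the (non-goal) state at step `t`, `loss t` and `next t` the
observed loss and next state; `policy t`, `optLoss t`, `optDyn t` are the policy, the optimistic
losses and the optimistic dynamics in force at step `t`. -/
structure Trajectory (S A : Type*) (d : ℕ) where
  ctx : ℕ → Fin d → ℝ
  state : ℕ → S
  next : ℕ → Option S
  loss : ℕ → ℝ
  policy : ℕ → S → A
  optLoss : ℕ → S → A → ℝ
  optDyn : ℕ → S → A → S → ℝ

/-- A minimizer of `f` over `s` (arbitrary if there is none). -/
def argminOn {α : Type*} [Nonempty α] (f : α → ℝ) (s : Set α) : α :=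
  Classical.epsilon fun x => x ∈ s ∧ IsMinOn f s x

/-- `‖x‖_V = √(xᵀ V x)`. -/
def vecNorm {d : ℕ} (V : Matrix (Fin d) (Fin d) ℝ) (x : Fin d → ℝ) : ℝ :=
  Real.sqrt (x ⬝ᵥ (V *ᵥ x))

/-- `‖P‖_V = √(tr(P V Pᵀ))`. -/
def matNorm {S : Type*} [Fintype S] {d : ℕ} (V : Matrix (Fin d) (Fin d) ℝ)
    (P : Matrix S (Fin d) ℝ) : ℝ :=
  Real.sqrt (Matrix.trace (P * V * Pᵀ))

namespace Trajectory

variable {S A : Type*} [Fintype S] [DecidableEq S] [Fintype A] [DecidableEq A] {d : ℕ}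

/-- The action played at step `t`. -/
def act (tr : Trajectory S A d) (t : ℕ) : A := tr.policy t (tr.state t)

/-- The steps before time `n` at which the pair `(s,a)` was visited (the data set `D(s,a)`). -/
def visits (tr : Trajectory S A d) (n : ℕ) (s : S) (a : A) : Finset ℕ :=
  (Finset.range n).filter fun i => tr.state i = s ∧ tr.act i = a

/-- `V̄(s,a) = λ I + ∑ c cᵀ` over the visits to `(s,a)` before time `n`. -/
def gram (p : Params) (tr : Trajectory S A d) (n : ℕ) (s : S) (a : A) :
    Matrix (Fin d) (Fin d) ℝ :=
  p.lam • (1 : Matrix (Fin d) (Fin d) ℝ) +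
    ∑ i ∈ tr.visits n s a, Matrix.vecMulVec (tr.ctx i) (tr.ctx i)

/-- `√(d log(8 |S|² |A| (1 + τ/λ) / δ)) + √λ`, where `τ` is the number of visits to `(s,a)`
before time `n`. -/
def radius (p : Params) (tr : Trajectory S A d) (n : ℕ) (s : S) (a : A) : ℝ :=
  Real.sqrt (d * Real.log (8 * (Fintype.card S : ℝ) ^ 2 * Fintype.card A *
    (1 + (tr.visits n s a).card / p.lam) / p.delta)) + Real.sqrt p.lam

/-- As `radius`, with `|S|` in place of `|S|²` (for the losses). -/
def lossRadius (p : Params) (tr : Trajectory S A d) (n : ℕ) (s : S) (a : A) : ℝ :=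
  Real.sqrt (d * Real.log (8 * (Fintype.card S : ℝ) * Fintype.card A *
    (1 + (tr.visits n s a).card / p.lam) / p.delta)) + Real.sqrt p.lam

/-- The pair `(s,a)` is known in the interval with index `m` that starts at time `u`. -/
def Known (p : Params) (tr : Trajectory S A d) (u m : ℕ) (s : S) (a : A) : Prop :=
  vecNorm (tr.gram p u s a)⁻¹ (tr.ctx u) <
    p.lmin / (10 * p.Bstar *
      max ((Fintype.card S : ℝ) * tr.radius p u s a) (Real.sqrt (Real.log (4 * m / p.delta))))

open Classical in
/-- The pair (starting time, index) of the interval that contains step `t`.  The first interval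
has index `1`.  A new interval starts after a step that reaches the goal or visits a pair that is
unknown in the current interval. -/
def interval (p : Params) (tr : Trajectory S A d) : ℕ → ℕ × ℕ
  | 0 => (0, 1)
  | t + 1 =>
    if tr.next t = none ∨
        ¬ tr.Known p (interval p tr t).1 (interval p tr t).2 (tr.state t) (tr.act t) then
      (t + 1, (interval p tr t).2 + 1)
    else interval p tr t

/-- The starting time of the interval that contains step `t`. -/
def intervalStart (p : Params) (tr : Trajectory S A d) (t : ℕ) : ℕ := (tr.interval p t).1

/-- The index `m` of the interval that contains step `t`. -/
def intervalIndex (p : Params) (tr : Trajectory S A d) (t : ℕ) : ℕ := (tr.interval p t).2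

/-- The ridge regression estimate of `L⋆(s,a)` from the data before time `n`. -/
def lossEst (p : Params) (tr : Trajectory S A d) (n : ℕ) (s : S) (a : A) : Fin d → ℝ :=
  argminOn (fun L : Fin d → ℝ =>
    ∑ i ∈ tr.visits n s a, (tr.ctx i ⬝ᵥ L - tr.loss i) ^ 2 + p.lam * (L ⬝ᵥ L)) Set.univ

/-- The ridge regression estimate of `P⋆(s,a)` from the data before time `n`; the regression target
is the indicator vector `e_{s'} ∈ ℝ^S` of the observed next state (zero for the goal). -/
def dynEstRaw (p : Params) (tr : Trajectory S A d) (n : ℕ) (s : S) (a : A) :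
    Matrix S (Fin d) ℝ :=
  argminOn (fun P : Matrix S (Fin d) ℝ =>
    ∑ i ∈ tr.visits n s a,
      ∑ s'' : S, ((P *ᵥ tr.ctx i) s'' - if tr.next i = some s'' then 1 else 0) ^ 2 +
    p.lam * ∑ s'' : S, ∑ j, P s'' j ^ 2) Set.univ

/-- The projection of `dynEstRaw`, in the norm `‖·‖_V̄`, on the matrices whose columns are
transition distributions. -/
def dynEst (p : Params) (tr : Trajectory S A d) (n : ℕ) (s : S) (a : A) : Matrix S (Fin d) ℝ :=
  argminOn (fun P : Matrix S (Fin d) ℝ => matNorm (tr.gram p n s a) (P - tr.dynEstRaw p n s a))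
    {P | ∀ j, (fun s' => P s' j) ∈ subDist S}

/-- The confidence set for `L⋆(s,a)` from the data before time `n`. -/
def lossConf (p : Params) (tr : Trajectory S A d) (n : ℕ) (s : S) (a : A) : Set (Fin d → ℝ) :=
  {L | vecNorm (tr.gram p n s a) (L - tr.lossEst p n s a) ≤ tr.lossRadius p n s a}

/-- The confidence set for `P⋆(s,a)` from the data before time `n`. -/
def dynConf (p : Params) (tr : Trajectory S A d) (n : ℕ) (s : S) (a : A) :
    Set (Matrix S (Fin d) ℝ) :=
  {P | matNorm (tr.gram p n s a) (P - tr.dynEst p n s a) ≤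
    Real.sqrt (Fintype.card S) * tr.radius p n s a}

/-- The loss functions (with values in `[0,1]`) that are plausible for the context `c`. -/
def lossConfAt (p : Params) (tr : Trajectory S A d) (n : ℕ) (c : Fin d → ℝ) :
    Set (S → A → ℝ) :=
  {l | ∀ s a, l s a ∈ Set.Icc (0 : ℝ) 1 ∧ ∃ L ∈ tr.lossConf p n s a, l s a = L ⬝ᵥ c}

/-- The transition functions that are plausible for the context `c`. -/
def dynConfAt (p : Params) (tr : Trajectory S A d) (n : ℕ) (c : Fin d → ℝ) :
    Set (S → A → S → ℝ) :=
  {P' | ∀ s a, P' s a ∈ subDist S ∧ ∃ P ∈ tr.dynConf p n s a, P' s a = P *ᵥ c}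

/-- The triple (policy, losses, dynamics) in force at time `u` has, simultaneously at all states,
the least value among all policies and all plausible models for the context and the data at
time `u`. -/
def OptimisticAt (p : Params) (tr : Trajectory S A d) (u : ℕ) : Prop :=
  tr.optLoss u ∈ tr.lossConfAt p u (tr.ctx u) ∧
  tr.optDyn u ∈ tr.dynConfAt p u (tr.ctx u) ∧
  ∀ π : S → A, ∀ l ∈ tr.lossConfAt p u (tr.ctx u), ∀ P ∈ tr.dynConfAt p u (tr.ctx u), ∀ s,
    value (tr.optLoss u) (tr.optDyn u) (tr.policy u) s ≤ value l P π s

/-- The number of episodes completed before step `t`, so that the episodes are numbered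
`0, 1, 2, …` and step `t` belongs to episode number `episode t`. -/
def episode (tr : Trajectory S A d) (t : ℕ) : ℕ :=
  ((Finset.range t).filter fun i => tr.next i = none).card

/-- Episode number `k` ends, by reaching the goal. -/
def Terminates (tr : Trajectory S A d) (k : ℕ) : Prop :=
  ∃ t, tr.episode t = k ∧ tr.next t = none

/-- The total number of steps in the first `K` episodes. -/
def totalSteps (tr : Trajectory S A d) (K : ℕ) : ℕ∞ := Set.encard {t | tr.episode t < K}

/-- `tr` is a possible trajectory of the algorithm on the linear contextual SSP `M`.  The policy in
the first interval is arbitrary, contexts at the beginning of episodes are arbitrary, and nothing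
is required of the optimistic choice if one of the sets of plausible losses or dynamics is empty. -/
structure IsRun (p : Params) (M : LinearCSSP S A d p.lmin) (tr : Trajectory S A d) : Prop where
  ctx_mem : ∀ t, tr.ctx t ∈ contexts d
  ctx_const : ∀ t, tr.next t ≠ none → tr.ctx (t + 1) = tr.ctx t
  state_zero : tr.state 0 = M.sInit (tr.ctx 0)
  state_succ : ∀ t, tr.state (t + 1) = (tr.next t).getD (M.sInit (tr.ctx (t + 1)))
  loss_mem : ∀ t, tr.loss t ∈ Set.Icc p.lmin 1
  keep : ∀ t, tr.intervalStart p (t + 1) ≠ t + 1 →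
    tr.policy (t + 1) = tr.policy t ∧ tr.optLoss (t + 1) = tr.optLoss t ∧
      tr.optDyn (t + 1) = tr.optDyn t
  optimistic : ∀ t, tr.intervalStart p (t + 1) = t + 1 →
    (tr.lossConfAt p (t + 1) (tr.ctx (t + 1))).Nonempty →
    (tr.dynConfAt p (t + 1) (tr.ctx (t + 1))).Nonempty → tr.OptimisticAt p (t + 1)

/-- The value function of the policy in force at step `t` in the optimistic model in force at
step `t`. -/
def optValue (tr : Trajectory S A d) (t : ℕ) (s : S) : ℝ :=
  (value (tr.optLoss t) (tr.optDyn t) (tr.policy t) s).toReal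

/-- The difference between the optimistic value of the observed next state (`0` at the goal) and
its expectation under the true dynamics, at step `t`. -/
def valueNoise {lmin : ℝ} (M : LinearCSSP S A d lmin) (tr : Trajectory S A d) (t : ℕ) : ℝ :=
  (match tr.next t with
    | some s' => tr.optValue t s'
    | none => 0) -
  ∑ s', M.dyn (tr.ctx t) (tr.state t) (tr.act t) s' * tr.optValue t s'

/-- The high-probability event, for the first `K` episodes. -/
structure HPE (p : Params) (M : LinearCSSP S A d p.lmin) (K : ℕ) (tr : Trajectory S A d) :
    Prop where
  loss_conf : ∀ t, tr.episode t < K → ∀ s a,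
    M.Lstar s a ∈ tr.lossConf p (tr.intervalStart p t) s a
  dyn_conf : ∀ t, tr.episode t < K → ∀ s a,
    M.Pstar s a ∈ tr.dynConf p (tr.intervalStart p t) s a
  interval_cost : ∀ t, tr.episode t < K →
    ∑ i ∈ Finset.Icc (tr.intervalStart p t) t, tr.loss i ≤
      48 * p.Bstar * Real.log (4 * tr.intervalIndex p t / p.delta)
  /-- The sum runs over the intervals with an optimistic model, that is, all but the first. -/
  value_noise : ∀ n, (∀ t < n, tr.episode t < K) →
    ∑ t ∈ (Finset.range n).filter (fun t => 2 ≤ tr.intervalIndex p t), tr.valueNoise M t ≤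
      p.Bstar * Real.sqrt (n * Real.log (4 * n / p.delta))

end Trajectory

/-- `tr` is a random trajectory of the algorithm on `M`, adapted to the filtration `F`, where `F t`
is what is known just before the action of step `t` is played: contexts, policies and optimistic
models depend on the past only, and, given the past, the next state at step `t` has the law
`P^c(· | s,a)` and the loss has mean `⟨c, L⋆(s,a)⟩`. -/
structure IsRandomRun {S A : Type*} [Fintype S] [DecidableEq S] [Fintype A] [DecidableEq A]
    {d : ℕ} {Ω : Type*} {mΩ : MeasurableSpace Ω} (μ : Measure Ω) (F : Filtration ℕ mΩ)
    (p : Params) (M : LinearCSSP S A d p.lmin) (tr : Ω → Trajectory S A d) : Prop where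
  isRun : ∀ ω, (tr ω).IsRun p M
  ctx_meas : ∀ t j, Measurable[F t] fun ω => (tr ω).ctx t j
  state_meas : ∀ t s, MeasurableSet[F t] {ω | (tr ω).state t = s}
  policy_meas : ∀ t π, MeasurableSet[F t] {ω | (tr ω).policy t = π}
  optLoss_meas : ∀ t s a, Measurable[F t] fun ω => (tr ω).optLoss t s a
  optDyn_meas : ∀ t s a s', Measurable[F t] fun ω => (tr ω).optDyn t s a s'
  loss_meas : ∀ t, Measurable[F (t + 1)] fun ω => (tr ω).loss t
  next_meas : ∀ t s', MeasurableSet[F (t + 1)] {ω | (tr ω).next t = some s'}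
  next_law : ∀ t s',
    μ[Set.indicator {ω | (tr ω).next t = some s'} (fun _ => (1 : ℝ)) | F t] =ᵐ[μ]
      fun ω => M.dyn ((tr ω).ctx t) ((tr ω).state t) ((tr ω).act t) s'
  loss_mean : ∀ t,
    μ[fun ω => (tr ω).loss t | F t] =ᵐ[μ]
      fun ω => M.meanLoss ((tr ω).ctx t) ((tr ω).state t) ((tr ω).act t)

end LRCSSP

end

open LRCSSP

/-!
# Linear contextual stochastic shortest paths: optimism with ridge regression

**The number of steps.** Suppose that all confidence sets contain the true parameters. Then the
true model is plausible in every interval but the first, so the optimistic value function `Ṽ` is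
bounded by `B⋆`; it solves a Bellman equation in the optimistic model (`IsRun.boundedAt`,
`value_toReal_bellman`). At a known pair the context is so short in the norm of the inverse Gram
matrix that passing from the optimistic to the true model costs at most `2/5` of the mean loss.
Hence `Ṽ` decreases in expectation by at least `3/5` of the mean loss at each step with a known
pair (`IsRun.driftAt`). Summing up, with a bound on the noise of `Ṽ`, the time spent is controlled
by `B⋆` times the number of intervals (`IsRun.drift_sum_le`). An interval ends at the goal, or at a
pair that is unknown; by the elliptical potential argument, which compares determinants of Gram
matrices, the number of visits to unknown pairs is only polylogarithmic in the number of steps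
(`unknownCount_le`). The first interval, whose policy is arbitrary, is short since its total loss
is bounded. The resulting inequality contains the number of steps on both sides, with
logarithms and a square root on the right; the square root is absorbed in `IsRun.steps_le`, and
`le_of_le_mul_log_mul_log` removes the logarithms. As the bound holds for every initial
segment of the first `K` episodes, these episodes terminate.

**The probability.** For `λ = 1`, four families of events receive the failure probability `δ/8`
each. The confidence sets rest on a self-normalized inequality, proved by the method of mixtures:
`√(λ^d / det Vₙ) exp (2 ‖Sₙ‖²)`, with the norm of `Vₙ⁻¹`, is a supermartingale
(`mixture_isNonnegSuper`), because a centered Bernoulli variable is subgaussian with variance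
proxy `1/4`, which survives a Gaussian mixture (`bernoulli_exp_quadratic_le`). Ville's inequality
makes the bound uniform in time. A factor `1/2` is gained over variance proxy `1`, and that pays
for the regularization error `√d` of the ridge estimate, which exceeds the summand `√λ` of the
radius (`half_sqrt_add_sqrt_le`). For the loss of an interval, the drift of `Ṽ` makes
`exp (C / (8 B⋆)) (1 + Ṽ / B⋆)` a supermartingale, where `C` is the loss so far
(`costPotential_isNonnegSuper`); the first interval is harmless as it consists of one step. The
noise of `Ṽ` is bounded by the Azuma–Hoeffding inequality (`measure_valueNoise_le`). Both
processes are cut off where `Ṽ` exceeds `B⋆`, and the first also where the drift fails; neither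
happens while the confidence sets are correct.
-/

set_option linter.unusedSectionVars false

namespace LRCSSP

/-! ### Quadratic forms of positive definite matrices -/

section LinearAlgebra

variable {d : ℕ} {V : Matrix (Fin d) (Fin d) ℝ}

theorem dotProduct_mulVec_comm (hV : V.IsHermitian) (x y : Fin d → ℝ) :
    x ⬝ᵥ (V *ᵥ y) = y ⬝ᵥ (V *ᵥ x) := by
  have h : Vᵀ = V := by
    rw [← conjTranspose_eq_transpose_of_trivial]; exact hV
  rw [dotProduct_mulVec, dotProduct_comm, ← mulVec_transpose, h]

theorem quadForm_nonneg (hV : V.PosSemidef) (x : Fin d → ℝ) : 0 ≤ x ⬝ᵥ (V *ᵥ x) := by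
  simpa using hV.dotProduct_mulVec_nonneg x

theorem quadForm_add (hV : V.IsHermitian) (x y : Fin d → ℝ) :
    (x + y) ⬝ᵥ (V *ᵥ (x + y)) = x ⬝ᵥ (V *ᵥ x) + 2 * (x ⬝ᵥ (V *ᵥ y)) + y ⬝ᵥ (V *ᵥ y) := by
  rw [mulVec_add, add_dotProduct, dotProduct_add, dotProduct_add, dotProduct_mulVec_comm hV y x]
  ring

theorem quadForm_smul (x : Fin d → ℝ) (t : ℝ) :
    (t • x) ⬝ᵥ (V *ᵥ (t • x)) = t ^ 2 * (x ⬝ᵥ (V *ᵥ x)) := by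
  simp only [mulVec_smul, smul_dotProduct, dotProduct_smul, smul_eq_mul]
  ring

/-- The Cauchy–Schwarz inequality for a positive semidefinite form. -/
theorem dotProduct_mulVec_sq_le (hV : V.PosSemidef) (x y : Fin d → ℝ) :
    (x ⬝ᵥ (V *ᵥ y)) ^ 2 ≤ (x ⬝ᵥ (V *ᵥ x)) * (y ⬝ᵥ (V *ᵥ y)) := by
  have h : ∀ t : ℝ, 0 ≤ (y ⬝ᵥ (V *ᵥ y)) * (t * t) + (2 * (x ⬝ᵥ (V *ᵥ y))) * t
      + x ⬝ᵥ (V *ᵥ x) := by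
    intro t
    have h1 := quadForm_nonneg hV (x + t • y)
    rw [quadForm_add hV.1, quadForm_smul, mulVec_smul, dotProduct_smul, smul_eq_mul] at h1
    linarith
  have h2 := discrim_le_zero h
  rw [discrim] at h2
  linarith

theorem vecNorm_nonneg (x : Fin d → ℝ) : 0 ≤ vecNorm V x := Real.sqrt_nonneg _

theorem vecNorm_sq (hV : V.PosSemidef) (x : Fin d → ℝ) : vecNorm V x ^ 2 = x ⬝ᵥ (V *ᵥ x) :=
  Real.sq_sqrt (quadForm_nonneg hV x)

theorem vecNorm_neg (x : Fin d → ℝ) : vecNorm V (-x) = vecNorm V x := by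
  simp [vecNorm, mulVec_neg]

theorem vecNorm_sub_comm (x y : Fin d → ℝ) : vecNorm V (x - y) = vecNorm V (y - x) := by
  rw [← neg_sub, vecNorm_neg]

theorem vecNorm_add_le (hV : V.PosSemidef) (x y : Fin d → ℝ) :
    vecNorm V (x + y) ≤ vecNorm V x + vecNorm V y := by
  have hx := vecNorm_nonneg (V := V) x
  have hy := vecNorm_nonneg (V := V) y
  refine abs_le_of_sq_le_sq' ?_ (by positivity) |>.2
  have h : x ⬝ᵥ (V *ᵥ y) ≤ vecNorm V x * vecNorm V y := by
    refine (abs_le_of_sq_le_sq' ?_ (by positivity)).2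
    rw [mul_pow, vecNorm_sq hV, vecNorm_sq hV]
    exact dotProduct_mulVec_sq_le hV x y
  rw [vecNorm_sq hV, quadForm_add hV.1, add_sq, vecNorm_sq hV, vecNorm_sq hV]
  linarith

theorem vecNorm_sub_le (hV : V.PosSemidef) (x y z : Fin d → ℝ) :
    vecNorm V (x - y) ≤ vecNorm V (x - z) + vecNorm V (y - z) := by
  rw [vecNorm_sub_comm y z]
  simpa using vecNorm_add_le hV (x - z) (z - y)

theorem isUnit_det_of_posDef (hV : V.PosDef) : IsUnit V.det := hV.det_pos.ne'.isUnit

theorem mulVec_inv_mulVec (hV : V.PosDef) (x : Fin d → ℝ) : V *ᵥ (V⁻¹ *ᵥ x) = x := by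
  rw [mulVec_mulVec, mul_nonsing_inv _ (isUnit_det_of_posDef hV), one_mulVec]

theorem inv_mulVec_mulVec (hV : V.PosDef) (x : Fin d → ℝ) : V⁻¹ *ᵥ (V *ᵥ x) = x := by
  rw [mulVec_mulVec, nonsing_inv_mul _ (isUnit_det_of_posDef hV), one_mulVec]

theorem vecNorm_inv_mulVec (hV : V.PosDef) (x : Fin d → ℝ) :
    vecNorm V (V⁻¹ *ᵥ x) = vecNorm V⁻¹ x := by
  rw [vecNorm, vecNorm, mulVec_inv_mulVec hV, dotProduct_comm]

/-- Duality of the norms `‖·‖_V` and `‖·‖_{V⁻¹}`. -/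
theorem abs_dotProduct_le (hV : V.PosDef) (x c : Fin d → ℝ) :
    |x ⬝ᵥ c| ≤ vecNorm V x * vecNorm V⁻¹ c := by
  have h := dotProduct_mulVec_sq_le hV.posSemidef x (V⁻¹ *ᵥ c)
  rw [← vecNorm_sq hV.posSemidef, ← vecNorm_sq hV.posSemidef, mulVec_inv_mulVec hV,
    vecNorm_inv_mulVec hV, ← mul_pow] at h
  exact abs_le_of_sq_le_sq h (mul_nonneg (vecNorm_nonneg _) (vecNorm_nonneg _))

theorem vecMulVec_mulVec_self (x y : Fin d → ℝ) :
    vecMulVec x x *ᵥ y = (x ⬝ᵥ y) • x := by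
  ext i
  simp [vecMulVec, mulVec, dotProduct, Finset.mul_sum, mul_comm, mul_left_comm]

theorem quadForm_vecMulVec (x y : Fin d → ℝ) :
    y ⬝ᵥ (vecMulVec x x *ᵥ y) = (x ⬝ᵥ y) ^ 2 := by
  rw [vecMulVec_mulVec_self, dotProduct_smul, smul_eq_mul, dotProduct_comm y x, sq]

/-- The matrix determinant lemma for a symmetric rank-one update. -/
theorem det_add_vecMulVec (hV : V.PosDef) (x : Fin d → ℝ) :
    (V + vecMulVec x x).det = V.det * (1 + x ⬝ᵥ (V⁻¹ *ᵥ x)) := by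
  rw [vecMulVec_eq Unit, det_add_replicateCol_mul_replicateRow (isUnit_det_of_posDef hV)]
  congr 1
  rw [det_unique, Matrix.add_apply, Matrix.one_apply_eq, Matrix.mul_assoc,
    ← replicateCol_mulVec, replicateRow_mul_replicateCol_apply]

theorem posDef_add_vecMulVec (hV : V.PosDef) (x : Fin d → ℝ) : (V + vecMulVec x x).PosDef := by
  refine hV.add_posSemidef ?_
  simpa using posSemidef_vecMulVec_self_star x

/-- The Sherman–Morrison formula for a symmetric rank-one update. -/
theorem inv_add_vecMulVec_mulVec (hV : V.PosDef) (x y : Fin d → ℝ) :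
    (V + vecMulVec x x)⁻¹ *ᵥ y =
      V⁻¹ *ᵥ y - ((x ⬝ᵥ (V⁻¹ *ᵥ y)) / (1 + x ⬝ᵥ (V⁻¹ *ᵥ x))) • (V⁻¹ *ᵥ x) := by
  have hw : 0 ≤ x ⬝ᵥ (V⁻¹ *ᵥ x) := quadForm_nonneg hV.inv.posSemidef x
  set z := V⁻¹ *ᵥ y - ((x ⬝ᵥ (V⁻¹ *ᵥ y)) / (1 + x ⬝ᵥ (V⁻¹ *ᵥ x))) • (V⁻¹ *ᵥ x) with hz
  have h : (V + vecMulVec x x) *ᵥ z = y := by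
    rw [add_mulVec, vecMulVec_mulVec_self, hz, mulVec_sub, mulVec_smul, mulVec_inv_mulVec hV,
      mulVec_inv_mulVec hV, dotProduct_sub, dotProduct_smul, smul_eq_mul, sub_add,
      ← sub_smul]
    have : (x ⬝ᵥ (V⁻¹ *ᵥ y)) / (1 + x ⬝ᵥ (V⁻¹ *ᵥ x)) - (x ⬝ᵥ (V⁻¹ *ᵥ y) -
        (x ⬝ᵥ (V⁻¹ *ᵥ y)) / (1 + x ⬝ᵥ (V⁻¹ *ᵥ x)) * (x ⬝ᵥ (V⁻¹ *ᵥ x))) = 0 := by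
      field_simp
      ring
    rw [this, zero_smul, sub_zero]
  rw [← h, inv_mulVec_mulVec (posDef_add_vecMulVec hV x)]

end LinearAlgebra

/-! ### Regularized Gram matrices and ridge regression -/

section Ridge

variable {ι : Type*} {d : ℕ} {lam : ℝ}

/-- The matrix `λ I + ∑ i ∈ I, xᵢ xᵢᵀ`. -/
def ridgeGram (lam : ℝ) (I : Finset ι) (x : ι → Fin d → ℝ) : Matrix (Fin d) (Fin d) ℝ :=
  lam • (1 : Matrix (Fin d) (Fin d) ℝ) + ∑ i ∈ I, vecMulVec (x i) (x i)

theorem ridgeGram_insert [DecidableEq ι] {I : Finset ι} {i : ι} (hi : i ∉ I)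
    (x : ι → Fin d → ℝ) :
    ridgeGram lam (insert i I) x = ridgeGram lam I x + vecMulVec (x i) (x i) := by
  rw [ridgeGram, ridgeGram, Finset.sum_insert hi, add_comm (vecMulVec _ _), add_assoc]

theorem ridgeGram_posDef (hlam : 0 < lam) (I : Finset ι) (x : ι → Fin d → ℝ) :
    (ridgeGram lam I x).PosDef := by
  classical
  induction I using Finset.induction_on with
  | empty => simpa [ridgeGram] using (PosDef.one (n := Fin d) (R := ℝ)).smul hlam
  | insert i I hi ih => rw [ridgeGram_insert hi]; exact posDef_add_vecMulVec ih _

theorem quadForm_ridgeGram (I : Finset ι) (x : ι → Fin d → ℝ) (y : Fin d → ℝ) :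
    y ⬝ᵥ (ridgeGram lam I x *ᵥ y) = lam * (y ⬝ᵥ y) + ∑ i ∈ I, (x i ⬝ᵥ y) ^ 2 := by
  rw [ridgeGram, add_mulVec, dotProduct_add, smul_mulVec, one_mulVec, dotProduct_smul,
    sum_mulVec, dotProduct_sum, smul_eq_mul]
  simp_rw [quadForm_vecMulVec]

theorem dotProduct_sq_le (x y : Fin d → ℝ) : (x ⬝ᵥ y) ^ 2 ≤ (x ⬝ᵥ x) * (y ⬝ᵥ y) := by
  simpa using dotProduct_mulVec_sq_le (V := (1 : Matrix (Fin d) (Fin d) ℝ))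
    PosDef.one.posSemidef x y

/-- If the vectors `xᵢ` lie in the unit ball, then all eigenvalues of the Gram matrix are at
most `λ + |I|`. -/
theorem det_ridgeGram_le (hlam : 0 < lam) (I : Finset ι) (x : ι → Fin d → ℝ)
    (hx : ∀ i ∈ I, x i ⬝ᵥ x i ≤ 1) : (ridgeGram lam I x).det ≤ (lam + I.card) ^ d := by
  have hP := ridgeGram_posDef hlam I x
  rw [hP.1.det_eq_prod_eigenvalues]
  calc ∏ i, ((hP.1.eigenvalues i : ℝ) : ℝ) ≤ ∏ _i : Fin d, (lam + I.card) := by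
        refine Finset.prod_le_prod (fun i _ => (hP.eigenvalues_pos i).le) fun i _ => ?_
        have hu : (hP.1.eigenvectorBasis i : Fin d → ℝ) ⬝ᵥ (hP.1.eigenvectorBasis i) = 1 := by
          have h := EuclideanSpace.inner_eq_star_dotProduct (𝕜 := ℝ) (hP.1.eigenvectorBasis i)
            (hP.1.eigenvectorBasis i)
          rw [real_inner_self_eq_norm_sq, hP.1.eigenvectorBasis.orthonormal.1 i] at h
          simpa using h.symm
        have h2 := hP.1.eigenvalues_eq i
        simp only [star_trivial, RCLike.re_to_real] at h2
        rw [quadForm_ridgeGram, hu, mul_one] at h2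
        rw [h2]
        gcongr
        calc ∑ j ∈ I, (x j ⬝ᵥ (hP.1.eigenvectorBasis i).ofLp) ^ 2 ≤ ∑ j ∈ I, (1 : ℝ) := by
              refine Finset.sum_le_sum fun j hj => ?_
              have := dotProduct_sq_le (x j) (hP.1.eigenvectorBasis i)
              rw [hu, mul_one] at this
              exact this.trans (hx j hj)
          _ = I.card := by simp
    _ = (lam + I.card) ^ d := by simp

theorem argminOn_spec {α : Type*} [Nonempty α] {f : α → ℝ} {s : Set α}
    (h : ∃ x ∈ s, IsMinOn f s x) : argminOn f s ∈ s ∧ IsMinOn f s (argminOn f s) :=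
  Classical.epsilon_spec (p := fun x => x ∈ s ∧ IsMinOn f s x) h

/-- The right-hand side of the normal equations. -/
def ridgeRHS (I : Finset ι) (x : ι → Fin d → ℝ) (y : ι → ℝ) : Fin d → ℝ := ∑ i ∈ I, y i • x i

/-- Completing the square in the objective of ridge regression. -/
theorem ridge_objective (hlam : 0 < lam) (I : Finset ι) (x : ι → Fin d → ℝ) (y : ι → ℝ)
    (L : Fin d → ℝ) :
    ∑ i ∈ I, (x i ⬝ᵥ L - y i) ^ 2 + lam * (L ⬝ᵥ L) =
      (L - (ridgeGram lam I x)⁻¹ *ᵥ ridgeRHS I x y) ⬝ᵥ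
        (ridgeGram lam I x *ᵥ (L - (ridgeGram lam I x)⁻¹ *ᵥ ridgeRHS I x y)) +
      (∑ i ∈ I, y i ^ 2 - ridgeRHS I x y ⬝ᵥ ((ridgeGram lam I x)⁻¹ *ᵥ ridgeRHS I x y)) := by
  have hP := ridgeGram_posDef hlam I x
  have h1 : ∑ i ∈ I, (x i ⬝ᵥ L - y i) ^ 2 =
      ∑ i ∈ I, (x i ⬝ᵥ L) ^ 2 - 2 * (L ⬝ᵥ ridgeRHS I x y) + ∑ i ∈ I, y i ^ 2 := by
    rw [ridgeRHS, dotProduct_sum, Finset.mul_sum, ← Finset.sum_sub_distrib,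
      ← Finset.sum_add_distrib]
    refine Finset.sum_congr rfl fun i _ => ?_
    rw [dotProduct_smul, dotProduct_comm L, smul_eq_mul]
    ring
  rw [sub_eq_add_neg L, quadForm_add hP.1]
  simp only [mulVec_neg, dotProduct_neg, neg_dotProduct]
  rw [mulVec_inv_mulVec hP, quadForm_ridgeGram, h1,
    dotProduct_comm (_ *ᵥ _) (ridgeRHS I x y)]
  ring

theorem eq_of_quadForm_sub_nonpos {V : Matrix (Fin d) (Fin d) ℝ} (hV : V.PosDef)
    {x y : Fin d → ℝ} (h : (x - y) ⬝ᵥ (V *ᵥ (x - y)) ≤ 0) : x = y := by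
  by_contra hne
  have := hV.dotProduct_mulVec_pos (sub_ne_zero.2 hne)
  simp only [star_trivial] at this
  linarith

theorem argminOn_ridge (hlam : 0 < lam) (I : Finset ι) (x : ι → Fin d → ℝ) (y : ι → ℝ) :
    argminOn (fun L : Fin d → ℝ => ∑ i ∈ I, (x i ⬝ᵥ L - y i) ^ 2 + lam * (L ⬝ᵥ L)) Set.univ =
      (ridgeGram lam I x)⁻¹ *ᵥ ridgeRHS I x y := by
  have hP := ridgeGram_posDef hlam I x
  simp_rw [ridge_objective hlam I x y]
  set L₀ := (ridgeGram lam I x)⁻¹ *ᵥ ridgeRHS I x y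
  have h := argminOn_spec (s := Set.univ) (f := fun L : Fin d → ℝ =>
    (L - L₀) ⬝ᵥ (ridgeGram lam I x *ᵥ (L - L₀)) +
      (∑ i ∈ I, y i ^ 2 - ridgeRHS I x y ⬝ᵥ L₀)) ⟨L₀, trivial, fun L _ => by
        simpa using quadForm_nonneg hP.posSemidef (L - L₀)⟩
  have h2 := h.2 (Set.mem_univ L₀)
  refine eq_of_quadForm_sub_nonpos hP ?_
  simpa using h2

/-- The error of the ridge estimate splits into a noise term and a regularization term. -/
theorem ridge_error (hlam : 0 < lam) (I : Finset ι) (x : ι → Fin d → ℝ) (y : ι → ℝ)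
    (L : Fin d → ℝ) :
    (ridgeGram lam I x)⁻¹ *ᵥ ridgeRHS I x y - L =
      (ridgeGram lam I x)⁻¹ *ᵥ (ridgeRHS I x (fun i => y i - x i ⬝ᵥ L) + (-lam) • L) := by
  have hP := ridgeGram_posDef hlam I x
  have h : ridgeGram lam I x *ᵥ L = lam • L + ridgeRHS I x (fun i => x i ⬝ᵥ L) := by
    rw [ridgeGram, add_mulVec, smul_mulVec, one_mulVec, sum_mulVec, ridgeRHS]
    simp_rw [vecMulVec_mulVec_self]
  conv_lhs => rw [← inv_mulVec_mulVec hP L, ← mulVec_sub, h]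
  congr 1
  have : ridgeRHS I x (fun i => y i - x i ⬝ᵥ L) =
      ridgeRHS I x y - ridgeRHS I x (fun i => x i ⬝ᵥ L) := by
    simp [ridgeRHS, sub_smul, Finset.sum_sub_distrib]
  rw [this, neg_smul]
  abel

theorem quadForm_inv_ridgeGram_le (hlam : 0 < lam) (I : Finset ι) (x : ι → Fin d → ℝ)
    (y : Fin d → ℝ) : lam * (y ⬝ᵥ ((ridgeGram lam I x)⁻¹ *ᵥ y)) ≤ y ⬝ᵥ y := by
  have hP := ridgeGram_posDef hlam I x
  set z := (ridgeGram lam I x)⁻¹ *ᵥ y with hz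
  have h1 : y ⬝ᵥ z = z ⬝ᵥ (ridgeGram lam I x *ᵥ z) := by
    rw [hz, mulVec_inv_mulVec hP, dotProduct_comm]
  have h2 : lam * (z ⬝ᵥ z) ≤ y ⬝ᵥ z := by
    rw [h1, quadForm_ridgeGram]
    have : 0 ≤ ∑ i ∈ I, (x i ⬝ᵥ z) ^ 2 := Finset.sum_nonneg fun i _ => sq_nonneg _
    linarith
  have h3 := dotProduct_sq_le y z
  have h4 : 0 ≤ y ⬝ᵥ z := by rw [h1]; exact quadForm_nonneg hP.posSemidef z
  have h5 : 0 ≤ y ⬝ᵥ y := by simpa using dotProduct_star_self_nonneg y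
  rcases h4.eq_or_lt with h0 | h0
  · rw [← h0, mul_zero]; exact h5
  · by_contra! hlt
    have : lam * (y ⬝ᵥ y) * (z ⬝ᵥ z) ≤ (y ⬝ᵥ y) * (y ⬝ᵥ z) := by nlinarith
    nlinarith

/-- A bound on the ridge estimate in terms of the self-normalized noise. -/
theorem vecNorm_ridge_error_le (hlam : 0 < lam) (I : Finset ι) (x : ι → Fin d → ℝ) (y : ι → ℝ)
    (L : Fin d → ℝ) :
    vecNorm (ridgeGram lam I x) (L - (ridgeGram lam I x)⁻¹ *ᵥ ridgeRHS I x y) ≤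
      vecNorm (ridgeGram lam I x)⁻¹ (ridgeRHS I x (fun i => y i - x i ⬝ᵥ L)) +
        Real.sqrt (lam * (L ⬝ᵥ L)) := by
  have hP := ridgeGram_posDef hlam I x
  rw [vecNorm_sub_comm, ridge_error hlam, vecNorm_inv_mulVec hP]
  refine (vecNorm_add_le hP.inv.posSemidef _ _).trans ?_
  gcongr
  rw [vecNorm, quadForm_smul]
  apply Real.sqrt_le_sqrt
  have := quadForm_inv_ridgeGram_le hlam I x L
  nlinarith

end Ridge

/-! ### The matrix norm and the projection on transition matrices -/

section MatNorm

variable {S : Type*} [Fintype S] {d : ℕ} {V : Matrix (Fin d) (Fin d) ℝ}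

theorem trace_eq_sum_quadForm (P Q : Matrix S (Fin d) ℝ) :
    trace (P * V * Qᵀ) = ∑ s, P s ⬝ᵥ (V *ᵥ Q s) := by
  simp only [trace, diag_apply, Matrix.mul_apply, transpose_apply, dotProduct, mulVec,
    Finset.sum_mul, Finset.mul_sum]
  refine Finset.sum_congr rfl fun s _ => ?_
  rw [Finset.sum_comm]
  simp only [mul_assoc]

theorem matNorm_nonneg (P : Matrix S (Fin d) ℝ) : 0 ≤ matNorm V P := Real.sqrt_nonneg _

theorem matNorm_sq (hV : V.PosSemidef) (P : Matrix S (Fin d) ℝ) :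
    matNorm V P ^ 2 = ∑ s, vecNorm V (P s) ^ 2 := by
  simp_rw [vecNorm_sq hV]
  rw [matNorm, trace_eq_sum_quadForm]
  exact Real.sq_sqrt (Finset.sum_nonneg fun s _ => quadForm_nonneg hV _)

/-- The sum of the norms of the rows, by the Cauchy–Schwarz inequality. -/
theorem sum_vecNorm_le (hV : V.PosSemidef) (P : Matrix S (Fin d) ℝ) :
    ∑ s, vecNorm V (P s) ≤ Real.sqrt (Fintype.card S) * matNorm V P := by
  refine (abs_le_of_sq_le_sq' ?_ (mul_nonneg (Real.sqrt_nonneg _) (matNorm_nonneg P))).2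
  rw [mul_pow, matNorm_sq hV, Real.sq_sqrt (by positivity)]
  simpa using sq_sum_le_card_mul_sum_sq (s := Finset.univ) (f := fun s => vecNorm V (P s))

theorem isCompact_subDist_matrices :
    IsCompact {P : Matrix S (Fin d) ℝ | ∀ j, (fun s' => P s' j) ∈ subDist S} := by
  have h : {P : Matrix S (Fin d) ℝ | ∀ j, (fun s' => P s' j) ∈ subDist S} =
      {P : Matrix S (Fin d) ℝ | (∀ s j, P s j ∈ Set.Icc (0 : ℝ) 1) ∧ ∀ j, ∑ s, P s j ≤ 1} := by
    ext P
    constructor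
    · intro hP
      exact ⟨fun s j => ⟨(hP j).1 s, (Finset.single_le_sum (f := fun s => P s j)
        (fun s _ => (hP j).1 s) (Finset.mem_univ s)).trans (hP j).2⟩, fun j => (hP j).2⟩
    · intro hP j
      exact ⟨fun s => (hP.1 s j).1, hP.2 j⟩
  have hbox : IsCompact {P : Matrix S (Fin d) ℝ | ∀ s j, P s j ∈ Set.Icc (0 : ℝ) 1} := by
    have := isCompact_pi_infinite (X := fun _ : S => Fin d → ℝ)
      (s := fun _ => {v | ∀ j, v j ∈ Set.Icc (0 : ℝ) 1})
      fun _ => isCompact_pi_infinite fun _ => isCompact_Icc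
    exact this
  rw [h]
  refine hbox.inter_right (t := {P : Matrix S (Fin d) ℝ | ∀ j, ∑ s, P s j ≤ 1}) ?_
  simp only [Set.ofPred_forall]
  refine isClosed_iInter fun j => isClosed_le ?_ continuous_const
  exact continuous_finsetSum _ fun s _ => (continuous_apply j).comp (continuous_apply s)

theorem continuous_matNorm_sub (Q : Matrix S (Fin d) ℝ) :
    Continuous fun P : Matrix S (Fin d) ℝ => matNorm V (P - Q) := by
  unfold matNorm
  refine Real.continuous_sqrt.comp ?_
  refine Continuous.matrix_trace ?_
  have h : Continuous fun P : Matrix S (Fin d) ℝ => P - Q := continuous_id.sub continuous_const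
  exact (h.matrix_mul continuous_const).matrix_mul h.matrix_transpose

/-- The projection on a compact convex set of matrices does not increase the distance to the
points of that set. -/
theorem matNorm_sub_argminOn_le (hV : V.PosSemidef) {s : Set (Matrix S (Fin d) ℝ)}
    (hc : IsCompact s) (hconv : Convex ℝ s) (Q : Matrix S (Fin d) ℝ)
    {P : Matrix S (Fin d) ℝ} (hP : P ∈ s) :
    matNorm V (P - argminOn (fun P => matNorm V (P - Q)) s) ≤ matNorm V (P - Q) := by
  obtain ⟨hm, hmin⟩ := argminOn_spec
    (hc.exists_isMinOn ⟨P, hP⟩ (continuous_matNorm_sub (V := V) Q).continuousOn)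
  set R := argminOn (fun P => matNorm V (P - Q)) s
  -- the squared distance to `Q` along the segment from the projection `R` to `P`
  have hsum : ∀ t : ℝ, matNorm V (R + t • (P - R) - Q) ^ 2 = matNorm V (R - Q) ^ 2 +
      2 * t * (∑ s, (R - Q) s ⬝ᵥ (V *ᵥ (P - R) s)) + t ^ 2 * matNorm V (P - R) ^ 2 := by
    intro t
    rw [matNorm_sq hV, matNorm_sq hV, matNorm_sq hV, Finset.mul_sum, Finset.mul_sum,
      ← Finset.sum_add_distrib, ← Finset.sum_add_distrib]
    refine Finset.sum_congr rfl fun i _ => ?_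
    have : (R + t • (P - R) - Q) i = (R - Q) i + t • (P - R) i := by
      ext j; simp; ring
    rw [vecNorm_sq hV, vecNorm_sq hV, vecNorm_sq hV, this, quadForm_add hV.1, quadForm_smul,
      mulVec_smul, dotProduct_smul, smul_eq_mul]
    ring
  have hle : ∀ t : ℝ, 0 < t → t ≤ 1 →
      0 ≤ 2 * (∑ s, (R - Q) s ⬝ᵥ (V *ᵥ (P - R) s)) + t * matNorm V (P - R) ^ 2 := by
    intro t ht ht1
    have hmem : R + t • (P - R) ∈ s := hconv.add_smul_sub_mem hm hP ⟨ht.le, ht1⟩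
    have h1 : matNorm V (R - Q) ≤ matNorm V (R + t • (P - R) - Q) := hmin hmem
    have h2 := pow_le_pow_left₀ (matNorm_nonneg _) h1 2
    rw [hsum] at h2
    have h3 : 0 ≤ t * (2 * (∑ s, (R - Q) s ⬝ᵥ (V *ᵥ (P - R) s)) + t * matNorm V (P - R) ^ 2) := by
      nlinarith
    exact nonneg_of_mul_nonneg_right h3 ht
  -- minimality of `R` as `t → 0`: the angle at `R` is obtuse
  have hcross : 0 ≤ ∑ s, (R - Q) s ⬝ᵥ (V *ᵥ (P - R) s) := by
    by_contra! hneg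
    set x := ∑ s, (R - Q) s ⬝ᵥ (V *ᵥ (P - R) s)
    set y := matNorm V (P - R) ^ 2
    have hy : 0 ≤ y := sq_nonneg _
    have h := hle (min 1 (-x / (y + 1))) (lt_min one_pos (div_pos (by linarith) (by linarith)))
      (min_le_left _ _)
    have h2 : min 1 (-x / (y + 1)) * y ≤ -x := by
      calc min 1 (-x / (y + 1)) * y ≤ -x / (y + 1) * y := by gcongr; exact min_le_right _ _
        _ ≤ -x := by
          rw [div_mul_eq_mul_div, div_le_iff₀ (by linarith)]
          nlinarith
    linarith
  have h1 := hsum 1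
  have e : R + (1 : ℝ) • (P - R) - Q = P - Q := by rw [one_smul]; abel
  rw [e] at h1
  refine (abs_le_of_sq_le_sq' ?_ (matNorm_nonneg _)).2
  nlinarith [sq_nonneg (matNorm V (R - Q))]

theorem convex_subDist_matrices :
    Convex ℝ {P : Matrix S (Fin d) ℝ | ∀ j, (fun s' => P s' j) ∈ subDist S} := by
  intro P hP Q hQ a b ha hb hab j
  refine ⟨fun s => ?_, ?_⟩
  · have h1 := (hP j).1 s
    have h2 := (hQ j).1 s
    simp only [Matrix.add_apply, Matrix.smul_apply, smul_eq_mul]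
    positivity
  · have h1 := (hP j).2
    have h2 := (hQ j).2
    simp only [Matrix.add_apply, Matrix.smul_apply, smul_eq_mul, Finset.sum_add_distrib,
      ← Finset.mul_sum]
    nlinarith

end MatNorm

/-! ### The Bellman equation -/

section Bellman

variable {S A : Type*} [Fintype S] [DecidableEq S]

theorem policyMatrix_pow_nonneg {P : S → A → S → ℝ} (hP : ∀ s a s', 0 ≤ P s a s') (π : S → A)
    (t : ℕ) (s s' : S) : 0 ≤ (policyMatrix P π ^ t) s s' := by
  induction t generalizing s s' with
  | zero => rw [pow_zero, Matrix.one_apply]; split_ifs <;> simp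
  | succ t ih =>
    rw [pow_succ, Matrix.mul_apply]
    exact Finset.sum_nonneg fun i _ => mul_nonneg (ih _ _) (hP _ _ _)

theorem value_bellman {l : S → A → ℝ} {P : S → A → S → ℝ} (hl : ∀ s a, 0 ≤ l s a)
    (hP : ∀ s a s', 0 ≤ P s a s') (π : S → A) (s : S) :
    value l P π s = ENNReal.ofReal (l s (π s)) +
      ∑ s', ENNReal.ofReal (P s (π s) s') * value l P π s' := by
  have hnn : ∀ t s, 0 ≤ ((policyMatrix P π ^ t) *ᵥ fun s' => l s' (π s')) s := fun t s =>
    Finset.sum_nonneg fun i _ => mul_nonneg (policyMatrix_pow_nonneg hP π t s i) (hl _ _)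
  have hstep : ∀ t, ENNReal.ofReal (((policyMatrix P π ^ (t + 1)) *ᵥ fun s' => l s' (π s')) s) =
      ∑ s', ENNReal.ofReal (P s (π s) s') *
        ENNReal.ofReal (((policyMatrix P π ^ t) *ᵥ fun s' => l s' (π s')) s') := by
    intro t
    rw [pow_succ', ← mulVec_mulVec]
    change ENNReal.ofReal (∑ i, P s (π s) i *
      ((policyMatrix P π ^ t) *ᵥ fun s' => l s' (π s')) i) = _
    rw [ENNReal.ofReal_sum_of_nonneg fun i _ => mul_nonneg (hP _ _ _) (hnn t i)]
    exact Finset.sum_congr rfl fun i _ => ENNReal.ofReal_mul (hP _ _ _)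
  unfold value
  rw [tsum_eq_zero_add' ENNReal.summable]
  congr 1
  · simp
  · simp_rw [hstep, ← ENNReal.tsum_mul_left]
    exact Summable.tsum_finsetSum fun _ _ => ENNReal.summable

theorem value_toReal_bellman {l : S → A → ℝ} {P : S → A → S → ℝ} (hl : ∀ s a, 0 ≤ l s a)
    (hP : ∀ s a s', 0 ≤ P s a s') (π : S → A) (hfin : ∀ s, value l P π s ≠ ∞) (s : S) :
    (value l P π s).toReal = l s (π s) + ∑ s', P s (π s) s' * (value l P π s').toReal := by
  conv_lhs => rw [value_bellman hl hP]
  have hne : ∀ s' ∈ Finset.univ, ENNReal.ofReal (P s (π s) s') * value l P π s' ≠ ∞ :=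
    fun s' _ => ENNReal.mul_ne_top ENNReal.ofReal_ne_top (hfin s')
  rw [ENNReal.toReal_add ENNReal.ofReal_ne_top (ENNReal.sum_ne_top.2 hne),
    ENNReal.toReal_ofReal (hl _ _), ENNReal.toReal_sum hne]
  congr 1
  refine Finset.sum_congr rfl fun s' _ => ?_
  rw [ENNReal.toReal_mul, ENNReal.toReal_ofReal (hP _ _ _)]

end Bellman

theorem dotProduct_mem_Icc {d : ℕ} {c L : Fin d → ℝ} {a b : ℝ} (hc : c ∈ contexts d)
    (hL : ∀ j, L j ∈ Set.Icc a b) : c ⬝ᵥ L ∈ Set.Icc a b := by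
  have h : ∀ x : ℝ, ∑ j, c j * x = x := fun x => by rw [← Finset.sum_mul, hc.2, one_mul]
  constructor
  · rw [← h a]
    exact Finset.sum_le_sum fun j _ => mul_le_mul_of_nonneg_left (hL j).1 (hc.1 j)
  · rw [← h b]
    exact Finset.sum_le_sum fun j _ => mul_le_mul_of_nonneg_left (hL j).2 (hc.1 j)

theorem dotProduct_self_le_one {d : ℕ} {c : Fin d → ℝ} (hc : c ∈ contexts d) : c ⬝ᵥ c ≤ 1 :=
  (dotProduct_mem_Icc (L := c) hc fun j => ⟨hc.1 j, by
    rw [← hc.2]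
    exact Finset.single_le_sum (fun i _ => hc.1 i) (Finset.mem_univ j)⟩).2

theorem LinearCSSP.meanLoss_mem {S A : Type*} [Fintype S] {d : ℕ} {lmin : ℝ}
    (M : LinearCSSP S A d lmin) {c : Fin d → ℝ} (hc : c ∈ contexts d) (s : S) (a : A) :
    M.meanLoss c s a ∈ Set.Icc lmin 1 := dotProduct_mem_Icc hc (M.Lstar_mem s a)

theorem LinearCSSP.dyn_mem {S A : Type*} [Fintype S] {d : ℕ} {lmin : ℝ}
    (M : LinearCSSP S A d lmin) {c : Fin d → ℝ} (hc : c ∈ contexts d) (s : S) (a : A) :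
    M.dyn c s a ∈ subDist S := by
  refine ⟨fun s' => ?_, ?_⟩
  · change 0 ≤ ∑ j, M.Pstar s a s' j * c j
    exact Finset.sum_nonneg fun j _ => mul_nonneg ((M.Pstar_mem s a j).1 s') (hc.1 j)
  have h : ∑ s', M.dyn c s a s' = c ⬝ᵥ fun j => ∑ s', M.Pstar s a s' j := by
    simp only [LinearCSSP.dyn, mulVec, dotProduct, Finset.mul_sum]
    rw [Finset.sum_comm]
    simp only [mul_comm]
  rw [h]
  exact (dotProduct_mem_Icc (a := 0) hc fun j =>
    ⟨Finset.sum_nonneg fun s' _ => (M.Pstar_mem s a j).1 s', (M.Pstar_mem s a j).2⟩).2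

/-! ### The structure of the intervals -/

namespace Trajectory

variable {S A : Type*} [Fintype S] [DecidableEq S] [Fintype A] [DecidableEq A] {d : ℕ}
  {p : Params} {tr : Trajectory S A d}

/-- The pair played at step `t` is known in the current interval. -/
def KnownAt (p : Params) (tr : Trajectory S A d) (t : ℕ) : Prop :=
  tr.Known p (tr.intervalStart p t) (tr.intervalIndex p t) (tr.state t) (tr.act t)

/-- Step `t` is the last step of its interval. -/
def EndsAt (p : Params) (tr : Trajectory S A d) (t : ℕ) : Prop :=
  tr.next t = none ∨ ¬ tr.KnownAt p t

theorem interval_succ_of_endsAt {t : ℕ} (h : tr.EndsAt p t) :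
    tr.interval p (t + 1) = (t + 1, tr.intervalIndex p t + 1) := by
  rw [interval]; exact if_pos h

theorem interval_succ_of_not_endsAt {t : ℕ} (h : ¬ tr.EndsAt p t) :
    tr.interval p (t + 1) = tr.interval p t := by
  rw [interval]; exact if_neg h

theorem intervalStart_le (t : ℕ) : tr.intervalStart p t ≤ t := by
  induction t with
  | zero => exact le_rfl
  | succ t ih =>
    by_cases h : tr.EndsAt p t
    · rw [intervalStart, interval_succ_of_endsAt h]
    · rw [intervalStart, interval_succ_of_not_endsAt h]; exact ih.trans (Nat.le_succ t)

theorem intervalStart_succ_eq_iff (t : ℕ) :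
    tr.intervalStart p (t + 1) = t + 1 ↔ tr.EndsAt p t := by
  constructor
  · intro h
    by_contra hne
    rw [intervalStart, interval_succ_of_not_endsAt hne] at h
    have := intervalStart_le (p := p) (tr := tr) t
    rw [intervalStart] at this
    omega
  · intro h; rw [intervalStart, interval_succ_of_endsAt h]

theorem intervalIndex_succ_of_endsAt {t : ℕ} (h : tr.EndsAt p t) :
    tr.intervalIndex p (t + 1) = tr.intervalIndex p t + 1 := by
  rw [intervalIndex, interval_succ_of_endsAt h]

theorem intervalIndex_succ_of_not_endsAt {t : ℕ} (h : ¬ tr.EndsAt p t) :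
    tr.intervalIndex p (t + 1) = tr.intervalIndex p t := by
  rw [intervalIndex, interval_succ_of_not_endsAt h, intervalIndex]

theorem intervalStart_succ_of_not_endsAt {t : ℕ} (h : ¬ tr.EndsAt p t) :
    tr.intervalStart p (t + 1) = tr.intervalStart p t := by
  rw [intervalStart, interval_succ_of_not_endsAt h, intervalStart]

theorem intervalIndex_mono : Monotone (tr.intervalIndex p) := by
  refine monotone_nat_of_le_succ fun t => ?_
  by_cases h : tr.EndsAt p t
  · rw [intervalIndex_succ_of_endsAt h]; omega
  · rw [intervalIndex_succ_of_not_endsAt h]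

theorem one_le_intervalIndex (t : ℕ) : 1 ≤ tr.intervalIndex p t :=
  (intervalIndex_mono (p := p) (tr := tr) (Nat.zero_le t)).trans' le_rfl

theorem intervalIndex_le (t : ℕ) : tr.intervalIndex p t ≤ t + 1 := by
  induction t with
  | zero => exact le_rfl
  | succ t ih =>
    by_cases h : tr.EndsAt p t
    · rw [intervalIndex_succ_of_endsAt h]; omega
    · rw [intervalIndex_succ_of_not_endsAt h]; omega

theorem not_endsAt_of_intervalIndex_eq {i t : ℕ} (hit : i < t)
    (h : tr.intervalIndex p i = tr.intervalIndex p t) : ¬ tr.EndsAt p i := by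
  intro he
  have h1 := intervalIndex_mono (p := p) (tr := tr) (show i + 1 ≤ t from hit)
  rw [intervalIndex_succ_of_endsAt he] at h1
  omega

/-- The steps before `t` in the interval of `t` are those from the start of that interval. -/
theorem intervalStart_le_iff {i t : ℕ} (hit : i ≤ t) :
    tr.intervalStart p t ≤ i ↔ tr.intervalIndex p i = tr.intervalIndex p t := by
  induction t with
  | zero =>
    obtain rfl : i = 0 := by omega
    simp [intervalStart, interval]
  | succ t ih =>
    by_cases h : tr.EndsAt p t
    · rw [(intervalStart_succ_eq_iff t).2 h, intervalIndex_succ_of_endsAt h]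
      constructor
      · intro h2
        obtain rfl : i = t + 1 := by omega
        exact intervalIndex_succ_of_endsAt h
      · intro h2
        by_contra hlt
        have := intervalIndex_mono (p := p) (tr := tr) (show i ≤ t by omega)
        omega
    · rw [intervalStart_succ_of_not_endsAt h, intervalIndex_succ_of_not_endsAt h]
      rcases hit.eq_or_lt with rfl | hlt
      · rw [intervalIndex_succ_of_not_endsAt h]
        have := intervalStart_le (p := p) (tr := tr) t
        simp only [iff_true]; omega
      · exact ih (by omega)

theorem intervalStart_pos {t : ℕ} (h : 2 ≤ tr.intervalIndex p t) : 0 < tr.intervalStart p t := by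
  rw [Nat.pos_iff_ne_zero]
  intro h0
  have := (intervalStart_le_iff (p := p) (tr := tr) (Nat.zero_le t)).1 h0.le
  have h1 : tr.intervalIndex p 0 = 1 := rfl
  omega

theorem intervalStart_intervalStart (t : ℕ) :
    tr.intervalStart p (tr.intervalStart p t) = tr.intervalStart p t := by
  induction t with
  | zero => rfl
  | succ t ih =>
    by_cases h : tr.EndsAt p t
    · have := (intervalStart_succ_eq_iff t).2 h
      rw [this, this]
    · rw [intervalStart_succ_of_not_endsAt h, ih]

section Run

variable {M : LinearCSSP S A d p.lmin}

theorem IsRun.next_eq_of_not_endsAt (hr : tr.IsRun p M) {t : ℕ} (h : ¬ tr.EndsAt p t) :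
    tr.next t = some (tr.state (t + 1)) := by
  rw [hr.state_succ]
  cases hn : tr.next t with
  | none => exact absurd (Or.inl hn) h
  | some s => rfl

theorem IsRun.keep_of_not_endsAt (hr : tr.IsRun p M) {t : ℕ} (h : ¬ tr.EndsAt p t) :
    tr.policy (t + 1) = tr.policy t ∧ tr.optLoss (t + 1) = tr.optLoss t ∧
      tr.optDyn (t + 1) = tr.optDyn t :=
  hr.keep t fun h2 => h ((intervalStart_succ_eq_iff t).1 h2)

theorem IsRun.optValue_succ_of_not_endsAt (hr : tr.IsRun p M) {t : ℕ} (h : ¬ tr.EndsAt p t) :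
    tr.optValue (t + 1) = tr.optValue t := by
  obtain ⟨h1, h2, h3⟩ := hr.keep_of_not_endsAt h
  funext s
  rw [optValue, optValue, h1, h2, h3]

theorem IsRun.eq_intervalStart (hr : tr.IsRun p M) (t : ℕ) :
    tr.ctx t = tr.ctx (tr.intervalStart p t) ∧ tr.policy t = tr.policy (tr.intervalStart p t) ∧
      tr.optLoss t = tr.optLoss (tr.intervalStart p t) ∧
      tr.optDyn t = tr.optDyn (tr.intervalStart p t) := by
  induction t with
  | zero => exact ⟨rfl, rfl, rfl, rfl⟩
  | succ t ih =>
    by_cases h : tr.EndsAt p t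
    · rw [(intervalStart_succ_eq_iff t).2 h]; exact ⟨rfl, rfl, rfl, rfl⟩
    · obtain ⟨h1, h2, h3⟩ := hr.keep_of_not_endsAt h
      have hc := hr.ctx_const t fun hn => h (Or.inl hn)
      rw [intervalStart_succ_of_not_endsAt h, h1, h2, h3, hc]
      exact ih

/-! ### Optimism -/

/-- The parameters of a run for which the analysis holds: `Bstar` bounds the optimal values. -/
structure Admissible (p : Params) (M : LinearCSSP S A d p.lmin) : Prop where
  lam : 1 ≤ p.lam
  delta_pos : 0 < p.delta
  delta_lt : p.delta < 1
  lmin_pos : 0 < p.lmin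
  Bstar : 1 ≤ p.Bstar
  optValue_le : ∀ c ∈ contexts d, ∀ s, M.optValue c s ≤ ENNReal.ofReal p.Bstar

theorem gram_posDef (hp : Admissible p M) (n : ℕ) (s : S) (a : A) : (tr.gram p n s a).PosDef :=
  ridgeGram_posDef (lt_of_lt_of_le one_pos hp.lam) _ _

/-- The optimistic value functions are bounded by `Bstar`, since the true model is plausible. -/
theorem IsRun.value_le (hr : tr.IsRun p M) (hp : Admissible p M) {t : ℕ}
    (h2 : 2 ≤ tr.intervalIndex p t)
    (hL : ∀ s a, M.Lstar s a ∈ tr.lossConf p (tr.intervalStart p t) s a)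
    (hP : ∀ s a, M.Pstar s a ∈ tr.dynConf p (tr.intervalStart p t) s a) :
    tr.optLoss t ∈ tr.lossConfAt p (tr.intervalStart p t) (tr.ctx (tr.intervalStart p t)) ∧
    tr.optDyn t ∈ tr.dynConfAt p (tr.intervalStart p t) (tr.ctx (tr.intervalStart p t)) ∧
    ∀ s, value (tr.optLoss t) (tr.optDyn t) (tr.policy t) s ≤ ENNReal.ofReal p.Bstar := by
  -- the triple in force was chosen at the start of the interval, with the data of that time
  obtain ⟨-, h4, h5, h6⟩ := hr.eq_intervalStart t
  rw [h4, h5, h6]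
  have hss := intervalStart_intervalStart (p := p) (tr := tr) t
  obtain ⟨u, hu⟩ : ∃ u, tr.intervalStart p t = u + 1 :=
    Nat.exists_eq_succ_of_ne_zero (intervalStart_pos h2).ne'
  rw [hu] at hss hL hP ⊢
  have hc := hr.ctx_mem (u + 1)
  have hLm : M.meanLoss (tr.ctx (u + 1)) ∈ tr.lossConfAt p (u + 1) (tr.ctx (u + 1)) := fun s a =>
    ⟨⟨hp.lmin_pos.le.trans (M.meanLoss_mem hc s a).1, (M.meanLoss_mem hc s a).2⟩,
      M.Lstar s a, hL s a, dotProduct_comm _ _⟩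
  have hPm : M.dyn (tr.ctx (u + 1)) ∈ tr.dynConfAt p (u + 1) (tr.ctx (u + 1)) := fun s a =>
    ⟨M.dyn_mem hc s a, M.Pstar s a, hP s a, rfl⟩
  obtain ⟨ho1, ho2, ho3⟩ := hr.optimistic u hss ⟨_, hLm⟩ ⟨_, hPm⟩
  refine ⟨ho1, ho2, fun s => le_trans ?_ (hp.optValue_le _ hc s)⟩
  unfold LinearCSSP.optValue
  exact le_iInf fun π => ho3 π.1 _ hLm _ hPm s

theorem optValue_nonneg (t : ℕ) (s : S) : 0 ≤ tr.optValue t s := ENNReal.toReal_nonneg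

/-- The values of the optimistic model at step `t` are at most `Bstar`. -/
def BoundedAt (p : Params) (tr : Trajectory S A d) (t : ℕ) : Prop :=
  ∀ s, tr.optValue t s ≤ p.Bstar

/-- In the true model, the optimistic value decreases in expectation at step `t` by at least `3/5`
of the mean loss. -/
def DriftAt (M : LinearCSSP S A d p.lmin) (tr : Trajectory S A d) (t : ℕ) : Prop :=
  3 / 5 * M.meanLoss (tr.ctx t) (tr.state t) (tr.act t) +
    ∑ s', M.dyn (tr.ctx t) (tr.state t) (tr.act t) s' * tr.optValue t s' ≤
    tr.optValue t (tr.state t)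

theorem IsRun.boundedAt (hr : tr.IsRun p M) (hp : Admissible p M) {t : ℕ}
    (h2 : 2 ≤ tr.intervalIndex p t)
    (hL : ∀ s a, M.Lstar s a ∈ tr.lossConf p (tr.intervalStart p t) s a)
    (hP : ∀ s a, M.Pstar s a ∈ tr.dynConf p (tr.intervalStart p t) s a) :
    tr.BoundedAt p t := fun s =>
  ENNReal.toReal_le_of_le_ofReal (by linarith [hp.Bstar]) ((hr.value_le hp h2 hL hP).2.2 s)

theorem one_le_card_state (M : LinearCSSP S A d p.lmin) : (1 : ℝ) ≤ Fintype.card S := by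
  have : Nonempty S := ⟨M.sInit 0⟩
  exact_mod_cast Nat.succ_le_of_lt Fintype.card_pos

theorem one_le_card_action [Nonempty A] : (1 : ℝ) ≤ Fintype.card A := by
  exact_mod_cast Nat.succ_le_of_lt Fintype.card_pos

theorem radius_pos (hp : Admissible p M) (n : ℕ) (s : S) (a : A) : 0 < tr.radius p n s a :=
  add_pos_of_nonneg_of_pos (Real.sqrt_nonneg _) (Real.sqrt_pos.2 (by linarith [hp.lam]))

theorem lossRadius_le_radius (hp : Admissible p M) (n : ℕ) (s : S) (a : A) :
    tr.lossRadius p n s a ≤ tr.radius p n s a := by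
  have : Nonempty A := ⟨a⟩
  have h1 := one_le_card_state M
  have h2 := one_le_card_action (A := A)
  have h3 := hp.delta_pos
  have h4 := hp.lam
  unfold lossRadius radius
  gcongr
  nlinarith

/-- At a known pair the confidence sets are so small that the optimistic model may be replaced by
the true one in the Bellman equation: the errors of the losses and of the dynamics cost at most
`lmin / 5` each. -/
theorem IsRun.driftAt (hr : tr.IsRun p M) (hp : Admissible p M) {t : ℕ}
    (h2 : 2 ≤ tr.intervalIndex p t)
    (hL : ∀ s a, M.Lstar s a ∈ tr.lossConf p (tr.intervalStart p t) s a)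
    (hP : ∀ s a, M.Pstar s a ∈ tr.dynConf p (tr.intervalStart p t) s a)
    (hk : tr.KnownAt p t) : DriftAt M tr t := by
  obtain ⟨hl, hd, hv⟩ := hr.value_le hp h2 hL hP
  have hbd := hr.boundedAt hp h2 hL hP
  obtain ⟨hctx, -, -, -⟩ := hr.eq_intervalStart t
  have hfin : ∀ s, value (tr.optLoss t) (tr.optDyn t) (tr.policy t) s ≠ ∞ := fun s =>
    ((hv s).trans_lt ENNReal.ofReal_lt_top).ne
  have hbell := value_toReal_bellman (fun s a => (hl s a).1.1) (fun s a => (hd s a).1.1)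
    (tr.policy t) hfin (tr.state t)
  unfold DriftAt
  change tr.optValue t (tr.state t) = tr.optLoss t (tr.state t) (tr.act t) +
    ∑ s', tr.optDyn t (tr.state t) (tr.act t) s' * tr.optValue t s' at hbell
  rw [hbell]
  unfold KnownAt Known at hk
  rw [hctx] at *
  set u := tr.intervalStart p t
  set s := tr.state t
  set a := tr.act t
  set c := tr.ctx u with hcdef
  have hV := gram_posDef (tr := tr) hp u s a
  set V := tr.gram p u s a
  have hρ := radius_pos (tr := tr) hp u s a
  have hρl := lossRadius_le_radius (tr := tr) hp u s a
  set ρ := tr.radius p u s a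
  have hS := one_le_card_state M
  set N := (Fintype.card S : ℝ)
  have hB := hp.Bstar
  have hc0 : 0 ≤ vecNorm V⁻¹ c := vecNorm_nonneg _
  have hsmall : 10 * p.Bstar * (N * ρ) * vecNorm V⁻¹ c ≤ p.lmin := by
    have hmax : 0 < max (N * ρ)
        (Real.sqrt (Real.log (4 * (tr.intervalIndex p t : ℕ) / p.delta))) :=
      lt_max_of_lt_left (by positivity)
    rw [lt_div_iff₀ (by positivity)] at hk
    calc 10 * p.Bstar * (N * ρ) * vecNorm V⁻¹ c ≤ _ := by
          rw [mul_comm]; gcongr; exact le_max_left _ _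
      _ ≤ p.lmin := hk.le
  -- two points of the confidence ellipsoid differ by at most `2 ρ ‖c‖` in the direction `c`
  have hloss : M.meanLoss c s a - p.lmin / 5 ≤ tr.optLoss t s a := by
    obtain ⟨-, L, hLc, hLe⟩ := hl s a
    rw [hLe, LinearCSSP.meanLoss, dotProduct_comm c]
    have h3 := (le_abs_self _).trans (abs_dotProduct_le hV (M.Lstar s a - L) c)
    rw [sub_dotProduct] at h3
    have h4 := vecNorm_sub_le hV.posSemidef (M.Lstar s a) L (tr.lossEst p u s a)
    have h5 : vecNorm V (M.Lstar s a - L) ≤ 2 * ρ :=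
      h4.trans (by
        have e1 : vecNorm V (M.Lstar s a - tr.lossEst p u s a) ≤ tr.lossRadius p u s a := hL s a
        have e2 : vecNorm V (L - tr.lossEst p u s a) ≤ tr.lossRadius p u s a := hLc
        linarith)
    have h6 : vecNorm V (M.Lstar s a - L) * vecNorm V⁻¹ c ≤ 2 * ρ * vecNorm V⁻¹ c := by gcongr
    have h7 : 10 * 1 * (1 * ρ) * vecNorm V⁻¹ c ≤ 10 * p.Bstar * (N * ρ) * vecNorm V⁻¹ c := by
      gcongr
    linarith
  -- the same for each row; summing over the rows turns `√|S| ρ` into `|S| ρ`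
  have hdyn : ∑ s', M.dyn c s a s' * tr.optValue t s' - p.lmin / 5 ≤
      ∑ s', tr.optDyn t s a s' * tr.optValue t s' := by
    obtain ⟨-, P, hPc, hPe⟩ := hd s a
    have h3 : ∀ s', M.dyn c s a s' * tr.optValue t s' - tr.optDyn t s a s' * tr.optValue t s' ≤
        (vecNorm V ((M.Pstar s a - tr.dynEst p u s a) s') +
          vecNorm V ((P - tr.dynEst p u s a) s')) * (vecNorm V⁻¹ c * p.Bstar) := by
      intro s'
      rw [hPe, ← sub_mul]
      have h4 : M.dyn c s a s' - (P *ᵥ c) s' = (M.Pstar s a s' - P s') ⬝ᵥ c := by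
        rw [sub_dotProduct]; rfl
      have h5 := (le_abs_self _).trans (abs_dotProduct_le hV (M.Pstar s a s' - P s') c)
      have h6 := vecNorm_sub_le hV.posSemidef (M.Pstar s a s') (P s') (tr.dynEst p u s a s')
      rw [h4]
      have h7 : vecNorm V (M.Pstar s a s' - P s') * vecNorm V⁻¹ c ≤
          (vecNorm V ((M.Pstar s a - tr.dynEst p u s a) s') +
          vecNorm V ((P - tr.dynEst p u s a) s')) * vecNorm V⁻¹ c := by
        gcongr; exact h6
      have h8 := optValue_nonneg (tr := tr) t s'
      have h9 := hbd s'
      have h10 : 0 ≤ (vecNorm V ((M.Pstar s a - tr.dynEst p u s a) s') +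
          vecNorm V ((P - tr.dynEst p u s a) s')) * vecNorm V⁻¹ c :=
        mul_nonneg (add_nonneg (vecNorm_nonneg _) (vecNorm_nonneg _)) hc0
      rw [← mul_assoc]
      exact mul_le_mul (h5.trans h7) h9 h8 h10
    have h4 := Finset.sum_le_sum fun s' (_ : s' ∈ Finset.univ) => h3 s'
    rw [Finset.sum_sub_distrib, ← Finset.sum_mul, Finset.sum_add_distrib] at h4
    have h5 := (sum_vecNorm_le hV.posSemidef (M.Pstar s a - tr.dynEst p u s a)).trans
      (mul_le_mul_of_nonneg_left (hP s a) (Real.sqrt_nonneg _))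
    have h6 := (sum_vecNorm_le hV.posSemidef (P - tr.dynEst p u s a)).trans
      (mul_le_mul_of_nonneg_left hPc (Real.sqrt_nonneg _))
    rw [← mul_assoc, Real.mul_self_sqrt (by positivity)] at h5 h6
    have h7 : (∑ s', vecNorm V ((M.Pstar s a - tr.dynEst p u s a) s') +
        ∑ s', vecNorm V ((P - tr.dynEst p u s a) s')) * (vecNorm V⁻¹ c * p.Bstar) ≤
        (N * ρ + N * ρ) * (vecNorm V⁻¹ c * p.Bstar) := by
      have : 0 ≤ vecNorm V⁻¹ c * p.Bstar := by positivity
      gcongr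
    linarith
  have hm := (M.meanLoss_mem (hr.ctx_mem u) s a).1
  rw [← hcdef] at hm
  linarith

end Run

end Trajectory

namespace Trajectory

variable {S A : Type*} [Fintype S] [DecidableEq S] [Fintype A] [DecidableEq A] {d : ℕ}
  {p : Params} {tr : Trajectory S A d} {M : LinearCSSP S A d p.lmin}

/-! ### The number of visits to unknown pairs -/

theorem visits_succ_of_visit {n : ℕ} {s : S} {a : A} (h : tr.state n = s ∧ tr.act n = a) :
    tr.visits (n + 1) s a = insert n (tr.visits n s a) := by
  rw [visits, Finset.range_add_one, Finset.filter_insert, if_pos h, visits]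

theorem visits_succ_of_not_visit {n : ℕ} {s : S} {a : A}
    (h : ¬ (tr.state n = s ∧ tr.act n = a)) : tr.visits (n + 1) s a = tr.visits n s a := by
  rw [visits, Finset.range_add_one, Finset.filter_insert, if_neg h, visits]

theorem notMem_visits (n : ℕ) (s : S) (a : A) : n ∉ tr.visits n s a := by simp [visits]

theorem card_visits_le (n : ℕ) (s : S) (a : A) : (tr.visits n s a).card ≤ n :=
  (Finset.card_filter_le _ _).trans (by simp)

theorem gram_succ_of_visit {n : ℕ} {s : S} {a : A} (h : tr.state n = s ∧ tr.act n = a) :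
    tr.gram p (n + 1) s a = tr.gram p n s a + vecMulVec (tr.ctx n) (tr.ctx n) := by
  have := ridgeGram_insert (lam := p.lam) (notMem_visits (tr := tr) n s a) tr.ctx
  rw [← visits_succ_of_visit h] at this
  exact this

theorem gram_succ_of_not_visit {n : ℕ} {s : S} {a : A}
    (h : ¬ (tr.state n = s ∧ tr.act n = a)) : tr.gram p (n + 1) s a = tr.gram p n s a := by
  rw [gram, visits_succ_of_not_visit h, gram]

theorem visits_eq_of_forall_not_visit {u t : ℕ} (hut : u ≤ t) {s : S} {a : A}
    (h : ∀ i, u ≤ i → i < t → ¬ (tr.state i = s ∧ tr.act i = a)) :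
    tr.visits t s a = tr.visits u s a := by
  induction t, hut using Nat.le_induction with
  | base => rfl
  | succ t hut ih =>
    rw [visits_succ_of_not_visit (h t hut (by omega)), ih fun i h1 h2 => h i h1 (by omega)]

/-- An unknown pair is not visited before the last step of the interval, so its data at the time
of the visit are those at the start of the interval. -/
theorem visits_intervalStart_of_not_knownAt {t : ℕ} (h : ¬ tr.KnownAt p t) :
    tr.visits t (tr.state t) (tr.act t) =
      tr.visits (tr.intervalStart p t) (tr.state t) (tr.act t) := by
  refine visits_eq_of_forall_not_visit (intervalStart_le t) fun i h1 h2 hv => ?_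
  have hi := (intervalStart_le_iff h2.le).1 h1
  have hs : tr.intervalStart p i = tr.intervalStart p t := by
    have hle := (intervalStart_le_iff (p := p) (tr := tr)
      ((intervalStart_le (p := p) (tr := tr) i).trans h2.le)).2
      (((intervalStart_le_iff (p := p) (tr := tr) (intervalStart_le i)).1 le_rfl).trans hi)
    have hge := (intervalStart_le_iff (p := p) (tr := tr) h1).2
      (((intervalStart_le_iff (p := p) (tr := tr) (intervalStart_le t)).1 le_rfl).trans hi.symm)
    omega
  have hk : tr.KnownAt p i := by
    by_contra hk
    exact not_endsAt_of_intervalIndex_eq h2 hi (Or.inr hk)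
  refine h ?_
  unfold KnownAt at hk ⊢
  rwa [hi, hs, hv.1, hv.2] at hk

theorem det_gram_succ_of_visit (hp : Admissible p M) {n : ℕ} {s : S} {a : A}
    (h : tr.state n = s ∧ tr.act n = a) :
    (tr.gram p (n + 1) s a).det =
      (tr.gram p n s a).det * (1 + vecNorm (tr.gram p n s a)⁻¹ (tr.ctx n) ^ 2) := by
  have hV := gram_posDef (tr := tr) hp n s a
  rw [gram_succ_of_visit h, det_add_vecMulVec hV, vecNorm_sq hV.inv.posSemidef]

open Classical in
/-- The visits before time `n` to the pair `(s,a)` while it is unknown. -/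
noncomputable def unknownVisits (p : Params) (tr : Trajectory S A d) (n : ℕ) (s : S) (a : A) :
    Finset ℕ :=
  (Finset.range n).filter fun t => (tr.state t = s ∧ tr.act t = a) ∧ ¬ tr.KnownAt p t

open Classical in
/-- The number of steps before time `n` that visit a pair unknown in the current interval. -/
noncomputable def unknownCount (p : Params) (tr : Trajectory S A d) (n : ℕ) : ℕ :=
  ((Finset.range n).filter fun t => ¬ tr.KnownAt p t).card

theorem unknownCount_eq_sum (n : ℕ) :
    tr.unknownCount p n = ∑ x : S × A, (tr.unknownVisits p n x.1 x.2).card := by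
  classical
  unfold unknownCount
  rw [Finset.card_eq_sum_card_fiberwise (f := fun t => (tr.state t, tr.act t)) (t := Finset.univ)
    fun _ _ => Finset.mem_coe.2 (Finset.mem_univ _)]
  refine Finset.sum_congr rfl fun x _ => ?_
  congr 1
  ext t
  simp only [unknownVisits, Finset.mem_filter, Prod.ext_iff]
  tauto

/-- The elliptical potential argument: every visit to an unknown pair increases the logarithm of
the determinant of its Gram matrix by a definite amount. -/
theorem card_unknownVisits_mul_le (hp : Admissible p M) (s : S) (a : A) {κ : ℝ} {n : ℕ}
    (hκ : ∀ t < n, ¬ tr.KnownAt p t → κ ≤ Real.log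
      (1 + vecNorm (tr.gram p t (tr.state t) (tr.act t))⁻¹ (tr.ctx t) ^ 2)) :
    (tr.unknownVisits p n s a).card * κ ≤
      Real.log (tr.gram p n s a).det - Real.log (p.lam ^ d) := by
  classical
  induction n with
  | zero => simp [unknownVisits, gram, visits]
  | succ n ih =>
    have ih' := ih fun t ht => hκ t (by omega)
    by_cases hv : tr.state n = s ∧ tr.act n = a
    · have hdet := (gram_posDef (tr := tr) hp n s a).det_pos
      have hw : 0 < 1 + vecNorm (tr.gram p n s a)⁻¹ (tr.ctx n) ^ 2 := by positivity
      rw [det_gram_succ_of_visit hp hv, Real.log_mul hdet.ne' hw.ne']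
      by_cases hk : tr.KnownAt p n
      · have h1 : tr.unknownVisits p (n + 1) s a = tr.unknownVisits p n s a := by
          rw [unknownVisits, Finset.range_add_one, Finset.filter_insert, if_neg (by tauto),
            unknownVisits]
        have h2 : 0 ≤ Real.log (1 + vecNorm (tr.gram p n s a)⁻¹ (tr.ctx n) ^ 2) :=
          Real.log_nonneg (by linarith [sq_nonneg (vecNorm (tr.gram p n s a)⁻¹ (tr.ctx n))])
        rw [h1]; linarith
      · have h1 : (tr.unknownVisits p (n + 1) s a).card = (tr.unknownVisits p n s a).card + 1 := by
          rw [unknownVisits, Finset.range_add_one, Finset.filter_insert, if_pos ⟨hv, hk⟩,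
            Finset.card_insert_of_notMem (by simp), unknownVisits]
        have h2 := hκ n (by omega) hk
        rw [hv.1, hv.2] at h2
        rw [h1]; push_cast; linarith
    · have h1 : tr.unknownVisits p (n + 1) s a = tr.unknownVisits p n s a := by
        rw [unknownVisits, Finset.range_add_one, Finset.filter_insert, if_neg (by tauto),
          unknownVisits]
      rw [h1, gram_succ_of_not_visit hv]; exact ih'

/-- The logarithmic factor `log (8 |S|² |A| (1 + n) / δ)`, an upper bound for all logarithms in
the confidence radii before time `n`. -/
noncomputable def logTerm (S A : Type*) [Fintype S] [Fintype A] (p : Params) (n : ℕ) : ℝ :=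
  Real.log (8 * (Fintype.card S : ℝ) ^ 2 * Fintype.card A * (1 + n) / p.delta)

theorem two_lt_log_eight : (2 : ℝ) < Real.log 8 := by
  rw [show (8 : ℝ) = 2 ^ 3 by norm_num, Real.log_pow]
  have := Real.log_two_gt_d9
  push_cast
  linarith

theorem le_logTerm [Nonempty A] (hp : Admissible p M) {x : ℝ} (hx : 0 < x) {n : ℕ}
    (h : x ≤ 8 * (1 + n)) : Real.log (x / p.delta) ≤ logTerm S A p n := by
  have h1 := one_le_card_state M
  have h2 := one_le_card_action (A := A)
  have h3 := hp.delta_pos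
  refine Real.log_le_log (by positivity) ?_
  gcongr
  refine h.trans ?_
  have : (1 : ℝ) ≤ (Fintype.card S : ℝ) ^ 2 * Fintype.card A :=
    one_le_mul_of_one_le_of_one_le (one_le_pow₀ h1) h2
  nlinarith [(Nat.cast_nonneg n : (0 : ℝ) ≤ n)]

theorem one_le_logTerm [Nonempty A] (hp : Admissible p M) (n : ℕ) : 1 ≤ logTerm S A p n := by
  have h : Real.log (8 / p.delta) ≤ logTerm S A p n :=
    le_logTerm hp (by norm_num) (by linarith [(Nat.cast_nonneg n : (0 : ℝ) ≤ n)])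
  have h2 : Real.log 8 ≤ Real.log (8 / p.delta) := by
    refine Real.log_le_log (by norm_num) ?_
    rw [le_div_iff₀ hp.delta_pos]
    linarith [hp.delta_lt]
  linarith [two_lt_log_eight]

theorem radius_sq_le [Nonempty A] (hp : Admissible p M) (hd : (1 : ℝ) ≤ d) {u n : ℕ} (hun : u ≤ n)
    (s : S) (a : A) :
    tr.radius p u s a ^ 2 ≤ (2 + 2 * p.lam) * d * logTerm S A p n := by
  have h1 := one_le_card_state M
  have h2 := one_le_card_action (A := A)
  have h3 := hp.delta_pos
  have h4 := hp.lam
  have h5 := one_le_logTerm hp n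
  have h6 : Real.log (8 * (Fintype.card S : ℝ) ^ 2 * Fintype.card A *
      (1 + (tr.visits u s a).card / p.lam) / p.delta) ≤ logTerm S A p n := by
    unfold logTerm
    refine Real.log_le_log (by positivity) ?_
    gcongr
    refine (div_le_self (by positivity) h4).trans ?_
    exact_mod_cast (card_visits_le u s a).trans hun
  have h7 : tr.radius p u s a ≤ Real.sqrt (d * logTerm S A p n) + Real.sqrt p.lam := by
    unfold radius; gcongr
  have h8 : tr.radius p u s a ^ 2 ≤
      (Real.sqrt (d * logTerm S A p n) + Real.sqrt p.lam) ^ 2 :=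
    pow_le_pow_left₀ (radius_pos hp u s a).le h7 2
  have h9 := Real.sq_sqrt (show 0 ≤ d * logTerm S A p n by positivity)
  have h10 := Real.sq_sqrt (show 0 ≤ p.lam by linarith)
  have h11 : p.lam * 1 ≤ p.lam * (d * logTerm S A p n) := by
    gcongr
    exact one_le_mul_of_one_le_of_one_le hd h5
  nlinarith [sq_nonneg (Real.sqrt (d * logTerm S A p n) - Real.sqrt p.lam)]

/-- At a visit to an unknown pair the context is long in the norm of the inverse Gram matrix. -/
theorem IsRun.unknown_width [Nonempty A] (hr : tr.IsRun p M) (hp : Admissible p M)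
    (hd : (1 : ℝ) ≤ d) {t n : ℕ} (htn : t < n) (hk : ¬ tr.KnownAt p t) :
    p.lmin ^ 2 / (100 * p.Bstar ^ 2 *
      ((3 + 2 * p.lam) * (Fintype.card S : ℝ) ^ 2 * d * logTerm S A p n)) ≤
    vecNorm (tr.gram p t (tr.state t) (tr.act t))⁻¹ (tr.ctx t) ^ 2 := by
  have hg : tr.gram p t (tr.state t) (tr.act t) =
      tr.gram p (tr.intervalStart p t) (tr.state t) (tr.act t) := by
    rw [gram, visits_intervalStart_of_not_knownAt hk, gram]
  rw [hg, (hr.eq_intervalStart t).1]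
  unfold KnownAt Known at hk
  rw [not_lt] at hk
  have hS := one_le_card_state M
  have hE := one_le_logTerm hp n
  have hB := hp.Bstar
  have hl := hp.lam
  have hlm := hp.lmin_pos
  have hρ := radius_pos (tr := tr) hp (tr.intervalStart p t) (tr.state t) (tr.act t)
  have hρ2 := radius_sq_le (tr := tr) hp hd
    ((intervalStart_le (p := p) (tr := tr) t).trans htn.le)
    (tr.state t) (tr.act t)
  set ρ := tr.radius p (tr.intervalStart p t) (tr.state t) (tr.act t)
  set E := logTerm S A p n
  set N := (Fintype.card S : ℝ)
  set R := max (N * ρ) (Real.sqrt (Real.log (4 * (tr.intervalIndex p t : ℕ) / p.delta)))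
  have hR : 0 < R := lt_max_of_lt_left (by positivity)
  have hR2 : R ^ 2 ≤ (3 + 2 * p.lam) * N ^ 2 * d * E := by
    have hbase : 1 ≤ N ^ 2 * d := one_le_mul_of_one_le_of_one_le (one_le_pow₀ hS) hd
    rcases max_choice (N * ρ)
      (Real.sqrt (Real.log (4 * (tr.intervalIndex p t : ℕ) / p.delta))) with h | h
    · rw [show R = N * ρ from h, mul_pow]
      calc N ^ 2 * ρ ^ 2 ≤ N ^ 2 * ((2 + 2 * p.lam) * d * E) := by gcongr
        _ ≤ _ := by nlinarith [mul_nonneg (zero_le_one.trans hbase) (zero_le_one.trans hE)]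
    · rw [show R = _ from h]
      have hm : (1 : ℝ) ≤ (tr.intervalIndex p t : ℕ) := by
        exact_mod_cast one_le_intervalIndex t
      have hmn : ((tr.intervalIndex p t : ℕ) : ℝ) ≤ n := by
        exact_mod_cast (intervalIndex_le t).trans htn
      rw [Real.sq_sqrt (Real.log_nonneg (by
        rw [le_div_iff₀ hp.delta_pos]; linarith [hp.delta_lt]))]
      have h1 : Real.log (4 * (tr.intervalIndex p t : ℕ) / p.delta) ≤ E :=
        le_logTerm hp (by positivity) (by linarith)
      have h2 : 1 * E ≤ (N ^ 2 * d) * E := by gcongr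
      have h3 : 1 * (N ^ 2 * d * E) ≤ (3 + 2 * p.lam) * (N ^ 2 * d * E) := by
        gcongr; linarith
      linarith
  calc _ ≤ p.lmin ^ 2 / (100 * p.Bstar ^ 2 * R ^ 2) := by gcongr
    _ = (p.lmin / (10 * p.Bstar * R)) ^ 2 := by rw [div_pow]; ring
    _ ≤ _ := pow_le_pow_left₀ (by positivity) hk 2

/-- The number of visits to unknown pairs is polylogarithmic in the number of steps: each visit
increases a log-determinant by at least `x / 2`, and log-determinants grow by at most
`d log (1 + n)` in total. -/
theorem unknownCount_le [Nonempty A] (hr : tr.IsRun p M) (hp : Admissible p M)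
    (hd : (1 : ℝ) ≤ d) (hl1 : p.lmin ≤ 1) (n : ℕ) :
    (tr.unknownCount p n : ℝ) ≤ 200 * (3 + 2 * p.lam) * ((Fintype.card S : ℝ) ^ 3 *
      Fintype.card A * (d : ℝ) ^ 2 * p.Bstar ^ 2 / p.lmin ^ 2) * Real.log (1 + n) *
      logTerm S A p n := by
  have hS := one_le_card_state M
  have hE := one_le_logTerm hp n
  have hB := hp.Bstar
  have hl := hp.lam
  have hlm := hp.lmin_pos
  set W := 100 * p.Bstar ^ 2 *
      ((3 + 2 * p.lam) * (Fintype.card S : ℝ) ^ 2 * d * logTerm S A p n) with hW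
  have hW1 : 1 ≤ W := by
    have h1 : 1 ≤ 100 * p.Bstar ^ 2 := by nlinarith
    have h2 : 1 ≤ (3 + 2 * p.lam) * (Fintype.card S : ℝ) ^ 2 := by nlinarith
    exact one_le_mul_of_one_le_of_one_le h1
      (one_le_mul_of_one_le_of_one_le (one_le_mul_of_one_le_of_one_le h2 hd) hE)
  set x := p.lmin ^ 2 / W with hx
  have hx0 : 0 < x := by positivity
  have hx1 : x ≤ 1 := by
    rw [hx, div_le_one (by positivity)]
    exact (pow_le_one₀ hlm.le hl1).trans hW1
  have hκ : ∀ t < n, ¬ tr.KnownAt p t → x / 2 ≤ Real.log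
      (1 + vecNorm (tr.gram p t (tr.state t) (tr.act t))⁻¹ (tr.ctx t) ^ 2) := by
    intro t ht hk
    have h1 := hr.unknown_width hp hd ht hk
    have h2 : x / 2 ≤ Real.log (1 + x) := by
      have h3 := Real.one_sub_inv_le_log_of_pos (show 0 < 1 + x by positivity)
      have h4 : x / 2 ≤ 1 - (1 + x)⁻¹ := by
        rw [show 1 - (1 + x)⁻¹ = x / (1 + x) by field_simp; ring]
        gcongr
        linarith
      linarith
    exact h2.trans (Real.log_le_log (by positivity) (by linarith))
  have hsa : ∀ y : S × A, ((tr.unknownVisits p n y.1 y.2).card : ℝ) ≤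
      2 * d * Real.log (1 + n) * W / p.lmin ^ 2 := by
    intro y
    have h1 := card_unknownVisits_mul_le hp y.1 y.2 hκ
    have h2 : (tr.gram p n y.1 y.2).det ≤ (p.lam * (1 + n)) ^ d := by
      refine (det_ridgeGram_le (by linarith) (tr.visits n y.1 y.2) tr.ctx fun i _ =>
        dotProduct_self_le_one (hr.ctx_mem i)).trans ?_
      have h3 : ((tr.visits n y.1 y.2).card : ℝ) ≤ n := by
        exact_mod_cast card_visits_le (tr := tr) n y.1 y.2
      gcongr
      nlinarith [(Nat.cast_nonneg n : (0 : ℝ) ≤ n)]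
    have h3 : Real.log (tr.gram p n y.1 y.2).det - Real.log (p.lam ^ d) ≤
        d * Real.log (1 + n) := by
      have := Real.log_le_log (gram_posDef hp n y.1 y.2).det_pos h2
      rw [mul_pow, Real.log_mul (by positivity) (by positivity), Real.log_pow (1 + (n : ℝ))] at this
      linarith
    have h4 := h1.trans h3
    rw [hx] at h4
    rw [le_div_iff₀ (by positivity)]
    have hWpos : 0 < W := by positivity
    have h5 : ((tr.unknownVisits p n y.1 y.2).card : ℝ) * p.lmin ^ 2 =
        ((tr.unknownVisits p n y.1 y.2).card * (p.lmin ^ 2 / W / 2)) * (2 * W) := by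
      field_simp
    rw [h5]
    calc _ ≤ (d * Real.log (1 + n)) * (2 * W) := by gcongr
      _ = _ := by ring
  have hsum : (tr.unknownCount p n : ℝ) ≤
      ∑ _y : S × A, 2 * d * Real.log (1 + n) * W / p.lmin ^ 2 := by
    rw [unknownCount_eq_sum, Nat.cast_sum]
    exact Finset.sum_le_sum fun y _ => hsa y
  rw [Finset.sum_const, Finset.card_univ, Fintype.card_prod, nsmul_eq_mul] at hsum
  refine hsum.trans (le_of_eq ?_)
  rw [hW]; push_cast; ring

/-! ### The number of steps, in terms of the number of unknown visits -/

open Classical in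
/-- The potential of the drift argument: the optimistic value of the current state, and its upper
bound `Bstar` at the start of an interval and in the first interval. -/
noncomputable def potential (p : Params) (tr : Trajectory S A d) (n : ℕ) : ℝ :=
  if tr.intervalStart p n = n then p.Bstar
  else if 2 ≤ tr.intervalIndex p n then tr.optValue n (tr.state n) else p.Bstar

theorem valueNoise_of_none {t : ℕ} (h : tr.next t = none) : tr.valueNoise M t =
    0 - ∑ s', M.dyn (tr.ctx t) (tr.state t) (tr.act t) s' * tr.optValue t s' := by
  rw [valueNoise, h]

theorem valueNoise_of_some {t : ℕ} {s : S} (h : tr.next t = some s) : tr.valueNoise M t =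
    tr.optValue t s - ∑ s', M.dyn (tr.ctx t) (tr.state t) (tr.act t) s' * tr.optValue t s' := by
  rw [valueNoise, h]

theorem potential_succ_of_endsAt {n : ℕ} (h : tr.EndsAt p n) :
    tr.potential p (n + 1) = p.Bstar := if_pos ((intervalStart_succ_eq_iff n).2 h)

theorem IsRun.sum_dyn_mul_optValue_le (hr : tr.IsRun p M) {t : ℕ}
    (hB : 0 ≤ p.Bstar) (hb : tr.BoundedAt p t) :
    ∑ s', M.dyn (tr.ctx t) (tr.state t) (tr.act t) s' * tr.optValue t s' ≤ p.Bstar := by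
  have hm := M.dyn_mem (hr.ctx_mem t) (tr.state t) (tr.act t)
  calc _ ≤ ∑ s', M.dyn (tr.ctx t) (tr.state t) (tr.act t) s' * p.Bstar :=
        Finset.sum_le_sum fun s' _ => mul_le_mul_of_nonneg_left (hb s') (hm.1 s')
    _ ≤ p.Bstar := by
        rw [← Finset.sum_mul]
        exact mul_le_of_le_one_left hB hm.2

theorem episode_succ_of_none {n : ℕ} (h : tr.next n = none) :
    tr.episode (n + 1) = tr.episode n + 1 := by
  rw [episode, Finset.range_add_one, Finset.filter_insert, if_pos h,
    Finset.card_insert_of_notMem (by simp), episode]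

theorem episode_succ_of_ne_none {n : ℕ} (h : tr.next n ≠ none) :
    tr.episode (n + 1) = tr.episode n := by
  rw [episode, Finset.range_add_one, Finset.filter_insert, if_neg h, episode]

theorem episode_le_succ (n : ℕ) : tr.episode n ≤ tr.episode (n + 1) := by
  by_cases h : tr.next n = none
  · rw [episode_succ_of_none h]; omega
  · rw [episode_succ_of_ne_none h]

theorem episode_succ_le (n : ℕ) : tr.episode (n + 1) ≤ tr.episode n + 1 := by
  by_cases h : tr.next n = none
  · rw [episode_succ_of_none h]
  · rw [episode_succ_of_ne_none h]; omega

theorem unknownCount_succ_of_known {n : ℕ} (h : tr.KnownAt p n) :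
    tr.unknownCount p (n + 1) = tr.unknownCount p n := by
  classical
  rw [unknownCount, Finset.range_add_one, Finset.filter_insert, if_neg (not_not.2 h), unknownCount]

theorem unknownCount_succ_of_unknown {n : ℕ} (h : ¬ tr.KnownAt p n) :
    tr.unknownCount p (n + 1) = tr.unknownCount p n + 1 := by
  classical
  rw [unknownCount, Finset.range_add_one, Finset.filter_insert, if_pos h,
    Finset.card_insert_of_notMem (by simp), unknownCount]

theorem unknownCount_le_succ (n : ℕ) : tr.unknownCount p n ≤ tr.unknownCount p (n + 1) := by
  by_cases h : tr.KnownAt p n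
  · rw [unknownCount_succ_of_known h]
  · rw [unknownCount_succ_of_unknown h]; omega

/-- The drift argument: outside the first interval the optimistic value decreases by a multiple of
`lmin` at every step, up to noise and up to a loss of order `Bstar` at the ends of intervals. -/
theorem IsRun.drift_sum_le (hr : tr.IsRun p M) (hp : Admissible p M) (hl1 : p.lmin ≤ 1) {n : ℕ}
    (hL : ∀ t < n, ∀ s a, M.Lstar s a ∈ tr.lossConf p (tr.intervalStart p t) s a)
    (hP : ∀ t < n, ∀ s a, M.Pstar s a ∈ tr.dynConf p (tr.intervalStart p t) s a) :
    3 / 5 * p.lmin * ((Finset.range n).filter fun t => 2 ≤ tr.intervalIndex p t).card +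
      tr.potential p n ≤ p.Bstar + p.Bstar * (tr.episode n + tr.unknownCount p n) +
      ∑ t ∈ (Finset.range n).filter (fun t => 2 ≤ tr.intervalIndex p t), tr.valueNoise M t +
      2 * p.Bstar * tr.unknownCount p n := by
  have hB := hp.Bstar
  induction n with
  | zero => simp [potential, intervalStart, interval, episode, unknownCount]
  | succ n ih =>
    have ih := ih (fun t ht => hL t (by omega)) fun t ht => hP t (by omega)
    have hL := hL n (by omega)
    have hP := hP n (by omega)
    rw [Finset.range_add_one, Finset.filter_insert]
    by_cases h2 : 2 ≤ tr.intervalIndex p n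
    · rw [if_pos h2, Finset.card_insert_of_notMem (by simp), Finset.sum_insert (by simp)]
      have hb := hr.boundedAt hp h2 hL hP
      have hφ : tr.optValue n (tr.state n) ≤ tr.potential p n := by
        unfold potential; split_ifs
        · exact hb _
        · exact le_rfl
      have hsum := hr.sum_dyn_mul_optValue_le (by linarith) hb
      have h0 := optValue_nonneg (tr := tr) n (tr.state n)
      push_cast
      by_cases hk : tr.KnownAt p n
      · have hdr := hr.driftAt hp h2 hL hP hk
        unfold DriftAt at hdr
        have hm := (M.meanLoss_mem (hr.ctx_mem n) (tr.state n) (tr.act n)).1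
        rw [unknownCount_succ_of_known hk]
        by_cases hn : tr.next n = none
        · rw [potential_succ_of_endsAt (Or.inl hn), episode_succ_of_none hn, valueNoise_of_none hn]
          -- the goal is reached: the next potential `Bstar` is paid for by the new episode
          push_cast
          linarith
        · have he : ¬ tr.EndsAt p n := by simp [EndsAt, hn, hk]
          have hpot : tr.potential p (n + 1) = tr.optValue n (tr.state (n + 1)) := by
            rw [potential, if_neg (by rwa [intervalStart_succ_eq_iff]),
              if_pos (by rwa [intervalIndex_succ_of_not_endsAt he]),
              hr.optValue_succ_of_not_endsAt he]
          rw [episode_succ_of_ne_none hn, hpot, valueNoise_of_some (hr.next_eq_of_not_endsAt he)]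
          linarith
      · -- an unknown visit costs `Bstar` for the next potential and `2 Bstar` for the noise and
        -- the missing drift
        rw [potential_succ_of_endsAt (Or.inr hk), unknownCount_succ_of_unknown hk]
        have he : (tr.episode n : ℝ) ≤ tr.episode (n + 1) := by exact_mod_cast episode_le_succ n
        have he' := mul_le_mul_of_nonneg_left he (zero_le_one.trans hB)
        have hnoise : -p.Bstar ≤ tr.valueNoise M n := by
          cases hn : tr.next n with
          | none => rw [valueNoise_of_none hn]; linarith
          | some s' =>
            rw [valueNoise_of_some hn]
            linarith [optValue_nonneg (tr := tr) n s']
        push_cast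
        linarith
    · rw [if_neg h2]
      have h3 : tr.potential p n = p.Bstar := by
        unfold potential; split_ifs <;> rfl
      have h4 : tr.potential p (n + 1) = p.Bstar := by
        by_cases he : tr.EndsAt p n
        · exact potential_succ_of_endsAt he
        · rw [potential, if_neg (by rwa [intervalStart_succ_eq_iff]),
            if_neg (by rwa [intervalIndex_succ_of_not_endsAt he])]
      have he : (tr.episode n : ℝ) ≤ tr.episode (n + 1) := by exact_mod_cast episode_le_succ n
      have hu : (tr.unknownCount p n : ℝ) ≤ tr.unknownCount p (n + 1) := by
        exact_mod_cast unknownCount_le_succ n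
      have h5 := mul_le_mul_of_nonneg_left he (zero_le_one.trans hB)
      have h6 := mul_le_mul_of_nonneg_left hu (zero_le_one.trans hB)
      linarith

/-- As each step has loss at least `lmin`, the bound on the loss of the first interval limits its
length. -/
theorem IsRun.first_interval_le (hr : tr.IsRun p M) (hp : Admissible p M) {K n : ℕ}
    (h : tr.HPE p M K) (hn : ∀ t < n, tr.episode t < K) :
    p.lmin * ((Finset.range n).filter fun t => ¬ 2 ≤ tr.intervalIndex p t).card ≤
      48 * p.Bstar * Real.log (4 / p.delta) := by
  set I := (Finset.range n).filter fun t => ¬ 2 ≤ tr.intervalIndex p t with hI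
  have hlog : 0 ≤ Real.log (4 / p.delta) := Real.log_nonneg (by
    rw [le_div_iff₀ hp.delta_pos]; linarith [hp.delta_lt])
  rcases I.eq_empty_or_nonempty with h0 | h0
  · have := hp.Bstar
    rw [h0, Finset.card_empty, Nat.cast_zero, mul_zero]
    positivity
  · set t := I.max' h0
    have ht : t ∈ I := I.max'_mem h0
    rw [hI, Finset.mem_filter, Finset.mem_range] at ht
    have hidx : tr.intervalIndex p t = 1 := by
      have := one_le_intervalIndex (p := p) (tr := tr) t
      omega
    have hst : tr.intervalStart p t = 0 := by
      have := (intervalStart_le_iff (p := p) (tr := tr) (Nat.zero_le t)).2 hidx.symm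
      omega
    have h1 := h.interval_cost t (hn t ht.1)
    rw [hst, hidx, Nat.cast_one, mul_one] at h1
    refine le_trans ?_ h1
    calc p.lmin * (I.card : ℝ) ≤ p.lmin * (Finset.Icc 0 t).card := by
          have hle : (I.card : ℝ) ≤ (Finset.Icc 0 t).card := by
            exact_mod_cast Finset.card_le_card fun i hi =>
              Finset.mem_Icc.2 ⟨Nat.zero_le i, I.le_max' i hi⟩
          exact mul_le_mul_of_nonneg_left hle hp.lmin_pos.le
      _ = ∑ i ∈ Finset.Icc 0 t, p.lmin := by rw [Finset.sum_const, nsmul_eq_mul, mul_comm]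
      _ ≤ _ := Finset.sum_le_sum fun i _ => (hr.loss_mem i).1

/-- An implicit bound on the number `n` of steps: the right-hand side is polylogarithmic
in `n`. -/
theorem IsRun.steps_le [Nonempty A] (hr : tr.IsRun p M) (hp : Admissible p M)
    (hd : (1 : ℝ) ≤ d) (hl1 : p.lmin ≤ 1) {K n : ℕ} (h : tr.HPE p M K) (hn0 : 1 ≤ n)
    (hn : ∀ t < n, tr.episode t < K) :
    (n : ℝ) ≤ 8 * (K * p.Bstar / p.lmin) + (2000 * (3 + 2 * p.lam) + 200) *
      ((Fintype.card S : ℝ) ^ 3 * Fintype.card A * (d : ℝ) ^ 2 * p.Bstar ^ 3 / p.lmin ^ 3) *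
      (Real.log (1 + n) * logTerm S A p n) := by
  have hB := hp.Bstar
  have hl := hp.lam
  have hlm := hp.lmin_pos
  have hS := one_le_card_state M
  have hA := one_le_card_action (A := A)
  have hE := one_le_logTerm hp n
  have hn1 : (1 : ℝ) ≤ n := by exact_mod_cast hn0
  have h1 := hr.drift_sum_le hp hl1 (fun t ht => h.loss_conf t (hn t ht))
    fun t ht => h.dyn_conf t (hn t ht)
  have h2 := h.value_noise n hn
  have h3 := hr.first_interval_le hp h hn
  have h4 := unknownCount_le hr hp hd hl1 n
  have hpot : 0 ≤ tr.potential p n := by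
    unfold potential; split_ifs
    · linarith
    · exact optValue_nonneg _ _
    · linarith
  have hepK : tr.episode n ≤ K := by
    obtain ⟨m, rfl⟩ := Nat.exists_eq_add_of_le' hn0
    exact (episode_succ_le m).trans (hn m (by omega))
  have hK : 1 ≤ K := (Nat.zero_le _).trans_lt (hn 0 (by omega))
  have hepK' : (tr.episode n : ℝ) ≤ K := by exact_mod_cast hepK
  have hK' : (1 : ℝ) ≤ K := by exact_mod_cast hK
  have hcard := Finset.card_filter_add_card_filter_not (s := Finset.range n)
    (fun t => 2 ≤ tr.intervalIndex p t)
  rw [Finset.card_range] at hcard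
  have hcard' : (((Finset.range n).filter fun t => 2 ≤ tr.intervalIndex p t).card : ℝ) +
      ((Finset.range n).filter fun t => ¬ 2 ≤ tr.intervalIndex p t).card = n := by
    exact_mod_cast hcard
  have hlog4 : Real.log (4 / p.delta) ≤ logTerm S A p n := le_logTerm hp (by norm_num) (by linarith)
  have hlogn : Real.log (4 * n / p.delta) ≤ logTerm S A p n :=
    le_logTerm hp (by positivity) (by linarith)
  have hsq : Real.sqrt (n * Real.log (4 * n / p.delta)) ≤
      Real.sqrt (n * logTerm S A p n) := by gcongr
  have hℓ : 1 / 2 ≤ Real.log (1 + n) := by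
    have := Real.log_two_gt_d9
    have h5 := Real.log_le_log (show (0 : ℝ) < 2 by norm_num) (show (2 : ℝ) ≤ 1 + n by linarith)
    linarith
  generalize (((Finset.range n).filter fun t => 2 ≤ tr.intervalIndex p t).card : ℝ) = a at *
  generalize (((Finset.range n).filter fun t => ¬ 2 ≤ tr.intervalIndex p t).card : ℝ) = q at *
  generalize logTerm S A p n = E at *
  generalize Real.log (1 + n) = ℓ at *
  generalize (tr.unknownCount p n : ℝ) = U at *
  generalize (n : ℝ) = x at *
  set b := p.Bstar / p.lmin with hb
  have hb1 : 1 ≤ b := by rw [hb, le_div_iff₀ hlm]; linarith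
  have hY : (Fintype.card S : ℝ) ^ 3 * Fintype.card A * (d : ℝ) ^ 2 * p.Bstar ^ 3 / p.lmin ^ 3 =
      (Fintype.card S : ℝ) ^ 3 * Fintype.card A * (d : ℝ) ^ 2 * b ^ 3 := by
    rw [hb, div_pow]; ring
  have hY' : (Fintype.card S : ℝ) ^ 3 * Fintype.card A * (d : ℝ) ^ 2 * p.Bstar ^ 2 / p.lmin ^ 2 =
      (Fintype.card S : ℝ) ^ 3 * Fintype.card A * (d : ℝ) ^ 2 * b ^ 2 := by
    rw [hb, div_pow]; ring
  have hSAd : 1 ≤ (Fintype.card S : ℝ) ^ 3 * Fintype.card A * (d : ℝ) ^ 2 :=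
    one_le_mul_of_one_le_of_one_le
      (one_le_mul_of_one_le_of_one_le (one_le_pow₀ hS) hA) (one_le_pow₀ hd)
  rw [hY, mul_div_assoc, ← hb]
  rw [hY'] at h4
  set J := (Fintype.card S : ℝ) ^ 3 * Fintype.card A * (d : ℝ) ^ 2
  -- the drift inequality divided by `lmin`
  have hdr : 3 / 5 * a ≤ b * (1 + K + 3 * U) + b * Real.sqrt (x * E) := by
    have h5 : 3 / 5 * p.lmin * a ≤
        p.Bstar * (1 + K + 3 * U) + p.Bstar * Real.sqrt (x * E) := by
      have h6 := mul_le_mul_of_nonneg_left hepK' (zero_le_one.trans hB)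
      have h7 := mul_le_mul_of_nonneg_left hsq (zero_le_one.trans hB)
      linarith
    have h6 := div_le_div_of_nonneg_right h5 hlm.le
    calc 3 / 5 * a = 3 / 5 * p.lmin * a / p.lmin := by field_simp
      _ ≤ _ := h6
      _ = _ := by rw [hb]; ring
  have hq : q ≤ 48 * b * E := by
    have h5 : p.lmin * q ≤ 48 * p.Bstar * E :=
      h3.trans (mul_le_mul_of_nonneg_left hlog4 (by linarith))
    calc q = p.lmin * q / p.lmin := by field_simp
      _ ≤ 48 * p.Bstar * E / p.lmin := div_le_div_of_nonneg_right h5 hlm.le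
      _ = _ := by rw [hb]; ring
  -- the square root is absorbed into the left-hand side
  have hroot : b * Real.sqrt (x * E) ≤ 3 / 10 * x + 5 / 6 * (b ^ 2 * E) := by
    have h5 : b * Real.sqrt (x * E) = Real.sqrt x * (b * Real.sqrt E) := by
      rw [Real.sqrt_mul (by linarith)]; ring
    have h6 := Real.sq_sqrt (show 0 ≤ x by linarith)
    have h7 := Real.sq_sqrt (show 0 ≤ E by linarith)
    have h8 := sq_nonneg (3 / 5 * Real.sqrt x - b * Real.sqrt E)
    have h9 : (b * Real.sqrt E) ^ 2 = b ^ 2 * E := by rw [mul_pow, h7]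
    rw [h5]
    linarith
  have hbU : b * U ≤ 200 * (3 + 2 * p.lam) * (J * b ^ 3) * (ℓ * E) := by
    calc b * U ≤ b * (200 * (3 + 2 * p.lam) * (J * b ^ 2) * ℓ * E) := by gcongr
      _ = _ := by ring
  have hb3 : b ^ 2 * E ≤ 2 * ((J * b ^ 3) * (ℓ * E)) := by
    have h5 : 1 * b ^ 2 ≤ J * b ^ 3 := by gcongr; norm_num
    have h6 : 1 / 2 * E ≤ ℓ * E := by gcongr
    have h7 : (1 * b ^ 2) * (1 / 2 * E) ≤ (J * b ^ 3) * (ℓ * E) := by gcongr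
    linarith
  have hbE : b * E ≤ b ^ 2 * E := by
    gcongr; exact le_self_pow₀ hb1 (by norm_num)
  have hbK : b ≤ b * K := le_mul_of_one_le_right (by linarith) hK'
  have e : (8 : ℝ) * (K * b) + (2000 * (3 + 2 * p.lam) + 200) * (J * b ^ 3) * (ℓ * E) =
    8 * (b * K) + 10 * (200 * (3 + 2 * p.lam) * (J * b ^ 3) * (ℓ * E)) +
      200 * ((J * b ^ 3) * (ℓ * E)) := by ring
  have hJ0 : 0 ≤ (J * b ^ 3) * (ℓ * E) := by positivity
  rw [e]
  linarith

end Trajectory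

/-! ### Solving the implicit bound -/

/-- A constant `F` such that `log (1 + x) ≤ F Λ D` for all solutions `x` of the implicit bound with
the constant `c`, where `Λ` is the logarithm of the problem size and `D = max 1 (log (1 / δ))`. -/
noncomputable def logFactor (c : ℝ) : ℝ := 2 * Real.log (8 * (9 + 7 * c)) + 10

theorem logFactor_pos {c : ℝ} (hc : 0 ≤ c) : 0 < logFactor c := by
  have : 0 ≤ Real.log (8 * (9 + 7 * c)) := Real.log_nonneg (by linarith)
  unfold logFactor; linarith

/-- The explicit form of an implicit bound on `x` with two factors logarithmic in `x`. A first,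
crude estimate bounds `log (1 + x)` by a multiple of `Λ D`; it is then inserted into the implicit
bound. The letters `κ, s, α, e, b` stand for `K, |S|, |A|, d, B⋆ / lmin`. -/
theorem le_of_le_mul_log_mul_log {c x κ s α δ b e : ℝ} (hc : 0 ≤ c) (hx : 0 ≤ x) (hκ : 1 ≤ κ)
    (hs : 1 ≤ s) (hα : 1 ≤ α) (he : 1 ≤ e) (hb : 1 ≤ b) (hδ : 0 < δ)
    (h : x ≤ 8 * (κ * b) + c * (s ^ 3 * α * e ^ 2 * b ^ 3) *
      (Real.log (1 + x) * Real.log (8 * s ^ 2 * α * (1 + x) / δ))) :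
    x ≤ (8 + c * (logFactor c * (7 + logFactor c))) *
      (κ * b + s ^ 3 * α * e ^ 2 * b ^ 3 * max 1 (Real.log (1 / δ)) ^ 2) *
      Real.log (2 + κ * s * α * e * b) ^ 2 := by
  have hF := logFactor_pos hc
  set D := max 1 (Real.log (1 / δ)) with hD
  set X := 2 + κ * s * α * e * b with hX
  set Λ := Real.log X with hΛ
  set ℓ := Real.log (1 + x) with hℓ
  set Y := s ^ 3 * α * e ^ 2 * b ^ 3 with hY
  have hκs : 1 ≤ κ * s := one_le_mul_of_one_le_of_one_le hκ hs
  have hκsα : 1 ≤ κ * s * α := one_le_mul_of_one_le_of_one_le hκs hα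
  have hκsαe : 1 ≤ κ * s * α * e := one_le_mul_of_one_le_of_one_le hκsα he
  have hprod : 1 ≤ κ * s * α * e * b := one_le_mul_of_one_le_of_one_le hκsαe hb
  have hX3 : 3 ≤ X := by linarith
  have hΛ1 : 1 ≤ Λ := by
    rw [hΛ, Real.le_log_iff_exp_le (by linarith)]
    linarith [Real.exp_one_lt_d9]
  have hD1 : 1 ≤ D := le_max_left _ _
  have hsX : s ≤ X := by
    have h1 : s * 1 ≤ s * (κ * α * e * b) := by
      gcongr
      exact one_le_mul_of_one_le_of_one_le (one_le_mul_of_one_le_of_one_le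
        (one_le_mul_of_one_le_of_one_le hκ hα) he) hb
    linarith [show s * (κ * α * e * b) = κ * s * α * e * b by ring]
  have hαX : α ≤ X := by
    have h1 : α * 1 ≤ α * (κ * s * e * b) := by
      gcongr
      exact one_le_mul_of_one_le_of_one_le (one_le_mul_of_one_le_of_one_le hκs he) hb
    linarith [show α * (κ * s * e * b) = κ * s * α * e * b by ring]
  have hκbX : κ * b ≤ X := by
    have h1 : κ * b * 1 ≤ κ * b * (s * α * e) := by
      gcongr
      exact one_le_mul_of_one_le_of_one_le (one_le_mul_of_one_le_of_one_le hs hα) he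
    linarith [show κ * b * (s * α * e) = κ * s * α * e * b by ring]
  have hYX : Y ≤ X ^ 3 := by
    calc Y = s ^ 3 * α * e ^ 2 * b ^ 3 * 1 := by rw [hY, mul_one]
      _ ≤ s ^ 3 * α * e ^ 2 * b ^ 3 * (κ ^ 3 * α ^ 2 * e) := by
          gcongr
          exact one_le_mul_of_one_le_of_one_le (one_le_mul_of_one_le_of_one_le
            (one_le_pow₀ hκ) (one_le_pow₀ hα)) he
      _ = (κ * s * α * e * b) ^ 3 := by ring
      _ ≤ X ^ 3 := by gcongr; linarith
  have hY0 : 0 ≤ Y := by positivity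
  have hℓ0 : 0 ≤ ℓ := Real.log_nonneg (by linarith)
  have hE : Real.log (8 * s ^ 2 * α * (1 + x) / δ) ≤ 6 * Λ + ℓ + D := by
    rw [div_eq_mul_one_div, Real.log_mul (by positivity) (by positivity),
      Real.log_mul (by positivity) (by positivity), Real.log_mul (by positivity) (by positivity),
      Real.log_mul (by positivity) (by positivity), Real.log_pow]
    have h1 : Real.log s ≤ Λ := Real.log_le_log (by linarith) hsX
    have h2 : Real.log α ≤ Λ := Real.log_le_log (by linarith) hαX
    have h3 : Real.log (1 / δ) ≤ D := le_max_right _ _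
    have h4 : Real.log 8 ≤ 3 := by
      rw [show (8 : ℝ) = 2 ^ 3 by norm_num, Real.log_pow]
      push_cast
      linarith [Real.log_two_lt_d9]
    push_cast
    linarith
  set G := 6 * Λ + D with hG
  have hG1 : 1 ≤ G := by linarith
  -- the logarithms are absorbed into the square root of `1 + x`
  set W := 1 + 8 * (κ * b) + c * Y * G with hW
  have hW0 : 0 < W := by positivity
  have hxW : Real.exp ℓ ≤ W * (1 + ℓ + ℓ ^ 2) := by
    rw [hℓ, Real.exp_log (by linarith), ← hℓ]
    have h1 : ℓ * Real.log (8 * s ^ 2 * α * (1 + x) / δ) ≤ G * (ℓ + ℓ ^ 2) := by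
      calc _ ≤ ℓ * (6 * Λ + ℓ + D) := by gcongr
        _ = G * ℓ + 1 * ℓ ^ 2 := by rw [hG]; ring
        _ ≤ G * ℓ + G * ℓ ^ 2 := by gcongr
        _ = _ := by ring
    have h2 : c * Y * (ℓ * Real.log (8 * s ^ 2 * α * (1 + x) / δ)) ≤
        c * Y * (G * (ℓ + ℓ ^ 2)) := by gcongr
    have h3 : 0 ≤ (1 + 8 * (κ * b)) * (ℓ + ℓ ^ 2) := by positivity
    have h4 : 0 ≤ c * Y * G := by positivity
    calc 1 + x ≤ 1 + 8 * (κ * b) + c * Y * (G * (ℓ + ℓ ^ 2)) := by linarith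
      _ ≤ (1 + 8 * (κ * b) + c * Y * G) + (1 + 8 * (κ * b)) * (ℓ + ℓ ^ 2) +
          c * Y * (G * (ℓ + ℓ ^ 2)) := by linarith
      _ = _ := by rw [hW]; ring
  have hexp : 1 + ℓ + ℓ ^ 2 ≤ 8 * Real.exp (ℓ / 2) := by
    have := Real.quadratic_le_exp_of_nonneg (show 0 ≤ ℓ / 2 by positivity)
    nlinarith
  have hhalf : Real.exp (ℓ / 2) ≤ 8 * W := by
    have h1 : Real.exp ℓ = Real.exp (ℓ / 2) * Real.exp (ℓ / 2) := by
      rw [← Real.exp_add]; congr 1; ring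
    have h2 : Real.exp (ℓ / 2) * Real.exp (ℓ / 2) ≤ 8 * W * Real.exp (ℓ / 2) := by
      rw [← h1]
      calc _ ≤ W * (1 + ℓ + ℓ ^ 2) := hxW
        _ ≤ W * (8 * Real.exp (ℓ / 2)) := by gcongr
        _ = _ := by ring
    exact le_of_mul_le_mul_right h2 (Real.exp_pos _)
  have hΛX : Λ ≤ X := (Real.log_le_sub_one_of_pos (by linarith)).trans (by linarith)
  have hWX : 8 * W ≤ 8 * (9 + 7 * c) * X ^ 4 * D := by
    have hX1 : 1 ≤ X := by linarith
    have h1 : 1 ≤ X ^ 4 * D := one_le_mul_of_one_le_of_one_le (one_le_pow₀ hX1) hD1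
    have h2 : X ≤ X ^ 4 * D :=
      (le_self_pow₀ hX1 (by norm_num)).trans (le_mul_of_one_le_right (by positivity) hD1)
    have h3 : G ≤ 7 * (X * D) := by
      have h4 : Λ ≤ X * D := hΛX.trans (le_mul_of_one_le_right (by linarith) hD1)
      have h5 : D ≤ X * D := le_mul_of_one_le_left (by linarith) hX1
      linarith
    have h4 : c * Y * G ≤ c * X ^ 3 * (7 * (X * D)) := by gcongr
    calc 8 * W ≤ 8 * (X ^ 4 * D + 8 * (X ^ 4 * D) + c * X ^ 3 * (7 * (X * D))) := by
          rw [hW]; linarith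
      _ = _ := by ring
  have hℓle : ℓ ≤ logFactor c * (Λ * D) := by
    have h1 : ℓ / 2 ≤ Real.log (8 * (9 + 7 * c) * X ^ 4 * D) := by
      rw [Real.le_log_iff_exp_le (by positivity)]
      exact hhalf.trans hWX
    rw [Real.log_mul (by positivity) (by positivity), Real.log_mul (by positivity) (by positivity),
      Real.log_pow] at h1
    have h2 : Real.log D ≤ D - 1 := Real.log_le_sub_one_of_pos (by linarith)
    have h3 : Λ ≤ Λ * D := le_mul_of_one_le_right (by linarith) hD1
    have h4 : D ≤ Λ * D := le_mul_of_one_le_left (by linarith) hΛ1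
    have h5 : Real.log (8 * (9 + 7 * c)) * 1 ≤ Real.log (8 * (9 + 7 * c)) * (Λ * D) := by
      have : 0 ≤ Real.log (8 * (9 + 7 * c)) := Real.log_nonneg (by linarith)
      gcongr
      exact one_le_mul_of_one_le_of_one_le hΛ1 hD1
    push_cast at h1
    unfold logFactor
    linarith
  have hEle : Real.log (8 * s ^ 2 * α * (1 + x) / δ) ≤ (7 + logFactor c) * (Λ * D) := by
    have h3 : Λ ≤ Λ * D := le_mul_of_one_le_right (by linarith) hD1
    have h4 : D ≤ Λ * D := le_mul_of_one_le_left (by linarith) hΛ1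
    linarith
  calc x ≤ 8 * (κ * b) + c * Y * (ℓ * Real.log (8 * s ^ 2 * α * (1 + x) / δ)) := h
    _ ≤ 8 * (κ * b) + c * Y * (ℓ * ((7 + logFactor c) * (Λ * D))) := by gcongr
    _ ≤ 8 * (κ * b) + c * Y * ((logFactor c * (Λ * D)) * ((7 + logFactor c) * (Λ * D))) := by
        gcongr
    _ = 8 * (κ * b) + c * (logFactor c * (7 + logFactor c)) * (Y * D ^ 2 * Λ ^ 2) := by ring
    _ ≤ 8 * (κ * b * Λ ^ 2) + c * (logFactor c * (7 + logFactor c)) * (Y * D ^ 2 * Λ ^ 2) +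
        (8 * (Y * D ^ 2 * Λ ^ 2) + c * (logFactor c * (7 + logFactor c)) * (κ * b * Λ ^ 2)) := by
        have h1 : κ * b * 1 ≤ κ * b * Λ ^ 2 := by gcongr; exact one_le_pow₀ hΛ1
        have h2 : 0 ≤ 8 * (Y * D ^ 2 * Λ ^ 2) +
            c * (logFactor c * (7 + logFactor c)) * (κ * b * Λ ^ 2) := by positivity
        linarith
    _ = _ := by ring

namespace Trajectory

variable {S A : Type*} [Fintype S] [DecidableEq S] [Fintype A] [DecidableEq A] {d : ℕ}
  {p : Params} {tr : Trajectory S A d} {M : LinearCSSP S A d p.lmin}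

/-! ### Termination and the number of steps -/

theorem episode_mono : Monotone tr.episode := monotone_nat_of_le_succ episode_le_succ

theorem IsRun.one_le_dim (hr : tr.IsRun p M) : (1 : ℝ) ≤ d := by
  have h : d ≠ 0 := by
    rintro rfl
    have := (hr.ctx_mem 0).2
    simp at this
  exact_mod_cast Nat.pos_of_ne_zero h

theorem IsRun.lmin_le_one (hr : tr.IsRun p M) : p.lmin ≤ 1 :=
  have h := M.meanLoss_mem (hr.ctx_mem 0) (tr.state 0) (tr.act 0)
  h.1.trans h.2

/-- If the number of steps in the first `K` episodes is bounded, these episodes terminate. -/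
theorem terminates_of_bounded {K N : ℕ} (hN : ∀ n, (∀ t < n, tr.episode t < K) → n ≤ N) {k : ℕ}
    (hk : k < K) : tr.Terminates k := by
  have hex : ∃ t, k < tr.episode t := by
    by_contra! h
    have := hN (N + 1) fun t _ => (h t).trans_lt hk
    omega
  classical
  obtain ⟨t, ht⟩ : ∃ t, Nat.find hex = t + 1 := by
    refine Nat.exists_eq_succ_of_ne_zero fun h0 => ?_
    have := Nat.find_spec hex
    rw [h0] at this
    simp [episode] at this
  have h1 := Nat.find_spec hex
  have h2 : tr.episode t ≤ k := not_lt.1 (Nat.find_min hex (m := t) (by omega))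
  rw [ht] at h1
  have h3 := episode_succ_le (tr := tr) t
  refine ⟨t, by omega, ?_⟩
  by_contra hne
  rw [episode_succ_of_ne_none hne] at h1
  omega

/-- The steps of the first `K` episodes are an initial segment of the time axis. -/
theorem exists_totalSteps_eq {K N : ℕ} (hN : ∀ n, (∀ t < n, tr.episode t < K) → n ≤ N) :
    ∃ T : ℕ, tr.totalSteps K = T ∧ ∀ t < T, tr.episode t < K := by
  classical
  have hex : ∃ t, ¬ tr.episode t < K := by
    by_contra! h
    have := hN (N + 1) fun t _ => h t
    omega
  obtain ⟨T, hT, hmin⟩ : ∃ T, ¬ tr.episode T < K ∧ ∀ t < T, tr.episode t < K :=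
    ⟨Nat.find hex, Nat.find_spec hex, fun t ht => not_not.1 (Nat.find_min hex ht)⟩
  have hset : {t | tr.episode t < K} = ((Finset.range T : Finset ℕ) : Set ℕ) := by
    ext t
    rw [Finset.mem_coe, Finset.mem_range]
    constructor
    · intro h
      by_contra h2
      exact hT ((episode_mono (not_lt.1 h2)).trans_lt h)
    · exact hmin t
  refine ⟨T, ?_, hmin⟩
  rw [totalSteps, hset, Set.encard_coe_eq_coe_finsetCard, Finset.card_range]

/-- The constant of the bound on the number of steps, as a function of the regularization
parameter. -/
noncomputable def stepsConstant (lam : ℝ) : ℝ :=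
  8 + (2000 * (3 + 2 * lam) + 200) * (logFactor (2000 * (3 + 2 * lam) + 200) *
    (7 + logFactor (2000 * (3 + 2 * lam) + 200)))

theorem stepsConstant_pos {lam : ℝ} (h : 1 ≤ lam) : 0 < stepsConstant lam := by
  have h1 := logFactor_pos (show 0 ≤ 2000 * (3 + 2 * lam) + 200 by linarith)
  unfold stepsConstant
  positivity

theorem IsRun.steps_le_explicit (hr : tr.IsRun p M) (hp : Admissible p M) {K n : ℕ}
    (h : tr.HPE p M K) (hn : ∀ t < n, tr.episode t < K) :
    (n : ℝ) ≤ stepsConstant p.lam *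
      (K * p.Bstar / p.lmin +
        (Fintype.card S : ℝ) ^ 3 * Fintype.card A * (d : ℝ) ^ 2 * p.Bstar ^ 3 /
          p.lmin ^ 3 * (max 1 (Real.log (1 / p.delta))) ^ 2) *
      (Real.log (2 + K * Fintype.card S * Fintype.card A * d * p.Bstar / p.lmin)) ^ 2 := by
  have : Nonempty A := ⟨tr.act 0⟩
  have hB := hp.Bstar
  have hlm := hp.lmin_pos
  have hl := hp.lam
  rcases Nat.eq_zero_or_pos n with rfl | hn0
  · have := stepsConstant_pos hl
    rw [Nat.cast_zero]
    positivity
  have hl1 := hr.lmin_le_one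
  have hK : (1 : ℝ) ≤ K := by exact_mod_cast (Nat.zero_le _).trans_lt (hn 0 hn0)
  have hb : 1 ≤ p.Bstar / p.lmin := by rw [le_div_iff₀ hlm]; linarith
  have h1 := hr.steps_le hp hr.one_le_dim hl1 h hn0 hn
  have h2 := le_of_le_mul_log_mul_log (c := 2000 * (3 + 2 * p.lam) + 200) (x := n) (κ := K)
    (s := Fintype.card S) (α := Fintype.card A) (e := d) (b := p.Bstar / p.lmin) (δ := p.delta)
    (by linarith) (by positivity) hK (one_le_card_state M) one_le_card_action hr.one_le_dim hb
    hp.delta_pos (by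
      rw [mul_div_assoc (K : ℝ), mul_div_assoc _ (p.Bstar ^ 3), ← div_pow] at h1; exact h1)
  rw [div_pow, ← mul_div_assoc, ← mul_div_assoc, ← mul_div_assoc] at h2
  exact h2

end Trajectory

/-! ### An exponential inequality for Bernoulli variables -/

theorem integral_exp_neg_mul_sq_add (β t : ℝ) (hβ : 0 < β) :
    Integrable (fun x : ℝ => Real.exp (-β * x ^ 2 + t * x)) ∧
      ∫ x : ℝ, Real.exp (-β * x ^ 2 + t * x) =
        Real.sqrt (Real.pi / β) * Real.exp (t ^ 2 / (4 * β)) := by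
  have h : (fun x : ℝ => Real.exp (-β * x ^ 2 + t * x)) =
      fun x => Real.exp (-β * (x - t / (2 * β)) ^ 2) * Real.exp (t ^ 2 / (4 * β)) := by
    funext x
    rw [← Real.exp_add]
    congr 1
    field_simp
    ring
  rw [h]
  refine ⟨((integrable_exp_neg_mul_sq hβ).comp_sub_right (t / (2 * β))).mul_const _, ?_⟩
  rw [integral_mul_const, integral_sub_right_eq_self (fun x => Real.exp (-β * x ^ 2)) (t / (2 * β)),
    integral_gaussian]

/-- Hoeffding's lemma for a centered Bernoulli variable. -/
theorem bernoulli_mgf_le {m : ℝ} (hm : m ∈ Set.Icc (0 : ℝ) 1) (x : ℝ) :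
    (1 - m) * Real.exp (x * (-m)) + m * Real.exp (x * (1 - m)) ≤ Real.exp (x ^ 2 / 8) := by
  set ν : Measure ℝ := ENNReal.ofReal (1 - m) • Measure.dirac 0 + ENNReal.ofReal m • Measure.dirac 1
    with hν
  have h1m : 0 ≤ 1 - m := by linarith [hm.2]
  have hprob : IsProbabilityMeasure ν := ⟨by
    rw [hν, Measure.add_apply, Measure.smul_apply, Measure.smul_apply, measure_univ, measure_univ,
      smul_eq_mul, smul_eq_mul, mul_one, mul_one, ← ENNReal.ofReal_add h1m hm.1]
    simp⟩
  have hint : ∀ f : ℝ → ℝ, ∫ y, f y ∂ν = (1 - m) * f 0 + m * f 1 := by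
    intro f
    have hi : ∀ (c : ℝ) (y : ℝ), Integrable f (ENNReal.ofReal c • Measure.dirac y) := fun c y =>
      (integrable_dirac (by simp)).smul_measure ENNReal.ofReal_ne_top
    rw [hν, integral_add_measure (hi _ _) (hi _ _), integral_smul_measure, integral_smul_measure,
      integral_dirac, integral_dirac, ENNReal.toReal_ofReal h1m, ENNReal.toReal_ofReal hm.1]
    rfl
  have hsub := hasSubgaussianMGF_of_mem_Icc (μ := ν) (X := id) (a := 0) (b := 1)
    aemeasurable_id (by
      rw [hν, ae_add_measure_iff]
      exact ⟨Measure.ae_smul_measure (by rw [ae_dirac_eq]; simp) _,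
        Measure.ae_smul_measure (by rw [ae_dirac_eq]; simp) _⟩)
  have h := hsub.mgf_le x
  rw [mgf, hint] at h
  rw [hint] at h
  simp only [id] at h
  norm_num at h
  have e : (1 : ℝ) / 4 * x ^ 2 / 2 = x ^ 2 / 8 := by ring
  have e2 : x * -m = -(x * m) := by ring
  rw [e2]
  convert h using 2
  ring

/-- The Gaussian mixture of Hoeffding's lemma: the exponential of a quadratic polynomial in a
centered Bernoulli variable. -/
theorem bernoulli_exp_quadratic_le {m : ℝ} (hm : m ∈ Set.Icc (0 : ℝ) 1) (a : ℝ) {b : ℝ}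
    (hb0 : 0 ≤ b) (hb1 : b < 1) :
    (1 - m) * Real.exp (4 * a * (-m) + 2 * b * (-m) ^ 2) +
      m * Real.exp (4 * a * (1 - m) + 2 * b * (1 - m) ^ 2) ≤
      Real.exp (2 * a ^ 2 / (1 - b)) / Real.sqrt (1 - b) := by
  -- `exp (2 b η²)` is the expectation of `exp (2 √b g η)` for a standard Gaussian `g`
  have key : ∀ η : ℝ, Integrable (fun g : ℝ => Real.exp (-(1 / 2) * g ^ 2 +
        2 * Real.sqrt b * η * g) * Real.exp (4 * a * η)) ∧
      ∫ g : ℝ, Real.exp (-(1 / 2) * g ^ 2 + 2 * Real.sqrt b * η * g) * Real.exp (4 * a * η) =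
        Real.sqrt (2 * Real.pi) * Real.exp (4 * a * η + 2 * b * η ^ 2) := by
    intro η
    obtain ⟨h1, h2⟩ := integral_exp_neg_mul_sq_add (1 / 2) (2 * Real.sqrt b * η) (by norm_num)
    refine ⟨h1.mul_const _, ?_⟩
    rw [integral_mul_const, h2, mul_assoc, ← Real.exp_add]
    congr 2
    · ring
    · rw [mul_pow, mul_pow, Real.sq_sqrt hb0]; ring
  obtain ⟨i1, e1⟩ := key (-m)
  obtain ⟨i2, e2⟩ := key (1 - m)
  obtain ⟨i3, e3⟩ := integral_exp_neg_mul_sq_add ((1 - b) / 2) (2 * a * Real.sqrt b) (by linarith)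
  have hle : ∫ g : ℝ, ((1 - m) * (Real.exp (-(1 / 2) * g ^ 2 + 2 * Real.sqrt b * (-m) * g) *
        Real.exp (4 * a * (-m))) +
      m * (Real.exp (-(1 / 2) * g ^ 2 + 2 * Real.sqrt b * (1 - m) * g) *
        Real.exp (4 * a * (1 - m)))) ≤
      ∫ g : ℝ, Real.exp (-((1 - b) / 2) * g ^ 2 + 2 * a * Real.sqrt b * g) *
        Real.exp (2 * a ^ 2) := by
    refine integral_mono ((i1.const_mul _).add (i2.const_mul _)) (i3.mul_const _) fun g => ?_
    have h := bernoulli_mgf_le hm (4 * a + 2 * Real.sqrt b * g)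
    have h2 := mul_le_mul_of_nonneg_left h (Real.exp_pos (-(1 / 2) * g ^ 2)).le
    have h3 : Real.exp (-(1 / 2) * g ^ 2) * Real.exp ((4 * a + 2 * Real.sqrt b * g) ^ 2 / 8) =
        Real.exp (-((1 - b) / 2) * g ^ 2 + 2 * a * Real.sqrt b * g) * Real.exp (2 * a ^ 2) := by
      rw [← Real.exp_add, ← Real.exp_add]
      congr 1
      have := Real.sq_sqrt hb0
      linear_combination (g ^ 2 / 2) * this
    have h4 : ∀ η, Real.exp (-(1 / 2) * g ^ 2 + 2 * Real.sqrt b * η * g) * Real.exp (4 * a * η) =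
        Real.exp (-(1 / 2) * g ^ 2) * Real.exp ((4 * a + 2 * Real.sqrt b * g) * η) := by
      intro η
      rw [← Real.exp_add, ← Real.exp_add]
      congr 1
      ring
    change _ + _ ≤ _
    rw [h4, h4, ← h3]
    linarith
  rw [integral_add (i1.const_mul _) (i2.const_mul _), integral_const_mul, integral_const_mul, e1,
    e2, integral_mul_const, e3] at hle
  have hpi : 0 < Real.sqrt (2 * Real.pi) := Real.sqrt_pos.2 (by positivity)
  have h1b : 0 < 1 - b := by linarith
  have hs : Real.sqrt (Real.pi / ((1 - b) / 2)) = Real.sqrt (2 * Real.pi) / Real.sqrt (1 - b) := by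
    rw [← Real.sqrt_div (by positivity)]
    congr 1
    field_simp
  have hexp : Real.exp ((2 * a * Real.sqrt b) ^ 2 / (4 * ((1 - b) / 2))) * Real.exp (2 * a ^ 2) =
      Real.exp (2 * a ^ 2 / (1 - b)) := by
    rw [← Real.exp_add]
    congr 1
    rw [mul_pow, Real.sq_sqrt hb0]
    field_simp
    ring
  rw [hs, mul_assoc (_ / _), hexp] at hle
  refine le_of_mul_le_mul_left ?_ hpi
  calc _ = _ := by ring
    _ ≤ _ := hle
    _ = _ := by ring

/-! ### Nonnegative supermartingales -/

section Supermartingale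

variable {Ω : Type*} {mΩ : MeasurableSpace Ω} {μ : Measure Ω} [IsProbabilityMeasure μ]
  {F : Filtration ℕ mΩ}

/-- A nonnegative supermartingale, in terms of lower Lebesgue integrals, so that no integrability
is needed. Nonnegativity itself is not part of the definition: only the positive part of the
process enters. -/
structure IsNonnegSuper (μ : Measure Ω) (F : Filtration ℕ mΩ) (M : ℕ → Ω → ℝ) : Prop where
  measurable : ∀ n, Measurable[F n] (M n)
  step : ∀ n B, MeasurableSet[F n] B →
    ∫⁻ ω in B, ENNReal.ofReal (M (n + 1) ω) ∂μ ≤ ∫⁻ ω in B, ENNReal.ofReal (M n ω) ∂μ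

/-- Ville's inequality up to a finite time, with the expectation of the process on the complement
retained for the induction. -/
theorem IsNonnegSuper.mul_measure_exists_lt_le {M : ℕ → Ω → ℝ} (h : IsNonnegSuper μ F M) (a : ℝ)
    (n : ℕ) :
    ENNReal.ofReal a * μ {ω | ∃ i < n, a ≤ M i ω} +
      ∫⁻ ω in {ω | ∀ i < n, M i ω < a}, ENNReal.ofReal (M n ω) ∂μ ≤
      ∫⁻ ω, ENNReal.ofReal (M 0 ω) ∂μ := by
  have hB : ∀ n k, n ≤ k + 1 → MeasurableSet[F k] {ω | ∀ i < n, M i ω < a} := by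
    intro n k hnk
    have e : {ω | ∀ i < n, M i ω < a} = ⋂ i, ⋂ (_ : i < n), {ω | M i ω < a} := by
      ext ω; simp
    rw [e]
    refine MeasurableSet.iInter fun i => MeasurableSet.iInter fun hi => ?_
    exact F.mono (show i ≤ k by omega) _ (measurableSet_lt (h.measurable i) measurable_const)
  induction n with
  | zero => simp
  | succ n ih =>
    refine le_trans ?_ ih
    have hA : MeasurableSet[F n] {ω | a ≤ M n ω} :=
      measurableSet_le measurable_const (h.measurable n)
    set Bn := {ω | ∀ i < n, M i ω < a}
    set Bn' := {ω | ∀ i < n + 1, M i ω < a}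
    have hBn' := hB (n + 1) n le_rfl
    have e1 : Bn' = Bn ∩ {ω | a ≤ M n ω}ᶜ := by
      ext ω
      simp only [Bn, Bn', Nat.lt_succ_iff_lt_or_eq, Set.mem_ofPred_eq, Set.mem_inter_iff,
        Set.mem_compl_iff, not_le]
      constructor
      · exact fun h => ⟨fun i hi => h i (Or.inl hi), h n (Or.inr rfl)⟩
      · rintro ⟨h1, h2⟩ i (hi | rfl)
        · exact h1 i hi
        · exact h2
    have e2 : {ω | ∃ i < n + 1, a ≤ M i ω} ⊆
        {ω | ∃ i < n, a ≤ M i ω} ∪ (Bn ∩ {ω | a ≤ M n ω}) := by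
      rintro ω ⟨i, hi, hia⟩
      by_cases hex : ∃ i < n, a ≤ M i ω
      · exact Or.inl hex
      · push Not at hex
        refine Or.inr ⟨hex, ?_⟩
        rcases Nat.lt_succ_iff_lt_or_eq.1 hi with h1 | rfl
        · exact absurd hia (not_le.2 (hex i h1))
        · exact hia
    have h1 : ENNReal.ofReal a * μ {ω | ∃ i < n + 1, a ≤ M i ω} ≤
        ENNReal.ofReal a * μ {ω | ∃ i < n, a ≤ M i ω} +
          ENNReal.ofReal a * μ (Bn ∩ {ω | a ≤ M n ω}) := by
      rw [← mul_add]
      gcongr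
      exact (measure_mono e2).trans (measure_union_le _ _)
    have h2 : ENNReal.ofReal a * μ (Bn ∩ {ω | a ≤ M n ω}) ≤
        ∫⁻ ω in Bn ∩ {ω | a ≤ M n ω}, ENNReal.ofReal (M n ω) ∂μ := by
      rw [← setLIntegral_const]
      refine setLIntegral_mono_ae' ((F.le n _ (hB n n (by omega))).inter (F.le n _ hA)) ?_
      exact Eventually.of_forall fun ω hω => ENNReal.ofReal_le_ofReal hω.2
    have h3 := h.step n Bn' hBn'
    have h4 := lintegral_inter_add_sdiff (μ := μ) (fun ω => ENNReal.ofReal (M n ω)) Bn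
      (F.le n _ hA)
    rw [Set.sdiff_eq, ← e1] at h4
    calc _ ≤ (ENNReal.ofReal a * μ {ω | ∃ i < n, a ≤ M i ω} +
          ∫⁻ ω in Bn ∩ {ω | a ≤ M n ω}, ENNReal.ofReal (M n ω) ∂μ) +
          ∫⁻ ω in Bn', ENNReal.ofReal (M n ω) ∂μ :=
            add_le_add (h1.trans (add_le_add le_rfl h2)) h3
      _ = _ := by rw [add_assoc, h4]

/-- Ville's maximal inequality. -/
theorem IsNonnegSuper.measure_exists_le {M : ℕ → Ω → ℝ} (h : IsNonnegSuper μ F M) {a c : ℝ}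
    (ha : 0 < a) (hc : ∀ ω, M 0 ω ≤ c) :
    μ {ω | ∃ i, a ≤ M i ω} ≤ ENNReal.ofReal (c / a) := by
  have e : {ω | ∃ i, a ≤ M i ω} = ⋃ n : ℕ, {ω | ∃ i < n, a ≤ M i ω} := by
    ext ω
    simp only [Set.mem_ofPred_eq, Set.mem_iUnion]
    exact ⟨fun ⟨i, hi⟩ => ⟨i + 1, i, by omega, hi⟩, fun ⟨_, i, _, hi⟩ => ⟨i, hi⟩⟩
  have hmono : Monotone fun n : ℕ => {ω | ∃ i < n, a ≤ M i ω} :=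
    fun n k hnk ω ⟨i, hi, hia⟩ => ⟨i, by omega, hia⟩
  rw [e, hmono.measure_iUnion]
  refine iSup_le fun n => ?_
  have h1 : ENNReal.ofReal a * μ {ω | ∃ i < n, a ≤ M i ω} ≤ ENNReal.ofReal c := by
    refine ((le_add_right le_rfl).trans (h.mul_measure_exists_lt_le a n)).trans ?_
    calc ∫⁻ ω, ENNReal.ofReal (M 0 ω) ∂μ ≤ ∫⁻ _ω, ENNReal.ofReal c ∂μ :=
          lintegral_mono fun ω => ENNReal.ofReal_le_ofReal (hc ω)
      _ = ENNReal.ofReal c := by simp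
  rw [ENNReal.ofReal_div_of_pos ha, ENNReal.le_div_iff_mul_le (Or.inl (by simpa using ha))
    (Or.inl ENNReal.ofReal_ne_top), mul_comm]
  exact h1

/-- `X` is a `[0,1]`-valued random variable with conditional expectation `m` given `𝓖`. -/
structure HasCondMean (μ : Measure Ω) (𝓖 : MeasurableSpace Ω) (X m : Ω → ℝ) : Prop where
  meas : Measurable[mΩ] X
  mem : ∀ ω, X ω ∈ Set.Icc (0 : ℝ) 1
  meas_mean : Measurable[𝓖] m
  mem_mean : ∀ ω, m ω ∈ Set.Icc (0 : ℝ) 1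
  condExp : μ[X | 𝓖] =ᵐ[μ] m

theorem HasCondMean.one_sub {𝓖 : MeasurableSpace Ω} (h𝓖 : 𝓖 ≤ mΩ) {X m : Ω → ℝ}
    (h : HasCondMean μ 𝓖 X m) : HasCondMean μ 𝓖 (fun ω => 1 - X ω) fun ω => 1 - m ω where
  meas := measurable_const.sub h.meas
  mem ω := ⟨by linarith [(h.mem ω).2], by linarith [(h.mem ω).1]⟩
  meas_mean := measurable_const.sub h.meas_mean
  mem_mean ω := ⟨by linarith [(h.mem_mean ω).2], by linarith [(h.mem_mean ω).1]⟩
  condExp := by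
    have hX : Integrable X μ := Integrable.of_mem_Icc 0 1 h.meas.aemeasurable
      (Eventually.of_forall h.mem)
    have h1 := condExp_sub (μ := μ) (integrable_const (1 : ℝ)) hX 𝓖
    rw [condExp_const h𝓖] at h1
    filter_upwards [h1, h.condExp] with ω h2 h3
    change (μ[(fun _ => (1 : ℝ)) - X | 𝓖]) ω = _
    rw [h2, Pi.sub_apply, h3]

/-- A factor known at the time of conditioning may be pulled out. -/
theorem HasCondMean.lintegral_mul {𝓖 : MeasurableSpace Ω} (h𝓖 : 𝓖 ≤ mΩ) {X m : Ω → ℝ}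
    (h : HasCondMean μ 𝓖 X m) {H : Ω → ℝ≥0∞} (hH : Measurable[𝓖] H) :
    ∫⁻ ω, H ω * ENNReal.ofReal (X ω) ∂μ = ∫⁻ ω, H ω * ENNReal.ofReal (m ω) ∂μ := by
  have hm := h.meas_mean.mono h𝓖 le_rfl
  have hX : Integrable X μ := Integrable.of_mem_Icc 0 1 h.meas.aemeasurable
    (Eventually.of_forall h.mem)
  have hmi : Integrable m μ := Integrable.of_mem_Icc 0 1 hm.aemeasurable
    (Eventually.of_forall h.mem_mean)
  have key : ∀ {Y : Ω → ℝ}, Measurable[mΩ] Y → ∫⁻ ω, H ω * ENNReal.ofReal (Y ω) ∂μ =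
      ∫⁻ ω, H ω ∂((μ.withDensity fun ω => ENNReal.ofReal (Y ω)).trim h𝓖) := by
    intro Y hY
    rw [lintegral_trim h𝓖 hH, lintegral_withDensity_eq_lintegral_mul _ hY.ennreal_ofReal
      (hH.mono h𝓖 le_rfl)]
    simp only [Pi.mul_apply, mul_comm]
  rw [key h.meas, key hm]
  congr 1
  refine @Measure.ext _ 𝓖 _ _ fun B hB => ?_
  rw [trim_measurableSet_eq h𝓖 hB, trim_measurableSet_eq h𝓖 hB, withDensity_apply _ (h𝓖 _ hB),
    withDensity_apply _ (h𝓖 _ hB),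
    ← ofReal_integral_eq_lintegral_ofReal hX.integrableOn
      (Eventually.of_forall fun ω => (h.mem ω).1),
    ← ofReal_integral_eq_lintegral_ofReal hmi.integrableOn
      (Eventually.of_forall fun ω => (h.mem_mean ω).1),
    ← setIntegral_condExp h𝓖 hX hB]
  congr 1
  exact setIntegral_congr_ae (h𝓖 _ hB) (h.condExp.mono fun ω hω _ => hω)

/-- The supermartingale step for a process dominated by an affine function of variables with known
conditional means. -/
theorem lintegral_step_le {ι : Type*} [Fintype ι] {𝓖 : MeasurableSpace Ω} (h𝓖 : 𝓖 ≤ mΩ)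
    {X m : ι → Ω → ℝ} (h : ∀ i, HasCondMean μ 𝓖 (X i) (m i)) {M M' g : Ω → ℝ} {H : ι → Ω → ℝ}
    (hg : Measurable[𝓖] g) (hg0 : ∀ ω, 0 ≤ g ω) (hH : ∀ i, Measurable[𝓖] (H i))
    (hH0 : ∀ i ω, 0 ≤ H i ω) (hM' : ∀ ω, M' ω ≤ g ω + ∑ i, H i ω * X i ω)
    (hM : ∀ ω, g ω + ∑ i, H i ω * m i ω ≤ M ω) {B : Set Ω} (hB : MeasurableSet[𝓖] B) :
    ∫⁻ ω in B, ENNReal.ofReal (M' ω) ∂μ ≤ ∫⁻ ω in B, ENNReal.ofReal (M ω) ∂μ := by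
  have hsplit : ∀ Y : ι → Ω → ℝ, (∀ i, Measurable[mΩ] (Y i)) → (∀ i ω, 0 ≤ Y i ω) →
      ∫⁻ ω in B, ENNReal.ofReal (g ω + ∑ i, H i ω * Y i ω) ∂μ =
        ∫⁻ ω in B, ENNReal.ofReal (g ω) ∂μ +
          ∑ i, ∫⁻ ω, (B.indicator fun ω => ENNReal.ofReal (H i ω)) ω *
            ENNReal.ofReal (Y i ω) ∂μ := by
    intro Y hYm hY0
    have e : ∀ ω, ENNReal.ofReal (g ω + ∑ i, H i ω * Y i ω) =
        ENNReal.ofReal (g ω) + ∑ i, ENNReal.ofReal (H i ω) * ENNReal.ofReal (Y i ω) := by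
      intro ω
      rw [ENNReal.ofReal_add (hg0 ω) (Finset.sum_nonneg fun i _ => mul_nonneg (hH0 i ω) (hY0 i ω)),
        ENNReal.ofReal_sum_of_nonneg fun i _ => mul_nonneg (hH0 i ω) (hY0 i ω)]
      congr 1
      exact Finset.sum_congr rfl fun i _ => ENNReal.ofReal_mul (hH0 i ω)
    simp_rw [e]
    rw [lintegral_add_left (hg.mono h𝓖 le_rfl).ennreal_ofReal, lintegral_finsetSum]
    · congr 1
      refine Finset.sum_congr rfl fun i _ => ?_
      rw [← lintegral_indicator (h𝓖 _ hB)]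
      refine lintegral_congr fun ω => ?_
      by_cases hω : ω ∈ B <;> simp [hω]
    · exact fun i _ => ((hH i).mono h𝓖 le_rfl).ennreal_ofReal.mul (hYm i).ennreal_ofReal
  calc _ ≤ ∫⁻ ω in B, ENNReal.ofReal (g ω + ∑ i, H i ω * X i ω) ∂μ :=
        lintegral_mono fun ω => ENNReal.ofReal_le_ofReal (hM' ω)
    _ = ∫⁻ ω in B, ENNReal.ofReal (g ω + ∑ i, H i ω * m i ω) ∂μ := by
        rw [hsplit X (fun i => (h i).meas) fun i ω => ((h i).mem ω).1,
          hsplit m (fun i => (h i).meas_mean.mono h𝓖 le_rfl) fun i ω => ((h i).mem_mean ω).1]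
        congr 1
        refine Finset.sum_congr rfl fun i _ => (h i).lintegral_mul h𝓖 ?_
        exact ((hH i).ennreal_ofReal).indicator hB
    _ ≤ _ := lintegral_mono fun ω => ENNReal.ofReal_le_ofReal (hM ω)

/-- The chord bound for the convex function `x ↦ exp (p x + q x²)`. -/
theorem exp_quadratic_le_chord {p q m x : ℝ} (hq : 0 ≤ q) (hx : x ∈ Set.Icc (0 : ℝ) 1) :
    Real.exp (p * (x - m) + q * (x - m) ^ 2) ≤
      (1 - x) * Real.exp (p * (-m) + q * (-m) ^ 2) +
        x * Real.exp (p * (1 - m) + q * (1 - m) ^ 2) := by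
  have h1 : p * (x - m) + q * (x - m) ^ 2 ≤
      (1 - x) * (p * (-m) + q * (-m) ^ 2) + x * (p * (1 - m) + q * (1 - m) ^ 2) := by
    nlinarith [mul_nonneg hq (mul_nonneg hx.1 (sub_nonneg.2 hx.2))]
  refine (Real.exp_le_exp.2 h1).trans ?_
  have := convexOn_exp.2 (Set.mem_univ (p * (-m) + q * (-m) ^ 2))
    (Set.mem_univ (p * (1 - m) + q * (1 - m) ^ 2)) (sub_nonneg.2 hx.2) hx.1 (by ring)
  simpa only [smul_eq_mul] using this

/-- The supermartingale step for an exponential of a quadratic polynomial in a centered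
`[0,1]`-valued variable. -/
theorem lintegral_exp_step_le {𝓖 : MeasurableSpace Ω} (h𝓖 : 𝓖 ≤ mΩ)
    {X m : Ω → ℝ} (h : HasCondMean μ 𝓖 X m) {M M' a b : Ω → ℝ}
    (hMm : Measurable[𝓖] M) (hM0 : ∀ ω, 0 ≤ M ω) (ha : Measurable[𝓖] a) (hb : Measurable[𝓖] b)
    (hb0 : ∀ ω, 0 ≤ b ω) (hb1 : ∀ ω, b ω < 1)
    (hM' : ∀ ω, M' ω ≤ M ω * (Real.sqrt (1 - b ω) * Real.exp (-(2 * a ω ^ 2 / (1 - b ω)))) *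
      Real.exp (4 * a ω * (X ω - m ω) + 2 * b ω * (X ω - m ω) ^ 2))
    {B : Set Ω} (hB : MeasurableSet[𝓖] B) :
    ∫⁻ ω in B, ENNReal.ofReal (M' ω) ∂μ ≤ ∫⁻ ω in B, ENNReal.ofReal (M ω) ∂μ := by
  set q : Ω → ℝ := fun ω => M ω * (Real.sqrt (1 - b ω) * Real.exp (-(2 * a ω ^ 2 / (1 - b ω))))
    with hq
  have hqm : Measurable[𝓖] q := by
    refine hMm.mul (Measurable.mul ?_ ?_)
    · exact (measurable_const.sub hb).sqrt
    · exact (((measurable_const.mul (ha.pow_const 2)).div (measurable_const.sub hb)).neg).exp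
  have hq0 : ∀ ω, 0 ≤ q ω := fun ω =>
    mul_nonneg (hM0 ω) (mul_nonneg (Real.sqrt_nonneg _) (Real.exp_pos _).le)
  have hmm := h.meas_mean
  refine lintegral_step_le (ι := Bool) h𝓖
    (X := fun i => bif i then X else fun ω => 1 - X ω)
    (m := fun i => bif i then m else fun ω => 1 - m ω)
    (g := fun _ => 0)
    (H := fun i => bif i then
        fun ω => q ω * Real.exp (4 * a ω * (1 - m ω) + 2 * b ω * (1 - m ω) ^ 2)
      else fun ω => q ω * Real.exp (4 * a ω * (-m ω) + 2 * b ω * (-m ω) ^ 2))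
    ?_ measurable_const (fun _ => le_rfl) ?_ ?_ ?_ ?_ hB
  · rintro (_ | _)
    · exact h.one_sub h𝓖
    · exact h
  · rintro (_ | _)
    · exact hqm.mul (((measurable_const.mul ha).mul hmm.neg).add
        ((measurable_const.mul hb).mul (hmm.neg.pow_const 2))).exp
    · exact hqm.mul (((measurable_const.mul ha).mul (measurable_const.sub hmm)).add
        ((measurable_const.mul hb).mul ((measurable_const.sub hmm).pow_const 2))).exp
  · rintro (_ | _) ω
    · exact mul_nonneg (hq0 ω) (Real.exp_pos _).le
    · exact mul_nonneg (hq0 ω) (Real.exp_pos _).le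
  · intro ω
    refine (hM' ω).trans ?_
    have h1 := mul_le_mul_of_nonneg_left (exp_quadratic_le_chord (p := 4 * a ω) (m := m ω)
      (show 0 ≤ 2 * b ω by linarith [hb0 ω]) (h.mem ω)) (hq0 ω)
    refine h1.trans (le_of_eq ?_)
    rw [Fintype.sum_bool]
    simp only [cond_true, cond_false]
    ring
  · intro ω
    have h1 := bernoulli_exp_quadratic_le (h.mem_mean ω) (a ω) (hb0 ω) (hb1 ω)
    have h2 := mul_le_mul_of_nonneg_left h1 (hq0 ω)
    have hs : 0 < Real.sqrt (1 - b ω) := Real.sqrt_pos.2 (by linarith [hb1 ω])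
    have h3 : q ω * (Real.exp (2 * a ω ^ 2 / (1 - b ω)) / Real.sqrt (1 - b ω)) = M ω := by
      simp only [hq]
      rw [Real.exp_neg]
      field_simp
    rw [h3] at h2
    refine le_trans (le_of_eq ?_) h2
    rw [Fintype.sum_bool]
    simp only [cond_true, cond_false]
    ring

end Supermartingale

/-! ### Measurability of matrix operations -/

section Measurability

variable {Ω : Type*} {d : ℕ}

theorem measurable_det {m : MeasurableSpace Ω} {V : Ω → Matrix (Fin d) (Fin d) ℝ}
    (hV : ∀ i j, Measurable fun ω => V ω i j) : Measurable fun ω => (V ω).det := by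
  simp_rw [Matrix.det_apply']
  exact Finset.measurable_fun_sum _ fun σ _ => measurable_const.mul
    (Finset.measurable_fun_prod _ fun i _ => hV _ _)

theorem measurable_inv_apply {m : MeasurableSpace Ω} {V : Ω → Matrix (Fin d) (Fin d) ℝ}
    (hV : ∀ i j, Measurable fun ω => V ω i j) (i j : Fin d) :
    Measurable fun ω => (V ω)⁻¹ i j := by
  simp_rw [Matrix.inv_def, Ring.inverse_eq_inv', Matrix.smul_apply, Matrix.adjugate_apply,
    smul_eq_mul]
  refine (measurable_det hV).inv.mul (measurable_det fun k l => ?_)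
  by_cases hk : k = j
  · subst hk; simp
  · simpa [Matrix.updateRow_apply, hk] using hV k l

theorem measurable_dotProduct {m : MeasurableSpace Ω} {x y : Ω → Fin d → ℝ}
    (hx : ∀ j, Measurable fun ω => x ω j) (hy : ∀ j, Measurable fun ω => y ω j) :
    Measurable fun ω => x ω ⬝ᵥ y ω :=
  Finset.measurable_fun_sum _ fun j _ => (hx j).mul (hy j)

theorem measurable_mulVec_apply {m : MeasurableSpace Ω} {V : Ω → Matrix (Fin d) (Fin d) ℝ}
    (hV : ∀ i j, Measurable fun ω => V ω i j) {x : Ω → Fin d → ℝ}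
    (hx : ∀ j, Measurable fun ω => x ω j) (i : Fin d) : Measurable fun ω => (V ω *ᵥ x ω) i :=
  measurable_dotProduct (fun j => hV i j) hx

theorem measurable_ridgeGram_apply {ι : Type*} {m : MeasurableSpace Ω} (lam : ℝ) (I : Finset ι)
    {x : ι → Ω → Fin d → ℝ} (hx : ∀ i ∈ I, ∀ j, Measurable fun ω => x i ω j) (j k : Fin d) :
    Measurable fun ω => ridgeGram lam I (fun i => x i ω) j k := by
  simp only [ridgeGram, Matrix.add_apply, Matrix.smul_apply, Matrix.sum_apply, vecMulVec_apply]
  exact measurable_const.add (Finset.measurable_fun_sum _ fun i hi => (hx i hi j).mul (hx i hi k))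

end Measurability

/-! ### Self-normalized concentration -/

section SelfNormalized

variable {Ω : Type*} {mΩ : MeasurableSpace Ω} {μ : Measure Ω} [IsProbabilityMeasure μ]
  {F : Filtration ℕ mΩ} {d : ℕ} {lam : ℝ} {x : ℕ → Ω → Fin d → ℝ} {X m : ℕ → Ω → ℝ}

theorem ridgeRHS_range_succ (x : ℕ → Fin d → ℝ) (y : ℕ → ℝ) (n : ℕ) :
    ridgeRHS (Finset.range (n + 1)) x y = ridgeRHS (Finset.range n) x y + y n • x n := by
  rw [ridgeRHS, Finset.sum_range_succ, ridgeRHS]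

theorem ridgeGram_range_succ (lam : ℝ) (x : ℕ → Fin d → ℝ) (n : ℕ) :
    ridgeGram lam (Finset.range (n + 1)) x =
      ridgeGram lam (Finset.range n) x + vecMulVec (x n) (x n) := by
  rw [Finset.range_add_one, ridgeGram_insert (by simp)]

/-- The process `√(λ^d / det Vₙ) exp (2 ‖Sₙ‖²)`, with the norm of `Vₙ⁻¹`, where
`Vₙ = λ I + ∑ xᵢ xᵢᵀ` and `Sₙ = ∑ yᵢ xᵢ`. -/
noncomputable def mixture (lam : ℝ) (x : ℕ → Fin d → ℝ) (y : ℕ → ℝ) (n : ℕ) : ℝ :=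
  Real.sqrt (lam ^ d / (ridgeGram lam (Finset.range n) x).det) *
    Real.exp (2 * (ridgeRHS (Finset.range n) x y ⬝ᵥ
      ((ridgeGram lam (Finset.range n) x)⁻¹ *ᵥ ridgeRHS (Finset.range n) x y)))

theorem mixture_nonneg (x : ℕ → Fin d → ℝ) (y : ℕ → ℝ) (n : ℕ) : 0 ≤ mixture lam x y n :=
  mul_nonneg (Real.sqrt_nonneg _) (Real.exp_pos _).le

/-- The effect of one more observation on the self-normalized norm. -/
theorem quadForm_inv_add_vecMulVec {V : Matrix (Fin d) (Fin d) ℝ} (hV : V.PosDef)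
    (x s : Fin d → ℝ) (η : ℝ) :
    (s + η • x) ⬝ᵥ ((V + vecMulVec x x)⁻¹ *ᵥ (s + η • x)) =
      s ⬝ᵥ (V⁻¹ *ᵥ s) - (x ⬝ᵥ (V⁻¹ *ᵥ s)) ^ 2 / (1 + x ⬝ᵥ (V⁻¹ *ᵥ x)) +
      2 * ((x ⬝ᵥ (V⁻¹ *ᵥ s)) / (1 + x ⬝ᵥ (V⁻¹ *ᵥ x))) * η +
      (x ⬝ᵥ (V⁻¹ *ᵥ x)) / (1 + x ⬝ᵥ (V⁻¹ *ᵥ x)) * η ^ 2 := by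
  have hw : 0 ≤ x ⬝ᵥ (V⁻¹ *ᵥ x) := quadForm_nonneg hV.inv.posSemidef x
  have hsx : s ⬝ᵥ (V⁻¹ *ᵥ x) = x ⬝ᵥ (V⁻¹ *ᵥ s) := dotProduct_mulVec_comm hV.inv.1 _ _
  rw [inv_add_vecMulVec_mulVec hV, dotProduct_sub, dotProduct_smul, quadForm_add hV.inv.1,
    quadForm_smul, mulVec_add, mulVec_smul, dotProduct_add, dotProduct_smul, add_dotProduct,
    smul_dotProduct, hsx, dotProduct_smul]
  simp only [smul_eq_mul]
  field_simp
  ring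

/-- One step of `mixture`, in the form required by `lintegral_exp_step_le` with
`a = z / (1 + w)` and `b = w / (1 + w)`, where `w = ‖xₙ‖²` and `z = ⟨xₙ, Sₙ⟩` for the form of
`Vₙ⁻¹`. -/
theorem mixture_succ (hlam : 0 < lam) (x : ℕ → Fin d → ℝ) (y : ℕ → ℝ) (n : ℕ) :
    mixture lam x y (n + 1) = mixture lam x y n *
      (Real.sqrt (1 - (x n ⬝ᵥ ((ridgeGram lam (Finset.range n) x)⁻¹ *ᵥ x n)) /
        (1 + x n ⬝ᵥ ((ridgeGram lam (Finset.range n) x)⁻¹ *ᵥ x n))) *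
      Real.exp (-(2 * ((x n ⬝ᵥ ((ridgeGram lam (Finset.range n) x)⁻¹ *ᵥ
          ridgeRHS (Finset.range n) x y)) /
        (1 + x n ⬝ᵥ ((ridgeGram lam (Finset.range n) x)⁻¹ *ᵥ x n))) ^ 2 /
        (1 - (x n ⬝ᵥ ((ridgeGram lam (Finset.range n) x)⁻¹ *ᵥ x n)) /
        (1 + x n ⬝ᵥ ((ridgeGram lam (Finset.range n) x)⁻¹ *ᵥ x n)))))) *
      Real.exp (4 * ((x n ⬝ᵥ ((ridgeGram lam (Finset.range n) x)⁻¹ *ᵥ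
          ridgeRHS (Finset.range n) x y)) /
        (1 + x n ⬝ᵥ ((ridgeGram lam (Finset.range n) x)⁻¹ *ᵥ x n))) * y n +
        2 * ((x n ⬝ᵥ ((ridgeGram lam (Finset.range n) x)⁻¹ *ᵥ x n)) /
        (1 + x n ⬝ᵥ ((ridgeGram lam (Finset.range n) x)⁻¹ *ᵥ x n))) * y n ^ 2) := by
  have hV := ridgeGram_posDef hlam (Finset.range n) x
  have hdet := hV.det_pos
  rw [mixture, mixture, ridgeGram_range_succ, ridgeRHS_range_succ,
    quadForm_inv_add_vecMulVec hV, det_add_vecMulVec hV]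
  set V := ridgeGram lam (Finset.range n) x
  set s := ridgeRHS (Finset.range n) x y
  have hw : 0 ≤ x n ⬝ᵥ (V⁻¹ *ᵥ x n) := quadForm_nonneg hV.inv.posSemidef _
  generalize x n ⬝ᵥ (V⁻¹ *ᵥ x n) = w at *
  generalize x n ⬝ᵥ (V⁻¹ *ᵥ s) = z at *
  generalize s ⬝ᵥ (V⁻¹ *ᵥ s) = Q at *
  have h1 : 1 - w / (1 + w) = 1 / (1 + w) := by field_simp; ring
  have h2 : lam ^ d / (V.det * (1 + w)) = lam ^ d / V.det * (1 / (1 + w)) := by field_simp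
  rw [h1, h2, Real.sqrt_mul (by positivity)]
  have h3 : Real.exp (2 * (Q - z ^ 2 / (1 + w) + 2 * (z / (1 + w)) * y n +
      w / (1 + w) * y n ^ 2)) = Real.exp (2 * Q) *
      Real.exp (-(2 * (z / (1 + w)) ^ 2 / (1 / (1 + w)))) *
      Real.exp (4 * (z / (1 + w)) * y n + 2 * (w / (1 + w)) * y n ^ 2) := by
    rw [← Real.exp_add, ← Real.exp_add]
    congr 1
    field_simp
    ring
  rw [h3]
  ring

theorem measurable_ridgeRHS_apply {m : MeasurableSpace Ω} (I : Finset ℕ)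
    {x : ℕ → Ω → Fin d → ℝ} {y : ℕ → Ω → ℝ} (hx : ∀ i ∈ I, ∀ j, Measurable fun ω => x i ω j)
    (hy : ∀ i ∈ I, Measurable (y i)) (j : Fin d) :
    Measurable fun ω => ridgeRHS I (fun i => x i ω) (fun i => y i ω) j := by
  simp only [ridgeRHS, Finset.sum_apply, Pi.smul_apply, smul_eq_mul]
  exact Finset.measurable_fun_sum _ fun i hi => (hy i hi).mul (hx i hi j)

/-- The method of mixtures: `mixture` is a supermartingale. -/
theorem mixture_isNonnegSuper (hlam : 0 < lam) (hx : ∀ t j, Measurable[F t] fun ω => x t ω j)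
    (hX : ∀ t, HasCondMean μ (F t) (X t) (m t)) (hXm : ∀ t, Measurable[F (t + 1)] (X t)) :
    IsNonnegSuper μ F fun n ω => mixture lam (fun i => x i ω) (fun i => X i ω - m i ω) n := by
  have hxm : ∀ n, ∀ i ∈ Finset.range n, ∀ j, Measurable[F n] fun ω => x i ω j := fun n i hi j =>
    (hx i j).mono (F.mono (Finset.mem_range.1 hi).le) le_rfl
  have hym : ∀ n, ∀ i ∈ Finset.range n, Measurable[F n] fun ω => X i ω - m i ω := fun n i hi =>
    ((hXm i).mono (F.mono (Nat.succ_le_of_lt (Finset.mem_range.1 hi))) le_rfl).sub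
      ((hX i).meas_mean.mono (F.mono (Finset.mem_range.1 hi).le) le_rfl)
  have hV := fun n => measurable_ridgeGram_apply lam (Finset.range n) (hxm n)
  have hS := fun n => measurable_ridgeRHS_apply (Finset.range n) (hxm n) (hym n)
  have hVi := fun n => measurable_inv_apply (hV n)
  have hM : ∀ n, Measurable[F n] fun ω =>
      mixture lam (fun i => x i ω) (fun i => X i ω - m i ω) n := fun n =>
    (measurable_const.div (measurable_det (hV n))).sqrt.mul (measurable_const.mul
      (measurable_dotProduct (hS n) (measurable_mulVec_apply (hVi n) (hS n)))).exp
  refine ⟨hM, fun n B hB => ?_⟩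
  set w : Ω → ℝ := fun ω =>
    x n ω ⬝ᵥ ((ridgeGram lam (Finset.range n) fun i => x i ω)⁻¹ *ᵥ x n ω)
  set z : Ω → ℝ := fun ω => x n ω ⬝ᵥ ((ridgeGram lam (Finset.range n) fun i => x i ω)⁻¹ *ᵥ
    ridgeRHS (Finset.range n) (fun i => x i ω) fun i => X i ω - m i ω)
  have hw : Measurable[F n] w :=
    measurable_dotProduct (hx n) (measurable_mulVec_apply (hVi n) (hx n))
  have hz : Measurable[F n] z :=
    measurable_dotProduct (hx n) (measurable_mulVec_apply (hVi n) (hS n))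
  have hw0 : ∀ ω, 0 ≤ w ω := fun ω =>
    quadForm_nonneg (ridgeGram_posDef hlam _ _).inv.posSemidef _
  refine lintegral_exp_step_le (F.le n) (hX n) (hM n) (fun ω => mixture_nonneg _ _ _)
    (a := fun ω => z ω / (1 + w ω)) (b := fun ω => w ω / (1 + w ω))
    (hz.div (measurable_const.add hw)) (hw.div (measurable_const.add hw))
    (fun ω => div_nonneg (hw0 ω) (by linarith [hw0 ω])) (fun ω => ?_) (fun ω => ?_) hB
  · rw [div_lt_one (by linarith [hw0 ω])]; linarith
  · exact (mixture_succ hlam (fun i => x i ω) (fun i => X i ω - m i ω) n).le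

/-- The self-normalized tail inequality for sums of centered `[0,1]`-valued variables. -/
theorem measure_selfNormalized_le (hlam : 0 < lam)
    (hx : ∀ t j, Measurable[F t] fun ω => x t ω j)
    (hX : ∀ t, HasCondMean μ (F t) (X t) (m t)) (hXm : ∀ t, Measurable[F (t + 1)] (X t))
    {ε : ℝ} (hε : 0 < ε) :
    μ {ω | ∃ n, 1 / 2 * Real.sqrt (Real.log ((ridgeGram lam (Finset.range n)
        fun i => x i ω).det / lam ^ d) + 2 * Real.log (1 / ε)) <
      vecNorm (ridgeGram lam (Finset.range n) fun i => x i ω)⁻¹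
        (ridgeRHS (Finset.range n) (fun i => x i ω) fun i => X i ω - m i ω)} ≤
      ENNReal.ofReal ε := by
  have h := (mixture_isNonnegSuper hlam hx hX hXm).measure_exists_le (a := 1 / ε) (c := 1)
    (by positivity) fun ω => by
      simp [mixture, ridgeGram, ridgeRHS, hlam.ne']
  rw [one_div_one_div] at h
  refine (measure_mono ?_).trans h
  rintro ω ⟨n, hn⟩
  refine ⟨n, ?_⟩
  by_contra! hlt
  refine absurd hn (not_lt.2 ?_)
  have hV := ridgeGram_posDef hlam (Finset.range n) fun i => x i ω
  have hdet := hV.det_pos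
  rw [mixture] at hlt
  have hQ := vecNorm_sq hV.inv.posSemidef
    (ridgeRHS (Finset.range n) (fun i => x i ω) fun i => X i ω - m i ω)
  rw [← hQ] at hlt
  set q := vecNorm (ridgeGram lam (Finset.range n) fun i => x i ω)⁻¹
    (ridgeRHS (Finset.range n) (fun i => x i ω) fun i => X i ω - m i ω)
  have hq : 0 ≤ q := vecNorm_nonneg _
  have hinv : Real.log (lam ^ d / (ridgeGram lam (Finset.range n) fun i => x i ω).det) =
      -Real.log ((ridgeGram lam (Finset.range n) fun i => x i ω).det / lam ^ d) := by
    rw [← Real.log_inv, inv_div]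
  have h1 := Real.log_lt_log (by positivity) hlt
  rw [Real.log_mul (by positivity) (by positivity), Real.log_exp, Real.log_sqrt (by positivity),
    hinv] at h1
  have h2 : (2 * q) ^ 2 ≤ Real.log ((ridgeGram lam (Finset.range n) fun i => x i ω).det /
      lam ^ d) + 2 * Real.log (1 / ε) := by linarith
  have h3 := Real.le_sqrt_of_sq_le h2
  linarith

/-- The noise and the bias of the ridge estimate, with `λ = 1`, fit into the confidence radius. -/
theorem half_sqrt_add_sqrt_le {d : ℕ} (hd : 1 ≤ d) {u y : ℝ} (hu : 0 ≤ u) (hy : Real.log 8 ≤ y) :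
    1 / 2 * Real.sqrt (d * u + 2 * y) + Real.sqrt d ≤ Real.sqrt (d * (u + y)) + 1 := by
  have hy2 : 2.079 ≤ y := by
    have h1 := Real.log_two_gt_d9
    rw [show (8 : ℝ) = 2 ^ 3 by norm_num, Real.log_pow] at hy
    push_cast at hy
    linarith
  have hd1 : (1 : ℝ) ≤ d := by exact_mod_cast hd
  rcases hd.eq_or_lt with rfl | h2
  · have h1 : Real.sqrt (((1 : ℕ) : ℝ) * u + 2 * y) ≤ 2 * Real.sqrt (((1 : ℕ) : ℝ) * (u + y)) := by
      rw [Real.sqrt_le_left (by positivity), mul_pow, Real.sq_sqrt (by push_cast; linarith)]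
      push_cast
      linarith
    simp only [Nat.cast_one, Real.sqrt_one] at *
    linarith
  · have hd2 : (2 : ℝ) ≤ d := by exact_mod_cast h2
    rcases le_or_gt d 9 with h9 | h9
    · have hd9 : (d : ℝ) ≤ 9 := by exact_mod_cast h9
      have h1 : Real.sqrt (d * u + 2 * y) ≤ Real.sqrt (d * (u + y)) := by
        apply Real.sqrt_le_sqrt
        nlinarith
      have h3 : Real.sqrt (d * (u + y)) = Real.sqrt d * Real.sqrt (u + y) :=
        Real.sqrt_mul (by linarith) _
      have h4 : 1.4 ≤ Real.sqrt (u + y) := Real.le_sqrt_of_sq_le (by norm_num; linarith)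
      have h5 : Real.sqrt d ≤ 3 := by
        rw [Real.sqrt_le_left (by norm_num)]; norm_num; exact h9
      have h6 : 0 ≤ Real.sqrt d := Real.sqrt_nonneg _
      nlinarith
    · have hd9 : (9 : ℝ) ≤ d := by exact_mod_cast h9.le
      -- `(√w / 2 + 1)² ≤ w + 4 / 3` for `w = u + 2 y / d`
      have h1 : 1 / 2 * Real.sqrt (d * u + 2 * y) + Real.sqrt d ≤ Real.sqrt (d * (u + y)) := by
        apply Real.le_sqrt_of_sq_le
        have e1 := Real.sq_sqrt (show 0 ≤ d * u + 2 * y by positivity)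
        have e2 := Real.sq_sqrt (show (0 : ℝ) ≤ d by positivity)
        have e3 := sq_nonneg (3 / 2 * Real.sqrt (d * u + 2 * y) - Real.sqrt d)
        have e4 : 2 * y + 4 / 3 * d ≤ d * y := by nlinarith
        nlinarith
      linarith

/-- The Azuma–Hoeffding inequality for centered `[0,1]`-valued variables. -/
theorem measure_sum_ge_le (hX : ∀ t, HasCondMean μ (F t) (X t) (m t))
    (hXm : ∀ t, Measurable[F (t + 1)] (X t)) {n : ℕ} (hn : 1 ≤ n) {R : ℝ} (hR : 0 ≤ R) :
    μ {ω | R < ∑ i ∈ Finset.range n, (X i ω - m i ω)} ≤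
      ENNReal.ofReal (Real.exp (-(2 * R ^ 2 / n))) := by
  have hn0 : (0 : ℝ) < n := by exact_mod_cast hn
  -- the optimal slope in `exp (-r R + r² n / 8)`
  set r := 4 * R / n with hr
  set Z : ℕ → Ω → ℝ := fun k ω =>
    Real.exp (r * ∑ i ∈ Finset.range k, (X i ω - m i ω) - r ^ 2 * k / 8) with hZ
  have hZm : ∀ k, Measurable[F k] (Z k) := fun k =>
    ((measurable_const.mul (Finset.measurable_fun_sum _ fun i hi =>
      ((hXm i).mono (F.mono (Nat.succ_le_of_lt (Finset.mem_range.1 hi))) le_rfl).sub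
      ((hX i).meas_mean.mono (F.mono (Finset.mem_range.1 hi).le) le_rfl))).sub
        measurable_const).exp
  have hsup : IsNonnegSuper μ F Z := by
    refine ⟨hZm, fun k B hB => ?_⟩
    refine lintegral_exp_step_le (F.le k) (hX k) (hZm k) (fun ω => (Real.exp_pos _).le)
      (a := fun _ => r / 4) (b := fun _ => 0) measurable_const measurable_const
      (fun _ => le_rfl) (fun _ => one_pos) (fun ω => le_of_eq ?_) hB
    simp only [hZ]
    rw [Finset.sum_range_succ, sub_zero, Real.sqrt_one, one_mul, ← Real.exp_add, ← Real.exp_add]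
    congr 1
    push_cast
    ring
  have h := hsup.measure_exists_le (a := Real.exp (2 * R ^ 2 / n)) (c := 1) (Real.exp_pos _)
    fun ω => by simp [hZ]
  rw [one_div, ← Real.exp_neg] at h
  refine (measure_mono ?_).trans h
  intro ω hω
  refine ⟨n, ?_⟩
  refine Real.exp_le_exp.2 ?_
  have h1 : r * R ≤ r * ∑ i ∈ Finset.range n, (X i ω - m i ω) :=
    mul_le_mul_of_nonneg_left (le_of_lt hω) (by positivity)
  have h2 : 2 * R ^ 2 / n = r * R - r ^ 2 * n / 8 := by
    rw [hr]; field_simp; ring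
  linarith

end SelfNormalized

/-! ### Measurability of the quantities of the algorithm -/

/-- A function that is measurable on each piece of a countable measurable partition. -/
theorem measurable_of_countable_cases {Ω ι β : Type*} {m : MeasurableSpace Ω} [MeasurableSpace β]
    [Countable ι] {k : Ω → ι} (hk : ∀ i, MeasurableSet {ω | k ω = i}) {f : ι → Ω → β}
    (hf : ∀ i, Measurable (f i)) : Measurable fun ω => f (k ω) ω := by
  intro B hB
  have e : (fun ω => f (k ω) ω) ⁻¹' B = ⋃ i, {ω | k ω = i} ∩ f i ⁻¹' B := by
    ext ω; simp
  rw [e]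
  exact MeasurableSet.iUnion fun i => (hk i).inter (hf i hB)

theorem measurableSet_of_countable_cases {Ω ι : Type*} {m : MeasurableSpace Ω} [Countable ι]
    {k : Ω → ι} (hk : ∀ i, MeasurableSet {ω | k ω = i}) {P : ι → Ω → Prop}
    (hP : ∀ i, MeasurableSet {ω | P i ω}) : MeasurableSet {ω | P (k ω) ω} := by
  have e : {ω | P (k ω) ω} = ⋃ i, {ω | k ω = i} ∩ {ω | P i ω} := by
    ext ω; simp
  rw [e]
  exact MeasurableSet.iUnion fun i => (hk i).inter (hP i)

theorem measurable_value {Ω S A : Type*} [Fintype S] [DecidableEq S] {m : MeasurableSpace Ω}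
    {l : Ω → S → A → ℝ} {P : Ω → S → A → S → ℝ} (hl : ∀ s a, Measurable fun ω => l ω s a)
    (hP : ∀ s a s', Measurable fun ω => P ω s a s') (π : S → A) (s : S) :
    Measurable fun ω => value (l ω) (P ω) π s := by
  have hpow : ∀ t s s', Measurable fun ω => (policyMatrix (P ω) π ^ t) s s' := by
    intro t
    induction t with
    | zero => intro s s'; simp only [pow_zero]; exact measurable_const
    | succ t ih =>
      intro s s'
      simp only [pow_succ, Matrix.mul_apply]
      exact Finset.measurable_fun_sum _ fun i _ => (ih s i).mul (hP i (π i) s')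
  refine Measurable.tsum (L := .unconditional ℕ) fun t => Measurable.ennreal_ofReal ?_
  exact Finset.measurable_fun_sum _ fun i _ => (hpow t s i).mul (hl i (π i))

namespace IsRandomRun

open Trajectory

variable {S A : Type*} [Fintype S] [DecidableEq S] [Fintype A] [DecidableEq A]
  {d : ℕ} {Ω : Type*} {mΩ : MeasurableSpace Ω} {μ : Measure Ω} {F : Filtration ℕ mΩ}
  {p : Params} {M : LinearCSSP S A d p.lmin} {tr : Ω → Trajectory S A d}

theorem act_meas (h : IsRandomRun μ F p M tr) (t : ℕ) (a : A) :
    MeasurableSet[F t] {ω | (tr ω).act t = a} := by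
  refine measurableSet_of_countable_cases (k := fun ω => (tr ω).state t) (h.state_meas t)
    (P := fun s ω => (tr ω).policy t s = a) fun s => ?_
  exact measurableSet_of_countable_cases (k := fun ω => (tr ω).policy t) (h.policy_meas t)
    (P := fun π _ => π s = a) fun π => MeasurableSet.const _

theorem pair_meas (h : IsRandomRun μ F p M tr) (t : ℕ) (x : S × A) :
    MeasurableSet[F t] {ω | ((tr ω).state t, (tr ω).act t) = x} := by
  simp only [Prod.ext_iff]
  exact (h.state_meas t x.1).inter (h.act_meas t x.2)

/-- The context of step `t` if that step visits `(s,a)`, and `0` otherwise. -/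
def visitCtx (tr : Ω → Trajectory S A d) (s : S) (a : A) (t : ℕ) (ω : Ω) : Fin d → ℝ :=
  if (tr ω).state t = s ∧ (tr ω).act t = a then (tr ω).ctx t else 0

theorem visitCtx_meas (h : IsRandomRun μ F p M tr) (s : S) (a : A) (t : ℕ) (j : Fin d) :
    Measurable[F t] fun ω => visitCtx tr s a t ω j := by
  have e : (fun ω => visitCtx tr s a t ω j) = fun ω =>
      if (tr ω).state t = s ∧ (tr ω).act t = a then (tr ω).ctx t j else 0 := by
    funext ω; unfold visitCtx; split_ifs <;> rfl
  rw [e]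
  exact Measurable.ite ((h.state_meas t s).inter (h.act_meas t a)) (h.ctx_meas t j)
    measurable_const

theorem gram_eq (tr : Ω → Trajectory S A d) (n : ℕ) (s : S) (a : A) (ω : Ω) :
    (tr ω).gram p n s a = ridgeGram p.lam (Finset.range n) fun i => visitCtx tr s a i ω := by
  rw [Trajectory.gram, ridgeGram, visits, Finset.sum_filter]
  congr 1
  refine Finset.sum_congr rfl fun i _ => ?_
  unfold visitCtx
  split_ifs
  · rfl
  · ext; simp [vecMulVec_apply]

theorem ridgeRHS_eq (tr : Ω → Trajectory S A d) (n : ℕ) (s : S) (a : A) (ω : Ω) {y y' : ℕ → ℝ}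
    (hy : ∀ i, (tr ω).state i = s → (tr ω).act i = a → y i = y' i) :
    ridgeRHS (Finset.range n) (fun i => visitCtx tr s a i ω) y =
      ridgeRHS ((tr ω).visits n s a) (tr ω).ctx y' := by
  rw [ridgeRHS, ridgeRHS, visits, Finset.sum_filter]
  refine Finset.sum_congr rfl fun i _ => ?_
  unfold visitCtx
  split_ifs with hv
  · rw [hy i hv.1 hv.2]
  · rw [smul_zero]

theorem gram_meas (h : IsRandomRun μ F p M tr) (n : ℕ) (s : S) (a : A) (j k : Fin d) :
    Measurable[F n] fun ω => (tr ω).gram p n s a j k := by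
  simp_rw [gram_eq]
  exact measurable_ridgeGram_apply p.lam (Finset.range n) (fun i hi j =>
    (h.visitCtx_meas s a i j).mono (F.mono (Finset.mem_range.1 hi).le) le_rfl) j k

theorem radius_meas (h : IsRandomRun μ F p M tr) (n : ℕ) (s : S) (a : A) :
    Measurable[F n] fun ω => (tr ω).radius p n s a := by
  have hcard : Measurable[F n] fun ω => (((tr ω).visits n s a).card : ℝ) := by
    have e : (fun ω => (((tr ω).visits n s a).card : ℝ)) = fun ω => ∑ i ∈ Finset.range n,
        if (tr ω).state i = s ∧ (tr ω).act i = a then (1 : ℝ) else 0 := by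
      funext ω
      rw [visits, Finset.sum_boole]
    rw [e]
    refine Finset.measurable_fun_sum _ fun i hi => ?_
    exact (Measurable.ite ((h.state_meas i s).inter (h.act_meas i a)) measurable_const
      measurable_const).mono (F.mono (Finset.mem_range.1 hi).le) le_rfl
  unfold radius
  exact (measurable_const.mul ((measurable_const.mul
    (measurable_const.add (hcard.div_const _))).div_const _).log).sqrt.add measurable_const

theorem known_meas (h : IsRandomRun μ F p M tr) (u m : ℕ) (s : S) (a : A) :
    MeasurableSet[F u] {ω | (tr ω).Known p u m s a} := by
  unfold Known vecNorm
  refine measurableSet_lt (Measurable.sqrt ?_) ?_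
  · exact measurable_dotProduct (h.ctx_meas u)
      (measurable_mulVec_apply (measurable_inv_apply (h.gram_meas u s a)) (h.ctx_meas u))
  · exact measurable_const.div (measurable_const.mul
      ((measurable_const.mul (h.radius_meas u s a)).max measurable_const))

theorem knownAt_meas (h : IsRandomRun μ F p M tr) (t : ℕ)
    (hi : ∀ x, MeasurableSet[F t] {ω | (tr ω).interval p t = x}) :
    MeasurableSet[F t] {ω | (tr ω).KnownAt p t} := by
  have e : {ω | (tr ω).KnownAt p t} = {ω | ((tr ω).interval p t).1 ≤ t ∧
      (tr ω).Known p ((tr ω).interval p t).1 ((tr ω).interval p t).2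
        ((tr ω).state t) ((tr ω).act t)} := by
    ext ω
    exact ⟨fun hk => ⟨intervalStart_le t, hk⟩, fun hk => hk.2⟩
  rw [e]
  refine measurableSet_of_countable_cases (k := fun ω => (tr ω).interval p t) hi
    (P := fun x ω => x.1 ≤ t ∧ (tr ω).Known p x.1 x.2 ((tr ω).state t) ((tr ω).act t))
    fun x => ?_
  refine measurableSet_of_countable_cases (h.pair_meas t)
    (P := fun y ω => x.1 ≤ t ∧ (tr ω).Known p x.1 x.2 y.1 y.2) fun y => ?_
  by_cases hx : x.1 ≤ t
  · simp only [hx, true_and]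
    exact F.mono hx _ (h.known_meas x.1 x.2 y.1 y.2)
  · simp [hx]

theorem next_none_meas (h : IsRandomRun μ F p M tr) (t : ℕ) :
    MeasurableSet[F (t + 1)] {ω | (tr ω).next t = none} := by
  have e : {ω | (tr ω).next t = none} = (⋃ s, {ω | (tr ω).next t = some s})ᶜ := by
    ext ω
    simp [Option.eq_none_iff_forall_ne_some]
  rw [e]
  exact (MeasurableSet.iUnion (h.next_meas t)).compl

theorem interval_meas (h : IsRandomRun μ F p M tr) (t : ℕ) (x : ℕ × ℕ) :
    MeasurableSet[F t] {ω | (tr ω).interval p t = x} := by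
  induction t generalizing x with
  | zero => simp only [interval]; exact MeasurableSet.const _
  | succ t ih =>
    have hE : MeasurableSet[F (t + 1)] {ω | (tr ω).EndsAt p t} :=
      (h.next_none_meas t).union (F.mono (Nat.le_succ t) _ (h.knownAt_meas t ih)).compl
    have e : {ω | (tr ω).interval p (t + 1) = x} =
        ({ω | (tr ω).EndsAt p t} ∩ {ω | (t + 1, ((tr ω).interval p t).2 + 1) = x}) ∪
        ({ω | (tr ω).EndsAt p t}ᶜ ∩ {ω | (tr ω).interval p t = x}) := by
      ext ω
      simp only [Set.mem_union, Set.mem_inter_iff, Set.mem_ofPred_eq, Set.mem_compl_iff]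
      by_cases he : (tr ω).EndsAt p t
      · rw [interval_succ_of_endsAt he]
        simp only [he, true_and, not_true_eq_false, false_and, or_false]
        rfl
      · rw [interval_succ_of_not_endsAt he]
        simp [he]
    rw [e]
    refine (hE.inter ?_).union (hE.compl.inter (F.mono (Nat.le_succ t) _ (ih x)))
    refine F.mono (Nat.le_succ t) _ ?_
    exact measurableSet_of_countable_cases (k := fun ω => (tr ω).interval p t) ih
      (P := fun y _ => (t + 1, y.2 + 1) = x) fun y => MeasurableSet.const _

theorem intervalIndex_meas (h : IsRandomRun μ F p M tr) (t : ℕ) (P : ℕ → Prop) :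
    MeasurableSet[F t] {ω | P ((tr ω).intervalIndex p t)} :=
  measurableSet_of_countable_cases (k := fun ω => (tr ω).interval p t) (h.interval_meas t)
    (P := fun y _ => P y.2) fun _ => MeasurableSet.const _

theorem optValue_meas (h : IsRandomRun μ F p M tr) (t : ℕ) (s : S) :
    Measurable[F t] fun ω => (tr ω).optValue t s := by
  unfold Trajectory.optValue
  refine measurable_of_countable_cases (k := fun ω => (tr ω).policy t) (h.policy_meas t)
    (f := fun π ω => (value ((tr ω).optLoss t) ((tr ω).optDyn t) π s).toReal) fun π => ?_
  exact (measurable_value (h.optLoss_meas t) (h.optDyn_meas t) π s).ennreal_toReal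

theorem optValue_state_meas (h : IsRandomRun μ F p M tr) (t : ℕ) :
    Measurable[F t] fun ω => (tr ω).optValue t ((tr ω).state t) :=
  measurable_of_countable_cases (k := fun ω => (tr ω).state t) (h.state_meas t)
    (f := fun s ω => (tr ω).optValue t s) (h.optValue_meas t)

theorem meanLoss_meas (h : IsRandomRun μ F p M tr) (t : ℕ) :
    Measurable[F t] fun ω => M.meanLoss ((tr ω).ctx t) ((tr ω).state t) ((tr ω).act t) :=
  measurable_of_countable_cases (h.pair_meas t)
    (f := fun x ω => M.meanLoss ((tr ω).ctx t) x.1 x.2) fun _ =>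
      measurable_dotProduct (h.ctx_meas t) fun _ => measurable_const

theorem dyn_meas (h : IsRandomRun μ F p M tr) (t : ℕ) (s' : S) :
    Measurable[F t] fun ω => M.dyn ((tr ω).ctx t) ((tr ω).state t) ((tr ω).act t) s' :=
  measurable_of_countable_cases (h.pair_meas t)
    (f := fun x ω => M.dyn ((tr ω).ctx t) x.1 x.2 s') fun _ =>
      measurable_dotProduct (fun _ => measurable_const) (h.ctx_meas t)

theorem boundedAt_meas (h : IsRandomRun μ F p M tr) (t : ℕ) :
    MeasurableSet[F t] {ω | (tr ω).BoundedAt p t} := by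
  unfold BoundedAt
  simp only [Set.ofPred_forall]
  exact MeasurableSet.iInter fun s => measurableSet_le (h.optValue_meas t s) measurable_const

theorem driftAt_meas (h : IsRandomRun μ F p M tr) (t : ℕ) :
    MeasurableSet[F t] {ω | DriftAt M (tr ω) t} :=
  measurableSet_le ((measurable_const.mul (h.meanLoss_meas t)).add
    (Finset.measurable_fun_sum _ fun s' _ => (h.dyn_meas t s').mul (h.optValue_meas t s')))
    (h.optValue_state_meas t)

variable [IsProbabilityMeasure μ]

theorem hasCondMean_loss (h : IsRandomRun μ F p M tr) (hp : Admissible p M) (t : ℕ) :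
    HasCondMean μ (F t) (fun ω => (tr ω).loss t) fun ω =>
      M.meanLoss ((tr ω).ctx t) ((tr ω).state t) ((tr ω).act t) where
  meas := (h.loss_meas t).mono (F.le _) le_rfl
  mem ω := ⟨hp.lmin_pos.le.trans ((h.isRun ω).loss_mem t).1, ((h.isRun ω).loss_mem t).2⟩
  meas_mean := h.meanLoss_meas t
  mem_mean ω := by
    have := M.meanLoss_mem ((h.isRun ω).ctx_mem t) ((tr ω).state t) ((tr ω).act t)
    exact ⟨hp.lmin_pos.le.trans this.1, this.2⟩
  condExp := h.loss_mean t

/-- The indicator of the event that `s'` is the next state. -/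
noncomputable def nextInd (tr : Ω → Trajectory S A d) (s' : S) (t : ℕ) : Ω → ℝ :=
  Set.indicator {ω | (tr ω).next t = some s'} fun _ => (1 : ℝ)

theorem nextInd_apply (tr : Ω → Trajectory S A d) (s' : S) (t : ℕ) (ω : Ω) :
    nextInd tr s' t ω = if (tr ω).next t = some s' then 1 else 0 := by
  unfold nextInd
  simp [Set.indicator_apply]

theorem nextInd_meas (h : IsRandomRun μ F p M tr) (s' : S) (t : ℕ) :
    Measurable[F (t + 1)] (nextInd tr s' t) :=
  measurable_const.indicator (h.next_meas t s')

theorem hasCondMean_next (h : IsRandomRun μ F p M tr) (s' : S) (t : ℕ) :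
    HasCondMean μ (F t) (nextInd tr s' t) fun ω =>
      M.dyn ((tr ω).ctx t) ((tr ω).state t) ((tr ω).act t) s' where
  meas := (h.nextInd_meas s' t).mono (F.le _) le_rfl
  mem ω := by rw [nextInd_apply]; split_ifs <;> simp
  meas_mean := h.dyn_meas t s'
  mem_mean ω := by
    have := M.dyn_mem ((h.isRun ω).ctx_mem t) ((tr ω).state t) ((tr ω).act t)
    exact ⟨this.1 s', (Finset.single_le_sum (fun s _ => this.1 s) (Finset.mem_univ s')).trans
      this.2⟩
  condExp := h.next_law t s'

/-! ### The confidence sets -/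

/-- With `λ = 1`, a self-normalized noise bound with failure probability `δ / (8 N)` puts the
regression target into the confidence ellipsoid. -/
theorem ridge_conf {ι : Type*} {d : ℕ} (hd : 1 ≤ d) (I : Finset ι) (c : ι → Fin d → ℝ)
    (hc : ∀ i ∈ I, c i ⬝ᵥ c i ≤ 1) (y : ι → ℝ) {L : Fin d → ℝ}
    (hL : ∀ j, L j ∈ Set.Icc (0 : ℝ) 1) {N δ : ℝ} (hN : 1 ≤ N) (hδ0 : 0 < δ) (hδ1 : δ < 1)
    (h : vecNorm (ridgeGram 1 I c)⁻¹ (ridgeRHS I c fun i => y i - c i ⬝ᵥ L) ≤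
      1 / 2 * Real.sqrt (Real.log ((ridgeGram 1 I c).det / 1 ^ d) +
        2 * Real.log (1 / (δ / (8 * N))))) :
    vecNorm (ridgeGram 1 I c) (L - (ridgeGram 1 I c)⁻¹ *ᵥ ridgeRHS I c y) ≤
      Real.sqrt (d * Real.log (8 * N * (1 + I.card / 1) / δ)) + Real.sqrt 1 := by
  have hdet := (ridgeGram_posDef one_pos I c).det_pos
  have h1 := vecNorm_ridge_error_le one_pos I c y L
  have hLL : L ⬝ᵥ L ≤ d := by
    calc L ⬝ᵥ L ≤ ∑ _j : Fin d, (1 : ℝ) := Finset.sum_le_sum fun j _ =>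
          mul_le_one₀ (hL j).2 (hL j).1 (hL j).2
      _ = d := by simp
  have h2 : Real.sqrt (1 * (L ⬝ᵥ L)) ≤ Real.sqrt d := by rw [one_mul]; gcongr
  have h3 : Real.log ((ridgeGram 1 I c).det / 1 ^ d) ≤ d * Real.log (1 + I.card) := by
    rw [one_pow, div_one, ← Real.log_pow]
    exact Real.log_le_log hdet (det_ridgeGram_le one_pos I c hc)
  have h4 : (1 : ℝ) / (δ / (8 * N)) = 8 * N / δ := by rw [one_div_div]
  rw [h4] at h
  have h5 := half_sqrt_add_sqrt_le hd (u := Real.log (1 + I.card)) (y := Real.log (8 * N / δ))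
    (Real.log_nonneg (by linarith [(Nat.cast_nonneg I.card : (0 : ℝ) ≤ I.card)])) (by
      refine Real.log_le_log (by norm_num) ?_
      rw [le_div_iff₀ hδ0]
      nlinarith)
  have h6 : Real.log (1 + I.card) + Real.log (8 * N / δ) =
      Real.log (8 * N * (1 + I.card / 1) / δ) := by
    rw [← Real.log_mul (by positivity) (by positivity)]
    congr 1
    rw [div_one]
    ring
  rw [h6] at h5
  rw [Real.sqrt_one]
  refine le_trans ?_ h5
  refine h1.trans (add_le_add (h.trans ?_) h2)
  gcongr

theorem one_le_dim (h : IsRandomRun μ F p M tr) : 1 ≤ d := by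
  obtain ⟨ω⟩ := nonempty_of_isProbabilityMeasure μ
  exact_mod_cast (h.isRun ω).one_le_dim

/-- At `λ = 1`, the loss confidence sets of a fixed pair contain `L⋆` at all times, up to a failure
probability that leaves room for a union bound over the pairs. -/
theorem measure_not_lossConf_le (h : IsRandomRun μ F p M tr) (hp : Admissible p M)
    (hlam : p.lam = 1) (s : S) (a : A) :
    μ {ω | ∃ n, M.Lstar s a ∉ (tr ω).lossConf p n s a} ≤
      ENNReal.ofReal (p.delta / (8 * (Fintype.card S * Fintype.card A))) := by
  have : Nonempty A := ⟨a⟩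
  have hS := one_le_card_state M
  have hA := one_le_card_action (A := A)
  have hδ := hp.delta_pos
  have hN := one_le_mul_of_one_le_of_one_le hS hA
  refine (measure_mono ?_).trans (measure_selfNormalized_le one_pos (h.visitCtx_meas s a)
    (h.hasCondMean_loss hp) h.loss_meas (ε := p.delta / (8 * (Fintype.card S * Fintype.card A)))
    (by positivity))
  rintro ω ⟨n, hn⟩
  refine ⟨n, ?_⟩
  by_contra hle
  rw [not_lt] at hle
  refine hn ?_
  rw [ridgeRHS_eq tr n s a ω (y' := fun i => (tr ω).loss i - (tr ω).ctx i ⬝ᵥ M.Lstar s a)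
    fun i h1 h2 => by simp only [h1, h2]; rfl] at hle
  have hg := gram_eq (p := p) tr n s a ω
  rw [hlam] at hg
  rw [← hg] at hle
  have hg2 : (tr ω).gram p n s a = ridgeGram 1 ((tr ω).visits n s a) (tr ω).ctx := by
    rw [← hlam]; rfl
  rw [hg2] at hle
  have h3 := ridge_conf h.one_le_dim _ _ (fun i _ => dotProduct_self_le_one ((h.isRun ω).ctx_mem i))
    (fun i => (tr ω).loss i) (fun j => ⟨hp.lmin_pos.le.trans (M.Lstar_mem s a j).1,
      (M.Lstar_mem s a j).2⟩) hN hδ hp.delta_lt hle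
  have he : (tr ω).lossEst p n s a = (ridgeGram 1 ((tr ω).visits n s a) (tr ω).ctx)⁻¹ *ᵥ
      ridgeRHS ((tr ω).visits n s a) (tr ω).ctx fun i => (tr ω).loss i := by
    rw [lossEst, hlam]
    exact argminOn_ridge one_pos _ _ _
  change vecNorm ((tr ω).gram p n s a) _ ≤ _
  rw [hg2, he, lossRadius, hlam]
  refine h3.trans (le_of_eq ?_)
  rw [← mul_assoc]

/-- The rows of the ridge estimate of the dynamics are ridge estimates. -/
theorem argminOn_ridge_matrix {ι : Type*} {lam : ℝ} (hlam : 0 < lam) (I : Finset ι)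
    (x : ι → Fin d → ℝ) (y : ι → S → ℝ) :
    argminOn (fun P : Matrix S (Fin d) ℝ => ∑ i ∈ I, ∑ s, ((P *ᵥ x i) s - y i s) ^ 2 +
      lam * ∑ s, ∑ j, P s j ^ 2) Set.univ =
      fun s => (ridgeGram lam I x)⁻¹ *ᵥ ridgeRHS I x fun i => y i s := by
  have hP := ridgeGram_posDef hlam I x
  set P₀ : Matrix S (Fin d) ℝ := fun s => (ridgeGram lam I x)⁻¹ *ᵥ ridgeRHS I x fun i => y i s
    with hP₀
  set C : S → ℝ := fun s => ∑ i ∈ I, y i s ^ 2 -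
    ridgeRHS I x (fun i => y i s) ⬝ᵥ ((ridgeGram lam I x)⁻¹ *ᵥ ridgeRHS I x fun i => y i s)
  have hobj : ∀ P : Matrix S (Fin d) ℝ, ∑ i ∈ I, ∑ s, ((P *ᵥ x i) s - y i s) ^ 2 +
      lam * ∑ s, ∑ j, P s j ^ 2 =
      ∑ s, (P s - P₀ s) ⬝ᵥ (ridgeGram lam I x *ᵥ (P s - P₀ s)) + ∑ s, C s := by
    intro P
    rw [Finset.sum_comm, Finset.mul_sum, ← Finset.sum_add_distrib, ← Finset.sum_add_distrib]
    refine Finset.sum_congr rfl fun s _ => ?_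
    rw [← ridge_objective hlam I x (fun i => y i s) (P s)]
    congr 1
    · refine Finset.sum_congr rfl fun i _ => ?_
      rw [dotProduct_comm]; rfl
    · congr 1
      exact Finset.sum_congr rfl fun j _ => sq _
  simp_rw [hobj]
  have hq : ∀ (P : Matrix S (Fin d) ℝ) s,
      0 ≤ (P s - P₀ s) ⬝ᵥ (ridgeGram lam I x *ᵥ (P s - P₀ s)) := fun P s =>
    quadForm_nonneg hP.posSemidef _
  have h := argminOn_spec (s := Set.univ) (f := fun P : Matrix S (Fin d) ℝ =>
    ∑ s, (P s - P₀ s) ⬝ᵥ (ridgeGram lam I x *ᵥ (P s - P₀ s)) + ∑ s, C s) ⟨P₀, trivial, fun P _ => by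
      simpa using Finset.sum_nonneg fun s (_ : s ∈ Finset.univ) => hq P s⟩
  set Q := argminOn (fun P : Matrix S (Fin d) ℝ =>
    ∑ s, (P s - P₀ s) ⬝ᵥ (ridgeGram lam I x *ᵥ (P s - P₀ s)) + ∑ s, C s) Set.univ
  have h2 := h.2 (Set.mem_univ P₀)
  have h3 : ∑ s, (Q s - P₀ s) ⬝ᵥ (ridgeGram lam I x *ᵥ (Q s - P₀ s)) ≤ 0 := by simpa using h2
  funext s
  exact eq_of_quadForm_sub_nonpos hP
    ((Finset.single_le_sum (fun s _ => hq Q s) (Finset.mem_univ s)).trans h3)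

/-- If all rows of the ridge estimate are accurate, then so is its projection. -/
theorem dynConf_of_rows (hp : Admissible p M) {n : ℕ} {s : S} {a : A}
    {ω : Ω} (h : ∀ s', vecNorm ((tr ω).gram p n s a)
      (M.Pstar s a s' - (tr ω).dynEstRaw p n s a s') ≤ (tr ω).radius p n s a) :
    M.Pstar s a ∈ (tr ω).dynConf p n s a := by
  have hV := (gram_posDef (tr := tr ω) hp n s a).posSemidef
  have h1 := matNorm_sub_argminOn_le hV (isCompact_subDist_matrices (S := S) (d := d))
    convex_subDist_matrices ((tr ω).dynEstRaw p n s a) (P := M.Pstar s a) (M.Pstar_mem s a)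
  refine le_trans h1 ?_
  have hρ := (radius_pos (tr := tr ω) hp n s a).le
  refine (abs_le_of_sq_le_sq' ?_ (mul_nonneg (Real.sqrt_nonneg _) hρ)).2
  rw [matNorm_sq hV, mul_pow, Real.sq_sqrt (by positivity)]
  calc _ ≤ ∑ _s' : S, (tr ω).radius p n s a ^ 2 :=
        Finset.sum_le_sum fun s' _ => pow_le_pow_left₀ (vecNorm_nonneg _) (h s') 2
    _ = _ := by simp

/-- At `λ = 1`, the rows of the ridge estimates of the dynamics are accurate at all times, up to a
failure probability that leaves room for a union bound over the pairs and the rows. -/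
theorem measure_not_row_le (h : IsRandomRun μ F p M tr) (hp : Admissible p M)
    (hlam : p.lam = 1) (s : S) (a : A) (s' : S) :
    μ {ω | ∃ n, ¬ vecNorm ((tr ω).gram p n s a)
      (M.Pstar s a s' - (tr ω).dynEstRaw p n s a s') ≤ (tr ω).radius p n s a} ≤
      ENNReal.ofReal (p.delta / (8 * ((Fintype.card S : ℝ) ^ 2 * Fintype.card A))) := by
  have : Nonempty A := ⟨a⟩
  have hS := one_le_card_state M
  have hA := one_le_card_action (A := A)
  have hδ := hp.delta_pos
  have hN := one_le_mul_of_one_le_of_one_le (one_le_pow₀ hS (n := 2)) hA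
  refine (measure_mono ?_).trans (measure_selfNormalized_le one_pos (h.visitCtx_meas s a)
    (h.hasCondMean_next s') (h.nextInd_meas s')
    (ε := p.delta / (8 * ((Fintype.card S : ℝ) ^ 2 * Fintype.card A))) (by positivity))
  rintro ω ⟨n, hn⟩
  refine ⟨n, ?_⟩
  by_contra hle
  rw [not_lt] at hle
  refine hn ?_
  rw [ridgeRHS_eq tr n s a ω
    (y' := fun i => nextInd tr s' i ω - (tr ω).ctx i ⬝ᵥ M.Pstar s a s')
    fun i h1 h2 => by
      simp only [h1, h2, LinearCSSP.dyn, dotProduct_comm ((tr ω).ctx i)]; rfl] at hle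
  have hg := gram_eq (p := p) tr n s a ω
  rw [hlam] at hg
  rw [← hg] at hle
  have hg2 : (tr ω).gram p n s a = ridgeGram 1 ((tr ω).visits n s a) (tr ω).ctx := by
    rw [← hlam]; rfl
  rw [hg2] at hle
  have h3 := ridge_conf h.one_le_dim _ _ (fun i _ => dotProduct_self_le_one ((h.isRun ω).ctx_mem i))
    (fun i => nextInd tr s' i ω) (fun j => ⟨(M.Pstar_mem s a j).1 s',
      (Finset.single_le_sum (fun s'' _ => (M.Pstar_mem s a j).1 s'') (Finset.mem_univ s')).trans
        (M.Pstar_mem s a j).2⟩) hN hδ hp.delta_lt hle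
  have he : (tr ω).dynEstRaw p n s a s' = (ridgeGram 1 ((tr ω).visits n s a) (tr ω).ctx)⁻¹ *ᵥ
      ridgeRHS ((tr ω).visits n s a) (tr ω).ctx fun i => nextInd tr s' i ω := by
    rw [dynEstRaw, hlam]
    have h4 := argminOn_ridge_matrix one_pos ((tr ω).visits n s a) (tr ω).ctx
      (fun i s'' => if (tr ω).next i = some s'' then (1 : ℝ) else 0)
    rw [h4]
    simp_rw [nextInd_apply]
  rw [hg2, he, radius, hlam]
  refine h3.trans (le_of_eq ?_)
  rw [← mul_assoc]

end IsRandomRun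

/-! ### The loss of the first interval -/

namespace Trajectory

variable {S A : Type*} [Fintype S] [DecidableEq S] [Fintype A] [DecidableEq A] {d : ℕ}
  {p : Params} {M : LinearCSSP S A d p.lmin} {tr : Trajectory S A d}

/-- With `λ = 1` no pair is known initially: `‖c‖ ≥ 1 / √d` on the simplex, while the radius
exceeds `√d`. -/
theorem IsRun.not_knownAt_zero (hr : tr.IsRun p M) (hp : Admissible p M) (hlam : p.lam = 1) :
    ¬ tr.KnownAt p 0 := by
  intro hk
  have : Nonempty A := ⟨tr.act 0⟩
  have hS := one_le_card_state M
  have hA := one_le_card_action (A := A)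
  have hd := hr.one_le_dim
  have hδ := hp.delta_pos
  have hB := hp.Bstar
  have hl1 := hr.lmin_le_one
  have hsd : 1 ≤ Real.sqrt d := Real.one_le_sqrt.2 hd
  have hs0 : (0 : ℝ) < Real.sqrt d := by linarith
  have hg : tr.gram p (tr.intervalStart p 0) (tr.state 0) (tr.act 0) = 1 := by
    have : tr.intervalStart p 0 = 0 := rfl
    rw [this, Trajectory.gram, hlam]
    simp [visits]
  have hnorm : 1 / Real.sqrt d ≤ vecNorm (1 : Matrix (Fin d) (Fin d) ℝ)⁻¹ (tr.ctx 0) := by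
    rw [inv_one, vecNorm, one_mulVec]
    refine Real.le_sqrt_of_sq_le ?_
    rw [div_pow, one_pow, Real.sq_sqrt (by linarith), div_le_iff₀ (by linarith)]
    have h1 := dotProduct_sq_le (tr.ctx 0) (fun _ => 1)
    have h2 : tr.ctx 0 ⬝ᵥ (fun _ => (1 : ℝ)) = 1 := by
      simp only [dotProduct, mul_one]; exact (hr.ctx_mem 0).2
    have h3 : (fun _ : Fin d => (1 : ℝ)) ⬝ᵥ (fun _ => (1 : ℝ)) = d := by simp [dotProduct]
    rw [h2, h3] at h1
    linarith
  have hrad : Real.sqrt d ≤ tr.radius p (tr.intervalStart p 0) (tr.state 0) (tr.act 0) := by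
    have h0 : 0 ≤ Real.sqrt p.lam := Real.sqrt_nonneg _
    rw [radius]
    refine le_trans (Real.sqrt_le_sqrt ?_) (le_add_of_nonneg_right h0)
    have h1 : Real.log 8 ≤ Real.log (8 * (Fintype.card S : ℝ) ^ 2 * Fintype.card A *
        (1 + ((tr.visits (tr.intervalStart p 0) (tr.state 0) (tr.act 0)).card : ℝ) / p.lam) /
          p.delta) := by
      refine Real.log_le_log (by norm_num) ?_
      rw [le_div_iff₀ hδ]
      have h2 : 1 ≤ (Fintype.card S : ℝ) ^ 2 * Fintype.card A *
          (1 + ((tr.visits (tr.intervalStart p 0) (tr.state 0) (tr.act 0)).card : ℝ) / p.lam) := by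
        refine one_le_mul_of_one_le_of_one_le
          (one_le_mul_of_one_le_of_one_le (one_le_pow₀ hS) hA) ?_
        rw [hlam, div_one]
        exact le_add_of_nonneg_right (Nat.cast_nonneg _)
      nlinarith [hp.delta_lt]
    nlinarith [two_lt_log_eight]
  have h1 := hk
  unfold KnownAt Known at h1
  rw [hg] at h1
  have hctx : tr.intervalStart p 0 = 0 := rfl
  rw [hctx] at h1 hrad
  set ρ := tr.radius p 0 (tr.state 0) (tr.act 0)
  set mx := max ((Fintype.card S : ℝ) * ρ)
    (Real.sqrt (Real.log (4 * (tr.intervalIndex p 0 : ℕ) / p.delta)))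
  have hmx : Real.sqrt d ≤ mx := by
    refine le_trans ?_ (le_max_left _ _)
    nlinarith
  have hden : Real.sqrt d ≤ 10 * p.Bstar * mx := by nlinarith
  have h2 : p.lmin / (10 * p.Bstar * mx) ≤ 1 / Real.sqrt d :=
    div_le_div₀ zero_le_one hl1 hs0 hden
  linarith

/-- With `λ = 1` the first interval consists of a single step. -/
theorem IsRun.eq_zero_of_intervalIndex (hr : tr.IsRun p M) (hp : Admissible p M)
    (hlam : p.lam = 1) {t : ℕ} (h : tr.intervalIndex p t = 1) : t = 0 := by
  by_contra h0
  exact not_endsAt_of_intervalIndex_eq (Nat.pos_of_ne_zero h0) h.symm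
    (Or.inr (hr.not_knownAt_zero hp hlam))

theorem log_eight_le (hp : Admissible p M) {x : ℝ} (hx : 8 ≤ x) :
    Real.log 8 ≤ Real.log (x / p.delta) := by
  refine Real.log_le_log (by norm_num) ?_
  rw [le_div_iff₀ hp.delta_pos]
  nlinarith [hp.delta_lt, hp.delta_pos]

theorem IsRun.cost_first_interval_le (hr : tr.IsRun p M) (hp : Admissible p M)
    (hlam : p.lam = 1) {t : ℕ} (h : tr.intervalIndex p t = 1) :
    ∑ i ∈ Finset.Icc (tr.intervalStart p t) t, tr.loss i ≤
      48 * p.Bstar * Real.log (4 * tr.intervalIndex p t / p.delta) := by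
  have ht := hr.eq_zero_of_intervalIndex hp hlam h
  subst ht
  have h0 : tr.intervalStart p 0 = 0 := rfl
  rw [h, h0, Finset.Icc_self, Finset.sum_singleton]
  have h1 := (hr.loss_mem 0).2
  have h2 : Real.log 4 ≤ Real.log (4 * (1 : ℕ) / p.delta) := by
    refine Real.log_le_log (by norm_num) ?_
    rw [le_div_iff₀ hp.delta_pos]
    push_cast
    nlinarith [hp.delta_lt, hp.delta_pos]
  have h3 : Real.log 4 = 2 * Real.log 2 := by
    rw [show (4 : ℝ) = 2 ^ 2 by norm_num, Real.log_pow]; norm_num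
  have h4 := Real.log_two_gt_d9
  have h5 : 1 ≤ Real.log (4 * (1 : ℕ) / p.delta) := by linarith
  nlinarith [hp.Bstar]

/-! ### The loss of the later intervals -/

/-- The loss of the `m`-th interval before step `t`. -/
noncomputable def pastCost (p : Params) (tr : Trajectory S A d) (m t : ℕ) : ℝ :=
  ∑ i ∈ Finset.range t, if tr.intervalIndex p i = m then tr.loss i else 0

/-- Step `t` belongs to the `m`-th interval, whose optimistic values are bounded and have drifted
downwards at all its earlier steps. -/
def Controlled (M : LinearCSSP S A d p.lmin) (tr : Trajectory S A d) (m t : ℕ) : Prop :=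
  tr.intervalIndex p t = m ∧ tr.BoundedAt p t ∧
    ∀ i < t, tr.intervalIndex p i = m → DriftAt M tr i

open Classical in
/-- The process `exp (C / (8 B)) (1 + Ṽ(s) / B)` in the `m`-th interval, where `C` is the loss of
the interval so far; it is `2` before the interval, and is stopped when the optimistic values fail
to be bounded or to drift downwards. -/
noncomputable def costPotential (M : LinearCSSP S A d p.lmin) (m : ℕ) (tr : Trajectory S A d)
    (t : ℕ) : ℝ :=
  if tr.intervalIndex p t < m then 2
  else if Controlled M tr m t then
    Real.exp (1 / (8 * p.Bstar) * tr.pastCost p m t) * (1 + tr.optValue t (tr.state t) / p.Bstar)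
  else 0

theorem costPotential_of_lt {m t : ℕ} (h : tr.intervalIndex p t < m) :
    costPotential M m tr t = 2 := if_pos h

theorem costPotential_of_controlled {m t : ℕ} (h : Controlled M tr m t) :
    costPotential M m tr t = Real.exp (1 / (8 * p.Bstar) * tr.pastCost p m t) *
      (1 + tr.optValue t (tr.state t) / p.Bstar) := by
  rw [costPotential, if_neg (by rw [h.1]; exact lt_irrefl m), if_pos h]

theorem costPotential_nonneg (hp : Admissible p M) (m t : ℕ) : 0 ≤ costPotential M m tr t := by
  have hB := hp.Bstar
  have := optValue_nonneg (tr := tr) t (tr.state t)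
  unfold costPotential
  split_ifs <;> positivity

theorem pastCost_succ (m t : ℕ) : tr.pastCost p m (t + 1) =
    tr.pastCost p m t + if tr.intervalIndex p t = m then tr.loss t else 0 :=
  Finset.sum_range_succ _ _

theorem pastCost_eq_zero {m t : ℕ} (h : tr.intervalIndex p t < m) : tr.pastCost p m t = 0 := by
  refine Finset.sum_eq_zero fun i hi => if_neg ?_
  have := intervalIndex_mono (p := p) (tr := tr) (Finset.mem_range.1 hi).le
  omega

theorem costPotential_zero_le (hp : Admissible p M) (m : ℕ) : costPotential M m tr 0 ≤ 2 := by
  have hB := hp.Bstar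
  unfold costPotential
  split_ifs with h1 h2
  · exact le_rfl
  · have h3 : tr.pastCost p m 0 = 0 := rfl
    have h4 := h2.2.1 (tr.state 0)
    rw [h3, mul_zero, Real.exp_zero, one_mul]
    have : tr.optValue 0 (tr.state 0) / p.Bstar ≤ 1 := by
      rw [div_le_one (by linarith)]; exact h4
    linarith
  · norm_num

/-- The loss of an interval, up to a step of it. -/
theorem sum_Icc_intervalStart (t : ℕ) : ∑ i ∈ Finset.Icc (tr.intervalStart p t) t, tr.loss i =
    tr.pastCost p (tr.intervalIndex p t) t + tr.loss t := by
  have h : tr.pastCost p (tr.intervalIndex p t) t + tr.loss t =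
      tr.pastCost p (tr.intervalIndex p t) (t + 1) := by
    rw [pastCost_succ, if_pos rfl]
  rw [h, pastCost, ← Finset.sum_filter]
  refine Finset.sum_congr ?_ fun _ _ => rfl
  ext i
  simp only [Finset.mem_Icc, Finset.mem_filter, Finset.mem_range, Nat.lt_succ_iff]
  constructor
  · rintro ⟨h1, h2⟩
    exact ⟨h2, (intervalStart_le_iff h2).1 h1⟩
  · rintro ⟨h1, h2⟩
    exact ⟨(intervalStart_le_iff h1).2 h2, h1⟩

/-- An interval of large loss makes `costPotential` large. -/
theorem IsRun.le_costPotential (hr : tr.IsRun p M) (hp : Admissible p M) {t : ℕ}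
    (h2 : 2 ≤ tr.intervalIndex p t)
    (hL : ∀ n s a, M.Lstar s a ∈ tr.lossConf p n s a)
    (hP : ∀ n s a, M.Pstar s a ∈ tr.dynConf p n s a)
    (h : 48 * p.Bstar * Real.log (4 * tr.intervalIndex p t / p.delta) <
      ∑ i ∈ Finset.Icc (tr.intervalStart p t) t, tr.loss i) :
    2 * Real.exp (2 * Real.log (4 * tr.intervalIndex p t / p.delta)) ≤
      costPotential M (tr.intervalIndex p t) tr t := by
  have hB := hp.Bstar
  rw [sum_Icc_intervalStart] at h
  have hc : Controlled M tr (tr.intervalIndex p t) t := by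
    refine ⟨rfl, hr.boundedAt hp h2 (hL _) (hP _), fun i hi hie => ?_⟩
    refine hr.driftAt hp (by rw [hie]; exact h2) (hL _) (hP _) ?_
    by_contra hk
    exact not_endsAt_of_intervalIndex_eq hi hie (Or.inr hk)
  rw [costPotential_of_controlled hc]
  have hL8 : Real.log 8 ≤ Real.log (4 * tr.intervalIndex p t / p.delta) := by
    refine log_eight_le hp ?_
    have : (2 : ℝ) ≤ tr.intervalIndex p t := by exact_mod_cast h2
    linarith
  set L := Real.log (4 * tr.intervalIndex p t / p.delta)
  have h3 := two_lt_log_eight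
  have h4 := (hr.loss_mem t).2
  -- the loss before step `t` exceeds `48 B L - 1`, and `L > 2`
  have h5 : 2 * L + 1 ≤ 1 / (8 * p.Bstar) * tr.pastCost p (tr.intervalIndex p t) t := by
    rw [div_mul_eq_mul_div, one_mul, le_div_iff₀ (by linarith)]
    nlinarith
  have h6 : (2 : ℝ) ≤ Real.exp 1 := by linarith [Real.add_one_le_exp (1 : ℝ)]
  have h7 : 0 ≤ tr.optValue t (tr.state t) / p.Bstar :=
    div_nonneg (optValue_nonneg _ _) (by linarith)
  calc 2 * Real.exp (2 * L) ≤ Real.exp (2 * L) * Real.exp 1 := by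
        nlinarith [Real.exp_pos (2 * L)]
    _ = Real.exp (2 * L + 1) := (Real.exp_add _ _).symm
    _ ≤ Real.exp (1 / (8 * p.Bstar) * tr.pastCost p (tr.intervalIndex p t) t) :=
        Real.exp_le_exp.2 h5
    _ ≤ _ := le_mul_of_one_le_right (Real.exp_pos _).le (by linarith)

open Classical in
/-- The weight of step `t` in the increment of `costPotential`: the exponential factor, if the
process is still running and drifts downwards at step `t`. -/
noncomputable def costWeight (M : LinearCSSP S A d p.lmin) (m : ℕ) (tr : Trajectory S A d)
    (t : ℕ) : ℝ :=
  if Controlled M tr m t ∧ DriftAt M tr t then Real.exp (1 / (8 * p.Bstar) * tr.pastCost p m t)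
  else 0

theorem costWeight_nonneg (m t : ℕ) : 0 ≤ costWeight M m tr t := by
  unfold costWeight
  split_ifs <;> positivity

/-- `exp θ - 1 ≤ 2 θ` for `θ = 1 / (8 B)`. -/
theorem exp_sub_one_le (hp : Admissible p M) :
    Real.exp (1 / (8 * p.Bstar)) - 1 ≤ 1 / (4 * p.Bstar) := by
  have hB := hp.Bstar
  have h0 : 0 ≤ 1 / (8 * p.Bstar) := by positivity
  have h1 : 1 / (8 * p.Bstar) ≤ 1 := by
    rw [div_le_one (by positivity)]; linarith
  have h2 := Real.abs_exp_sub_one_le (x := 1 / (8 * p.Bstar)) (by rwa [abs_of_nonneg h0])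
  rw [abs_of_nonneg h0] at h2
  refine (le_abs_self _).trans (h2.trans (le_of_eq ?_))
  field_simp
  norm_num

/-- The next value of `costPotential` is at most affine in the loss and in the indicators of the
next state, with coefficients known before the step. -/
theorem IsRun.costPotential_succ_le (hr : tr.IsRun p M) (hp : Admissible p M) (m t : ℕ) :
    costPotential M m tr (t + 1) ≤
      ((if tr.intervalIndex p t < m then 2 else 0) + costWeight M m tr t) +
      (costWeight M m tr t * (2 * (Real.exp (1 / (8 * p.Bstar)) - 1)) * tr.loss t +
        ∑ s', costWeight M m tr t * (tr.optValue t s' / p.Bstar) *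
          if tr.next t = some s' then 1 else 0) := by
  have hB := hp.Bstar
  have hW := costWeight_nonneg (M := M) (tr := tr) m t
  have he : 0 ≤ Real.exp (1 / (8 * p.Bstar)) - 1 := by
    have := Real.add_one_le_exp (1 / (8 * p.Bstar))
    have : 0 ≤ 1 / (8 * p.Bstar) := by positivity
    linarith
  have hl := hr.loss_mem t
  have hl0 : 0 ≤ tr.loss t := hp.lmin_pos.le.trans hl.1
  have hsum : 0 ≤ ∑ s', costWeight M m tr t * (tr.optValue t s' / p.Bstar) *
      if tr.next t = some s' then (1 : ℝ) else 0 := by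
    refine Finset.sum_nonneg fun s' _ => ?_
    have := optValue_nonneg (tr := tr) t s'
    split_ifs <;> positivity
  have hmid : 0 ≤ costWeight M m tr t * (2 * (Real.exp (1 / (8 * p.Bstar)) - 1)) * tr.loss t := by
    positivity
  have hind : (0 : ℝ) ≤ if tr.intervalIndex p t < m then 2 else 0 := by split_ifs <;> norm_num
  have hmono : tr.intervalIndex p t ≤ tr.intervalIndex p (t + 1) :=
    intervalIndex_mono (Nat.le_succ t)
  by_cases h1 : tr.intervalIndex p (t + 1) < m
  · rw [costPotential_of_lt h1, if_pos (lt_of_le_of_lt hmono h1)]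
    linarith
  by_cases h2 : Controlled M tr m (t + 1)
  swap
  · rw [costPotential, if_neg h1, if_neg h2]
    linarith
  rw [costPotential_of_controlled h2]
  have hw1 : tr.optValue (t + 1) (tr.state (t + 1)) / p.Bstar ≤ 1 := by
    rw [div_le_one (by linarith)]; exact h2.2.1 _
  by_cases h3 : tr.intervalIndex p t < m
  · -- the interval begins at step `t + 1`
    rw [pastCost_succ, pastCost_eq_zero h3, if_neg h3.ne, add_zero, mul_zero, Real.exp_zero,
      one_mul, if_pos h3]
    linarith
  have h4 : tr.intervalIndex p t = m := by have := h2.1; omega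
  have hne : ¬ tr.EndsAt p t :=
    not_endsAt_of_intervalIndex_eq (Nat.lt_succ_self t) (h4.trans h2.1.symm)
  have hopt := hr.optValue_succ_of_not_endsAt hne
  have hnext := hr.next_eq_of_not_endsAt hne
  have hc : Controlled M tr m t ∧ DriftAt M tr t := by
    refine ⟨⟨h4, fun s => ?_, fun i hi => h2.2.2 i (hi.trans (Nat.lt_succ_self t))⟩,
      h2.2.2 t (Nat.lt_succ_self t) h4⟩
    rw [← hopt]; exact h2.2.1 s
  have hWe : costWeight M m tr t = Real.exp (1 / (8 * p.Bstar) * tr.pastCost p m t) := if_pos hc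
  have hsum2 : ∑ s', costWeight M m tr t * (tr.optValue t s' / p.Bstar) *
      (if tr.next t = some s' then (1 : ℝ) else 0) =
      costWeight M m tr t * (tr.optValue t (tr.state (t + 1)) / p.Bstar) := by
    simp [hnext]
  rw [hsum2, if_neg h3, pastCost_succ, if_pos h4, mul_add (1 / _), Real.exp_add, ← hWe, hopt]
  rw [hopt] at hw1
  have hw0 : 0 ≤ tr.optValue t (tr.state (t + 1)) / p.Bstar :=
    div_nonneg (optValue_nonneg _ _) (by linarith)
  have hchord := exp_quadratic_le_chord (p := 1 / (8 * p.Bstar)) (m := 0) le_rfl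
    (⟨hl0, hl.2⟩ : tr.loss t ∈ Set.Icc (0 : ℝ) 1)
  simp only [sub_zero, neg_zero, mul_zero, zero_mul, add_zero, Real.exp_zero, mul_one] at hchord
  set w := tr.optValue t (tr.state (t + 1)) / p.Bstar
  set e := Real.exp (1 / (8 * p.Bstar))
  -- `exp (θ x) ≤ 1 + (exp θ - 1) x` by convexity, and `1 + w ≤ 2`
  have h5 : Real.exp (1 / (8 * p.Bstar) * tr.loss t) * (1 + w) ≤
      1 + 2 * (e - 1) * tr.loss t + w := by
    have h6 : Real.exp (1 / (8 * p.Bstar) * tr.loss t) * (1 + w) ≤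
        (1 + (e - 1) * tr.loss t) * (1 + w) := by
      refine mul_le_mul_of_nonneg_right ?_ (by linarith)
      linarith
    have h7 : 0 ≤ (e - 1) * tr.loss t * (1 - w) :=
      mul_nonneg (mul_nonneg he hl0) (by linarith)
    linarith
  have h8 := mul_le_mul_of_nonneg_left h5 hW
  linarith

/-- The expectation of the affine upper bound does not exceed the current value, by the drift. -/
theorem IsRun.costPotential_mean_le (hr : tr.IsRun p M) (hp : Admissible p M) (m t : ℕ) :
    ((if tr.intervalIndex p t < m then 2 else 0) + costWeight M m tr t) +
      (costWeight M m tr t * (2 * (Real.exp (1 / (8 * p.Bstar)) - 1)) *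
          M.meanLoss (tr.ctx t) (tr.state t) (tr.act t) +
        ∑ s', costWeight M m tr t * (tr.optValue t s' / p.Bstar) *
          M.dyn (tr.ctx t) (tr.state t) (tr.act t) s') ≤ costPotential M m tr t := by
  have hB := hp.Bstar
  by_cases h1 : Controlled M tr m t ∧ DriftAt M tr t
  · have h2 : ¬ tr.intervalIndex p t < m := by rw [h1.1.1]; exact lt_irrefl m
    have hWe : costWeight M m tr t = Real.exp (1 / (8 * p.Bstar) * tr.pastCost p m t) := if_pos h1
    rw [if_neg h2, costPotential_of_controlled h1.1, ← hWe, zero_add]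
    have hW := costWeight_nonneg (M := M) (tr := tr) m t
    have hd : DriftAt M tr t := h1.2
    unfold DriftAt at hd
    have hsum : ∑ s', costWeight M m tr t * (tr.optValue t s' / p.Bstar) *
          M.dyn (tr.ctx t) (tr.state t) (tr.act t) s' = costWeight M m tr t *
        ((∑ s', M.dyn (tr.ctx t) (tr.state t) (tr.act t) s' * tr.optValue t s') / p.Bstar) := by
      rw [Finset.sum_div, Finset.mul_sum]
      refine Finset.sum_congr rfl fun s' _ => ?_
      ring
    have hml : 0 ≤ M.meanLoss (tr.ctx t) (tr.state t) (tr.act t) :=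
      hp.lmin_pos.le.trans (M.meanLoss_mem (hr.ctx_mem t) _ _).1
    have h3 : 2 * (Real.exp (1 / (8 * p.Bstar)) - 1) *
        M.meanLoss (tr.ctx t) (tr.state t) (tr.act t) ≤
        3 / 5 * M.meanLoss (tr.ctx t) (tr.state t) (tr.act t) / p.Bstar := by
      have h4 : 2 * (1 / (4 * p.Bstar)) ≤ 3 / 5 / p.Bstar := by
        rw [mul_one_div, div_le_div_iff₀ (by positivity) (by positivity)]
        linarith
      have h5 := mul_le_mul_of_nonneg_right
        ((mul_le_mul_of_nonneg_left (exp_sub_one_le hp) zero_le_two).trans h4) hml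
      rwa [div_mul_eq_mul_div] at h5
    have h6 := div_le_div_of_nonneg_right hd (by linarith : 0 ≤ p.Bstar)
    rw [add_div] at h6
    rw [hsum]
    have h7 := mul_le_mul_of_nonneg_left (show
      2 * (Real.exp (1 / (8 * p.Bstar)) - 1) * M.meanLoss (tr.ctx t) (tr.state t) (tr.act t) +
        (∑ s', M.dyn (tr.ctx t) (tr.state t) (tr.act t) s' * tr.optValue t s') / p.Bstar ≤
      tr.optValue t (tr.state t) / p.Bstar by linarith) hW
    linarith
  · have hWe : costWeight M m tr t = 0 := if_neg h1
    rw [hWe]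
    simp only [zero_mul, Finset.sum_const_zero, add_zero]
    split_ifs with h2
    · rw [costPotential_of_lt h2]
    · exact costPotential_nonneg hp m t

end Trajectory

/-! ### Probabilities of the noise events -/

section Sum

variable {Ω : Type*} {mΩ : MeasurableSpace Ω} {μ : Measure Ω} [IsProbabilityMeasure μ]

/-- A sum of variables with total at most `1`, weighted by known weights in `[0,1]`. -/
theorem HasCondMean.sum_mul {ι : Type*} [Fintype ι] {𝓖 : MeasurableSpace Ω} (h𝓖 : 𝓖 ≤ mΩ)
    {X m W : ι → Ω → ℝ} (h : ∀ i, HasCondMean μ 𝓖 (X i) (m i)) (hW : ∀ i, Measurable[𝓖] (W i))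
    (hW01 : ∀ i ω, W i ω ∈ Set.Icc (0 : ℝ) 1) (hX : ∀ ω, ∑ i, X i ω ≤ 1)
    (hm : ∀ ω, ∑ i, m i ω ≤ 1) :
    HasCondMean μ 𝓖 (fun ω => ∑ i, W i ω * X i ω) fun ω => ∑ i, W i ω * m i ω where
  meas := Finset.measurable_fun_sum _ fun i _ => ((hW i).mono h𝓖 le_rfl).mul (h i).meas
  mem ω := ⟨Finset.sum_nonneg fun i _ => mul_nonneg (hW01 i ω).1 ((h i).mem ω).1,
    (Finset.sum_le_sum fun i _ => mul_le_of_le_one_left ((h i).mem ω).1 (hW01 i ω).2).trans (hX ω)⟩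
  meas_mean := Finset.measurable_fun_sum _ fun i _ => (hW i).mul (h i).meas_mean
  mem_mean ω := ⟨Finset.sum_nonneg fun i _ => mul_nonneg (hW01 i ω).1 ((h i).mem_mean ω).1,
    (Finset.sum_le_sum fun i _ =>
      mul_le_of_le_one_left ((h i).mem_mean ω).1 (hW01 i ω).2).trans (hm ω)⟩
  condExp := by
    have hXi : ∀ i, Integrable (X i) μ := fun i =>
      Integrable.of_mem_Icc 0 1 (h i).meas.aemeasurable (Eventually.of_forall (h i).mem)
    have hb : ∀ i, ∀ᵐ ω ∂μ, ‖W i ω‖ ≤ 1 := fun i => Eventually.of_forall fun ω => by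
      rw [Real.norm_eq_abs, abs_of_nonneg (hW01 i ω).1]; exact (hW01 i ω).2
    have hWi : ∀ i ∈ Finset.univ, Integrable (W i * X i) μ := fun i _ =>
      (hXi i).bdd_mul ((hW i).mono h𝓖 le_rfl).aestronglyMeasurable (hb i)
    have h1 := condExp_finsetSum hWi 𝓖
    have h2 : ∀ i, μ[W i * X i | 𝓖] =ᵐ[μ] W i * μ[X i | 𝓖] := fun i =>
      condExp_stronglyMeasurable_mul_of_bound h𝓖 (hW i).stronglyMeasurable (hXi i) 1 (hb i)
    have e : (fun ω => ∑ i, W i ω * X i ω) = ∑ i, W i * X i := by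
      funext ω; simp [Finset.sum_apply]
    rw [e]
    filter_upwards [h1, ae_all_iff.2 h2, ae_all_iff.2 fun i => (h i).condExp] with ω h3 h4 h5
    rw [h3, Finset.sum_apply]
    exact Finset.sum_congr rfl fun i _ => by rw [h4, Pi.mul_apply, h5]

theorem exp_neg_two_log_le {δ : ℝ} (hδ0 : 0 < δ) (hδ1 : δ < 1) {n : ℕ} (hn : 1 ≤ n) :
    Real.exp (-(2 * Real.log (4 * n / δ))) ≤ δ / 16 * (1 / (n : ℝ) ^ 2) := by
  have hn0 : (0 : ℝ) < n := by exact_mod_cast hn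
  have e : Real.exp (-(2 * Real.log (4 * n / δ))) = (δ / (4 * n)) ^ 2 := by
    rw [show -(2 * Real.log (4 * n / δ)) = (2 : ℕ) * Real.log (4 * n / δ)⁻¹ by
      rw [Real.log_inv]; push_cast; ring, ← Real.log_pow, Real.exp_log (by positivity), inv_div]
  rw [e, div_pow, mul_pow, div_mul_div_comm, mul_one]
  norm_num
  gcongr
  nlinarith

/-- A union bound with probabilities proportional to `1 / n²`. -/
theorem measure_exists_le_of_sq {E : ℕ → Set Ω} {δ : ℝ} (hδ : 0 < δ)
    (h : ∀ n, μ (E n) ≤ ENNReal.ofReal (δ / 16 * (1 / (n : ℝ) ^ 2))) :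
    μ {ω | ∃ n, ω ∈ E n} ≤ ENNReal.ofReal (δ / 8) := by
  have hs := hasSum_zeta_two.mul_left (δ / 16)
  rw [show {ω | ∃ n, ω ∈ E n} = ⋃ n, E n by ext; simp]
  refine (measure_iUnion_le E).trans ((ENNReal.tsum_le_tsum h).trans ?_)
  rw [← ENNReal.ofReal_tsum_of_nonneg (fun n => by positivity) hs.summable, hs.tsum_eq]
  refine ENNReal.ofReal_le_ofReal ?_
  have : Real.pi ^ 2 ≤ 12 := by nlinarith [Real.pi_lt_d2, Real.pi_pos]
  nlinarith

end Sum

namespace IsRandomRun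

open Trajectory

variable {S A : Type*} [Fintype S] [DecidableEq S] [Fintype A] [DecidableEq A]
  {d : ℕ} {Ω : Type*} {mΩ : MeasurableSpace Ω} {μ : Measure Ω} {F : Filtration ℕ mΩ}
  {p : Params} {M : LinearCSSP S A d p.lmin} {tr : Ω → Trajectory S A d}

theorem pastCost_meas (h : IsRandomRun μ F p M tr) (m t : ℕ) :
    Measurable[F t] fun ω => (tr ω).pastCost p m t := by
  refine Finset.measurable_fun_sum _ fun i hi => ?_
  have hi' := Finset.mem_range.1 hi
  exact Measurable.ite (F.mono hi'.le _ (h.intervalIndex_meas i (· = m)))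
    ((h.loss_meas i).mono (F.mono hi') le_rfl) measurable_const

theorem controlled_meas (h : IsRandomRun μ F p M tr) (m t : ℕ) :
    MeasurableSet[F t] {ω | Controlled M (tr ω) m t} := by
  refine (h.intervalIndex_meas t (· = m)).inter ((h.boundedAt_meas t).inter ?_)
  have e : {ω | ∀ i < t, (tr ω).intervalIndex p i = m → DriftAt M (tr ω) i} =
      ⋂ i, ⋂ (_ : i < t), ({ω | (tr ω).intervalIndex p i = m}ᶜ ∪ {ω | DriftAt M (tr ω) i}) := by
    ext ω
    simp [imp_iff_not_or]
  change MeasurableSet[F t] {ω | ∀ i < t, (tr ω).intervalIndex p i = m → DriftAt M (tr ω) i}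
  rw [e]
  exact MeasurableSet.iInter fun i => MeasurableSet.iInter fun hi =>
    (F.mono hi.le _ (h.intervalIndex_meas i (· = m))).compl.union
      (F.mono hi.le _ (h.driftAt_meas i))

theorem costWeight_meas (h : IsRandomRun μ F p M tr) (m t : ℕ) :
    Measurable[F t] fun ω => costWeight M m (tr ω) t := by
  unfold costWeight
  exact Measurable.ite ((h.controlled_meas m t).inter (h.driftAt_meas t))
    (Real.measurable_exp.comp (measurable_const.mul (h.pastCost_meas m t))) measurable_const

theorem costPotential_meas (h : IsRandomRun μ F p M tr) (m t : ℕ) :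
    Measurable[F t] fun ω => costPotential M m (tr ω) t := by
  unfold costPotential
  exact Measurable.ite (h.intervalIndex_meas t (· < m)) measurable_const
    (Measurable.ite (h.controlled_meas m t)
      ((Real.measurable_exp.comp (measurable_const.mul (h.pastCost_meas m t))).mul
        (measurable_const.add ((h.optValue_state_meas t).div_const _))) measurable_const)

variable [IsProbabilityMeasure μ]

theorem costPotential_isNonnegSuper (h : IsRandomRun μ F p M tr) (hp : Admissible p M) (m : ℕ) :
    IsNonnegSuper μ F fun t ω => costPotential M m (tr ω) t where
  measurable := h.costPotential_meas m
  step t B hB := by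
    have hB1 := hp.Bstar
    have he : 0 ≤ Real.exp (1 / (8 * p.Bstar)) - 1 := by
      have := Real.add_one_le_exp (1 / (8 * p.Bstar))
      have : 0 ≤ 1 / (8 * p.Bstar) := by positivity
      linarith
    refine lintegral_step_le (F.le t) (ι := Option S)
      (X := fun o => o.elim (fun ω => (tr ω).loss t) fun s' => nextInd tr s' t)
      (m := fun o => o.elim (fun ω => M.meanLoss ((tr ω).ctx t) ((tr ω).state t) ((tr ω).act t))
        fun s' ω => M.dyn ((tr ω).ctx t) ((tr ω).state t) ((tr ω).act t) s')
      (H := fun o => o.elim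
        (fun ω => costWeight M m (tr ω) t * (2 * (Real.exp (1 / (8 * p.Bstar)) - 1)))
        fun s' ω => costWeight M m (tr ω) t * ((tr ω).optValue t s' / p.Bstar))
      (g := fun ω => (if (tr ω).intervalIndex p t < m then 2 else 0) + costWeight M m (tr ω) t)
      ?_ ?_ ?_ ?_ ?_ ?_ ?_ hB
    · rintro (_ | s')
      · exact h.hasCondMean_loss hp t
      · exact h.hasCondMean_next s' t
    · exact (Measurable.ite (h.intervalIndex_meas t (· < m)) measurable_const
        measurable_const).add (h.costWeight_meas m t)
    · intro ω
      have := costWeight_nonneg (M := M) (tr := tr ω) m t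
      have : (0 : ℝ) ≤ if (tr ω).intervalIndex p t < m then 2 else 0 := by
        split_ifs <;> norm_num
      linarith
    · rintro (_ | s')
      · exact (h.costWeight_meas m t).mul measurable_const
      · exact (h.costWeight_meas m t).mul ((h.optValue_meas t s').div_const _)
    · rintro (_ | s') ω
      · exact mul_nonneg (costWeight_nonneg _ _) (by linarith)
      · exact mul_nonneg (costWeight_nonneg _ _) (div_nonneg (optValue_nonneg _ _) (by linarith))
    · intro ω
      simp only [Fintype.sum_option, Option.elim_none, Option.elim_some, nextInd_apply]
      exact (h.isRun ω).costPotential_succ_le hp m t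
    · intro ω
      simp only [Fintype.sum_option, Option.elim_none, Option.elim_some]
      exact (h.isRun ω).costPotential_mean_le hp m t

/-- With probability at least `1 - δ / 8`, no `costPotential` reaches its threshold; intervals of
large loss are then impossible while the confidence sets are correct, by
`IsRun.le_costPotential`. -/
theorem measure_costPotential_le (h : IsRandomRun μ F p M tr) (hp : Admissible p M) :
    μ {ω | ∃ m : ℕ, ω ∈ {ω | 1 ≤ m ∧ ∃ t, 2 * Real.exp (2 * Real.log (4 * m / p.delta)) ≤
      costPotential M m (tr ω) t}} ≤ ENNReal.ofReal (p.delta / 8) := by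
  refine measure_exists_le_of_sq hp.delta_pos fun m => ?_
  by_cases hm : 1 ≤ m
  · simp only [hm, true_and]
    refine ((h.costPotential_isNonnegSuper hp m).measure_exists_le (by positivity)
      fun ω => costPotential_zero_le hp m).trans (ENNReal.ofReal_le_ofReal ?_)
    refine le_trans (le_of_eq ?_) (exp_neg_two_log_le hp.delta_pos hp.delta_lt hm)
    rw [Real.exp_neg, div_mul_cancel_left₀ two_ne_zero]
  · simp [hm]

open Classical in
/-- The optimistic value of `s'` at step `t`, divided by `Bstar`; it is replaced by `0` in the first
interval and where the optimistic values exceed `Bstar`, so that it always lies in `[0,1]`. -/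
noncomputable def scaledValue (p : Params) (tr : Ω → Trajectory S A d) (t : ℕ) (s' : S) (ω : Ω) :
    ℝ :=
  if 2 ≤ (tr ω).intervalIndex p t ∧ (tr ω).BoundedAt p t then (tr ω).optValue t s' / p.Bstar else 0

theorem sum_nextInd (tr : Ω → Trajectory S A d) (f : S → ℝ) (t : ℕ) (ω : Ω) :
    ∑ s', f s' * nextInd tr s' t ω = ((tr ω).next t).elim 0 f := by
  simp only [nextInd_apply]
  cases hn : (tr ω).next t <;> simp

theorem hasCondMean_scaledValue (h : IsRandomRun μ F p M tr) (hp : Admissible p M) (t : ℕ) :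
    HasCondMean μ (F t) (fun ω => ∑ s', scaledValue p tr t s' ω * nextInd tr s' t ω)
      fun ω => ∑ s', scaledValue p tr t s' ω *
        M.dyn ((tr ω).ctx t) ((tr ω).state t) ((tr ω).act t) s' := by
  have hB := hp.Bstar
  refine HasCondMean.sum_mul (F.le t) (fun s' => h.hasCondMean_next s' t) (fun s' => ?_)
    (fun s' ω => ?_) (fun ω => ?_) fun ω =>
      (M.dyn_mem ((h.isRun ω).ctx_mem t) ((tr ω).state t) ((tr ω).act t)).2
  · exact Measurable.ite ((h.intervalIndex_meas t (2 ≤ ·)).inter (h.boundedAt_meas t))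
      ((h.optValue_meas t s').div_const _) measurable_const
  · unfold scaledValue
    split_ifs with hc
    · refine ⟨div_nonneg (optValue_nonneg _ _) (by linarith), ?_⟩
      rw [div_le_one (by linarith)]
      exact hc.2 s'
    · simp
  · have := sum_nextInd tr (fun _ => (1 : ℝ)) t ω
    simp only [one_mul] at this
    rw [this]
    cases (tr ω).next t <;> simp

/-- The Azuma-Hoeffding bound for the value noise, for all numbers of steps. -/
theorem measure_valueNoise_le (h : IsRandomRun μ F p M tr) (hp : Admissible p M) :
    μ {ω | ∃ n : ℕ, ω ∈ {ω | 1 ≤ n ∧ Real.sqrt (n * Real.log (4 * n / p.delta)) <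
      ∑ t ∈ Finset.range n, (∑ s', scaledValue p tr t s' ω * nextInd tr s' t ω -
        ∑ s', scaledValue p tr t s' ω *
          M.dyn ((tr ω).ctx t) ((tr ω).state t) ((tr ω).act t) s')}} ≤
      ENNReal.ofReal (p.delta / 8) := by
  refine measure_exists_le_of_sq hp.delta_pos fun n => ?_
  by_cases hn : 1 ≤ n
  · simp only [hn, true_and]
    have hn0 : (0 : ℝ) < n := by exact_mod_cast hn
    refine (measure_sum_ge_le (h.hasCondMean_scaledValue hp) (fun t => ?_) hn
      (Real.sqrt_nonneg _)).trans (ENNReal.ofReal_le_ofReal ?_)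
    · refine Finset.measurable_fun_sum _ fun s' _ => ?_
      exact ((Measurable.ite ((h.intervalIndex_meas t (2 ≤ ·)).inter (h.boundedAt_meas t))
        ((h.optValue_meas t s').div_const _) measurable_const).mono (F.mono (Nat.le_succ t))
          le_rfl).mul (h.nextInd_meas s' t)
    · refine le_trans (le_of_eq ?_) (exp_neg_two_log_le hp.delta_pos hp.delta_lt hn)
      have hlog : 0 ≤ Real.log (4 * n / p.delta) := by
        refine Real.log_nonneg ?_
        rw [le_div_iff₀ hp.delta_pos]
        have : (1 : ℝ) ≤ n := by exact_mod_cast hn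
        linarith [hp.delta_lt]
      rw [Real.sq_sqrt (by positivity)]
      congr 2
      field_simp
  · simp [hn]

/-- Where the optimistic values are bounded, the sum of the scaled values is the value noise. -/
theorem sum_valueNoise_eq (hp : Admissible p M) {ω : Ω} (n : ℕ)
    (hb : ∀ t, 2 ≤ (tr ω).intervalIndex p t → (tr ω).BoundedAt p t) :
    ∑ t ∈ (Finset.range n).filter (fun t => 2 ≤ (tr ω).intervalIndex p t),
      (tr ω).valueNoise M t = p.Bstar *
    ∑ t ∈ Finset.range n, (∑ s', scaledValue p tr t s' ω * nextInd tr s' t ω -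
        ∑ s', scaledValue p tr t s' ω *
          M.dyn ((tr ω).ctx t) ((tr ω).state t) ((tr ω).act t) s') := by
  have hB : p.Bstar ≠ 0 := by linarith [hp.Bstar]
  rw [Finset.sum_filter, Finset.mul_sum]
  refine Finset.sum_congr rfl fun t _ => ?_
  split_ifs with h2
  · have hs : ∀ s', scaledValue p tr t s' ω = (tr ω).optValue t s' / p.Bstar := fun s' =>
      if_pos ⟨h2, hb t h2⟩
    simp only [hs]
    have hn : (tr ω).valueNoise M t = ∑ s', (tr ω).optValue t s' * nextInd tr s' t ω -
        ∑ s', M.dyn ((tr ω).ctx t) ((tr ω).state t) ((tr ω).act t) s' * (tr ω).optValue t s' := by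
      rw [sum_nextInd]
      cases hn : (tr ω).next t with
      | none => exact valueNoise_of_none hn
      | some s' => exact valueNoise_of_some hn
    rw [hn, mul_sub, Finset.mul_sum, Finset.mul_sum]
    congr 1 <;> refine Finset.sum_congr rfl fun s' _ => ?_ <;> field_simp
  · have hs : ∀ s', scaledValue p tr t s' ω = 0 := fun s' => if_neg fun hc => h2 hc.1
    simp [hs]

end IsRandomRun

/-! ### The probability of the high-probability event -/

namespace IsRandomRun

open Trajectory

variable {S A : Type*} [Fintype S] [DecidableEq S] [Fintype A] [DecidableEq A]
  {d : ℕ} {Ω : Type*} {mΩ : MeasurableSpace Ω} {μ : Measure Ω} {F : Filtration ℕ mΩ}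
  {p : Params} {M : LinearCSSP S A d p.lmin} {tr : Ω → Trajectory S A d}

/-- The two concentration events, together with the confidence sets at all times, imply the
high-probability event for every number of episodes. -/
theorem hpe_of_good (h : IsRandomRun μ F p M tr) (hp : Admissible p M) (hlam : p.lam = 1) {ω : Ω}
    (hL : ∀ n s a, M.Lstar s a ∈ (tr ω).lossConf p n s a)
    (hP : ∀ n s a, M.Pstar s a ∈ (tr ω).dynConf p n s a)
    (hC : ∀ m : ℕ, 1 ≤ m → ∀ t,
      costPotential M m (tr ω) t < 2 * Real.exp (2 * Real.log (4 * m / p.delta)))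
    (hN : ∀ n : ℕ, 1 ≤ n → ∑ t ∈ Finset.range n,
        (∑ s', scaledValue p tr t s' ω * nextInd tr s' t ω - ∑ s', scaledValue p tr t s' ω *
          M.dyn ((tr ω).ctx t) ((tr ω).state t) ((tr ω).act t) s') ≤
      Real.sqrt (n * Real.log (4 * n / p.delta))) (K : ℕ) : (tr ω).HPE p M K where
  loss_conf t _ := hL _
  dyn_conf t _ := hP _
  interval_cost t _ := by
    rcases (one_le_intervalIndex (p := p) (tr := tr ω) t).eq_or_lt with h1 | h2
    · exact (h.isRun ω).cost_first_interval_le hp hlam h1.symm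
    · by_contra hcon
      exact absurd ((h.isRun ω).le_costPotential hp h2 hL hP (not_le.1 hcon))
        (not_le.2 (hC _ (one_le_two.trans h2) t))
  value_noise n _ := by
    rw [sum_valueNoise_eq hp n fun t h2 => (h.isRun ω).boundedAt hp h2 (hL _) (hP _)]
    rcases Nat.eq_zero_or_pos n with rfl | hn
    · simp
    · exact mul_le_mul_of_nonneg_left (hN n hn) (by linarith [hp.Bstar])

variable [IsProbabilityMeasure μ]

/-- With probability at least `1 - δ / 8`, all loss confidence sets are correct. -/
theorem measure_exists_not_lossConf_le (h : IsRandomRun μ F p M tr) (hp : Admissible p M)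
    (hlam : p.lam = 1) :
    μ {ω | ∃ x : S × A, ∃ n, M.Lstar x.1 x.2 ∉ (tr ω).lossConf p n x.1 x.2} ≤
      ENNReal.ofReal (p.delta / 8) := by
  obtain ⟨ω⟩ := nonempty_of_isProbabilityMeasure μ
  have : Nonempty A := ⟨(tr ω).act 0⟩
  have hS := one_le_card_state M
  have hA := one_le_card_action (A := A)
  have hδ := hp.delta_pos
  rw [Set.ofPred_exists]
  refine (measure_iUnion_fintype_le μ _).trans ((Finset.sum_le_sum fun x _ =>
    h.measure_not_lossConf_le hp hlam x.1 x.2).trans (le_of_eq ?_))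
  rw [← ENNReal.ofReal_sum_of_nonneg fun _ _ => by positivity]
  congr 1
  rw [Finset.sum_const, Finset.card_univ, Fintype.card_prod, nsmul_eq_mul]
  push_cast
  field_simp

/-- With probability at least `1 - δ / 8`, all dynamics confidence sets are correct. -/
theorem measure_exists_not_dynConf_le (h : IsRandomRun μ F p M tr) (hp : Admissible p M)
    (hlam : p.lam = 1) :
    μ {ω | ∃ x : S × A, ∃ n, M.Pstar x.1 x.2 ∉ (tr ω).dynConf p n x.1 x.2} ≤
      ENNReal.ofReal (p.delta / 8) := by
  obtain ⟨ω⟩ := nonempty_of_isProbabilityMeasure μ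
  have : Nonempty A := ⟨(tr ω).act 0⟩
  have hS := one_le_card_state M
  have hA := one_le_card_action (A := A)
  have hδ := hp.delta_pos
  have hsub : {ω | ∃ x : S × A, ∃ n, M.Pstar x.1 x.2 ∉ (tr ω).dynConf p n x.1 x.2} ⊆
      ⋃ x : (S × A) × S, {ω | ∃ n, ¬ vecNorm ((tr ω).gram p n x.1.1 x.1.2)
        (M.Pstar x.1.1 x.1.2 x.2 - (tr ω).dynEstRaw p n x.1.1 x.1.2 x.2) ≤
          (tr ω).radius p n x.1.1 x.1.2} := by
    rintro ω ⟨x, n, hx⟩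
    by_contra hcon
    simp only [Set.mem_iUnion, Set.mem_ofPred_eq, not_exists, not_not] at hcon
    exact hx (dynConf_of_rows hp fun s' => hcon (x, s') n)
  refine (measure_mono hsub).trans ((measure_iUnion_fintype_le μ _).trans
    ((Finset.sum_le_sum fun x _ =>
      h.measure_not_row_le hp hlam x.1.1 x.1.2 x.2).trans (le_of_eq ?_)))
  rw [← ENNReal.ofReal_sum_of_nonneg fun _ _ => by positivity]
  congr 1
  rw [Finset.sum_const, Finset.card_univ, Fintype.card_prod, Fintype.card_prod, nsmul_eq_mul]
  push_cast
  field_simp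

theorem le_measure_hpe (h : IsRandomRun μ F p M tr) (hp : Admissible p M) (hlam : p.lam = 1)
    (K : ℕ) : ENNReal.ofReal (1 - p.delta) ≤ μ {ω | (tr ω).HPE p M K} := by
  have hδ := hp.delta_pos
  have h1 := h.measure_exists_not_lossConf_le hp hlam
  have h2 := h.measure_exists_not_dynConf_le hp hlam
  have h3 := h.measure_costPotential_le hp
  have h4 := h.measure_valueNoise_le hp
  set E₁ := {ω | ∃ x : S × A, ∃ n, M.Lstar x.1 x.2 ∉ (tr ω).lossConf p n x.1 x.2}
  set E₂ := {ω | ∃ x : S × A, ∃ n, M.Pstar x.1 x.2 ∉ (tr ω).dynConf p n x.1 x.2}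
  set E₃ := {ω | ∃ m : ℕ, ω ∈ {ω | 1 ≤ m ∧ ∃ t,
    2 * Real.exp (2 * Real.log (4 * m / p.delta)) ≤ costPotential M m (tr ω) t}} with hE₃
  set E₄ := {ω | ∃ n : ℕ, ω ∈ {ω | 1 ≤ n ∧ Real.sqrt (n * Real.log (4 * n / p.delta)) <
      ∑ t ∈ Finset.range n, (∑ s', scaledValue p tr t s' ω * nextInd tr s' t ω -
        ∑ s', scaledValue p tr t s' ω *
          M.dyn ((tr ω).ctx t) ((tr ω).state t) ((tr ω).act t) s')}} with hE₄
  have hcover : Set.univ ⊆ {ω | (tr ω).HPE p M K} ∪ (E₁ ∪ (E₂ ∪ (E₃ ∪ E₄))) := by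
    intro ω _
    by_contra hcon
    simp only [Set.mem_union, not_or] at hcon
    obtain ⟨c0, c1, c2, c3, c4⟩ := hcon
    refine c0 (h.hpe_of_good hp hlam (fun n s a => ?_) (fun n s a => ?_) (fun m hm t => ?_)
      (fun n hn => ?_) K)
    · by_contra hc
      exact c1 ⟨(s, a), n, hc⟩
    · by_contra hc
      exact c2 ⟨(s, a), n, hc⟩
    · by_contra hc
      exact c3 ⟨m, hm, t, not_lt.1 hc⟩
    · by_contra hc
      exact c4 ⟨n, hn, not_le.1 hc⟩
  have hbad : μ (E₁ ∪ (E₂ ∪ (E₃ ∪ E₄))) ≤ ENNReal.ofReal p.delta := by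
    calc μ (E₁ ∪ (E₂ ∪ (E₃ ∪ E₄))) ≤ μ E₁ + (μ E₂ + (μ E₃ + μ E₄)) :=
          (measure_union_le _ _).trans (add_le_add le_rfl ((measure_union_le _ _).trans
            (add_le_add le_rfl (measure_union_le _ _))))
      _ ≤ ENNReal.ofReal (p.delta / 8) + (ENNReal.ofReal (p.delta / 8) +
          (ENNReal.ofReal (p.delta / 8) + ENNReal.ofReal (p.delta / 8))) := by gcongr
      _ ≤ ENNReal.ofReal p.delta := by
          rw [← ENNReal.ofReal_add (by positivity) (by positivity),
            ← ENNReal.ofReal_add (by positivity) (by positivity),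
            ← ENNReal.ofReal_add (by positivity) (by positivity)]
          exact ENNReal.ofReal_le_ofReal (by linarith)
  have h5 := (measure_mono (μ := μ) hcover).trans ((measure_union_le _ _).trans
    (add_le_add le_rfl hbad))
  rw [measure_univ] at h5
  rw [ENNReal.ofReal_sub _ hδ.le, ENNReal.ofReal_one]
  exact tsub_le_iff_right.2 h5

end IsRandomRun

end LRCSSP

theorem mainTheorem3 :
    ∃ r : ℕ, ∀ lam : ℝ, 1 ≤ lam → ∃ C : ℝ, 0 < C ∧
      ∀ {S A : Type*} [Fintype S] [DecidableEq S] [Fintype A] [DecidableEq A] (d : ℕ)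
        (p : Params) (M : LinearCSSP S A d p.lmin),
        p.lam = lam → 0 < p.delta → p.delta < 1 → 0 < p.lmin → 1 ≤ p.Bstar →
        (∀ c ∈ contexts d, ∃ π : S → A, IsProper (M.dyn c) π) →
        (∀ c ∈ contexts d, ∀ s, M.optValue c s ≤ ENNReal.ofReal p.Bstar) →
        ∀ {Ω : Type*} {mΩ : MeasurableSpace Ω} (μ : Measure Ω) [IsProbabilityMeasure μ]
          (F : Filtration ℕ mΩ) (tr : Ω → Trajectory S A d), IsRandomRun μ F p M tr →
        ∀ K : ℕ,
          (lam = 1 → ENNReal.ofReal (1 - p.delta) ≤ μ {ω | (tr ω).HPE p M K}) ∧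
          ∀ ω, (tr ω).HPE p M K →
            (∀ k < K, (tr ω).Terminates k) ∧
            ∃ T : ℕ, (tr ω).totalSteps K = T ∧
              (T : ℝ) ≤ C *
                (K * p.Bstar / p.lmin +
                  (Fintype.card S : ℝ) ^ 3 * Fintype.card A * (d : ℝ) ^ 2 * p.Bstar ^ 3 /
                    p.lmin ^ 3 * (max 1 (Real.log (1 / p.delta))) ^ 2) *
                (Real.log (2 + K * Fintype.card S * Fintype.card A * d * p.Bstar / p.lmin)) ^ r := by
  refine ⟨2, fun lam hlam => ⟨Trajectory.stepsConstant lam, Trajectory.stepsConstant_pos hlam, ?_⟩⟩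
  intro S A _ _ _ _ d p M hplam hδ0 hδ1 hl hB _ hV Ω mΩ μ _ F tr h K
  have hp : Trajectory.Admissible p M := ⟨hplam ▸ hlam, hδ0, hδ1, hl, hB, hV⟩
  refine ⟨fun h1 => h.le_measure_hpe hp (hplam.trans h1) K, fun ω hω => ?_⟩
  have hn := fun n (hn : ∀ t < n, (tr ω).episode t < K) =>
    (h.isRun ω).steps_le_explicit hp hω hn
  rw [hplam] at hn
  have hN := fun n (h' : ∀ t < n, (tr ω).episode t < K) => Nat.le_floor (hn n h')
  refine ⟨fun k hk => Trajectory.terminates_of_bounded hN hk, ?_⟩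
  obtain ⟨T, hT, hT2⟩ := Trajectory.exists_totalSteps_eq hN
  exact ⟨T, hT, hn T hT2⟩
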